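/- **Notation.** A triple $(d_1,d_2,d_3)$ of distinct squarefree integers $d_i\neq 1$ is *admissible* if $d_3=d_1d_2/\gcd(d_1,d_2)^2$. It has type $h\in\{1,2,3,4\}$ if $(d_1,d_2,d_3)\bmod 4$ equals $(1,1,1)$, $(2,2,1)$, $(3,3,1)$, $(2,2,3)$ respectively. Put $m_1=6$, $m_2=m_3=m_4=2$; $\tau_1=1$, $\tau_2=\tau_3=16$, $\tau_4=64$; $T_1=1$, $T_2=64$, $T_3=16$, $T_4=256$. For $\sigma=(\varepsilon_1,\varepsilon_2)\in\{\pm1\}^2$ and real $X$ let $$B_h^\sigma(X;D_4)=\frac1{m_h}\,\#\Big\{(d_1,d_2,d_3)\ \text{admissible of type } h:\ \tau_hd_1d_2d_3\le X,\ (\operatorname{sign}d_1,\operatorname{sign}d_2)=\sigma,\ \mathbb Q(\sqrt{d_1},\sqrt{d_2},\sqrt{d_3})\ \text{admits a } D_4\text{-extension}\Big\},$$ where $K$ admits a $D_4$-extension if $K$ is contained in a Galois extension of $\mathbb Q$ whose group is dihedral of order $8$. For a tuple $\vec D=(D_{11},D_{12},D_{21},D_{22},D_{31},D_{32})$ of odd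 positive integers write $D_i=D_{i1}D_{i2}$ and put $\Delta(\vec D)=(D_1D_2D_3)^2$, $\omega(\vec D)=\omega(D_1D_2D_3)$ (number of distinct prime divisors), and, with Jacobi symbols, $$g(\vec D)=\Big(\tfrac{D_{22}D_{32}}{D_{11}}\Big)\Big(\tfrac{D_{12}D_{32}}{D_{21}}\Big)\Big(\tfrac{D_{12}D_{22}}{D_{31}}\Big).$$ The sign $\sum^\natural$ denotes a sum over tuples $\vec D$ of positive, odd, squarefree, pairwise coprime integers. For odd $a,b,c$ let $\eta(a,b)=(-1)^{\frac{a-1}2\frac{b-1}2}$ and $\Phi(a,b,c)=\eta(a,b+2)\eta(b,c+2)\eta(c,a+2)$. Let $\psi(n)=1$ if every prime divisor of $n$ is $\equiv1\pmod 4$ and $\psi(n)=0$ otherwise. Let $H=(\mathbb Z/8\mathbb Z)^\times$; an element $\vec w=(w_{11},\dots,w_{32})\in H^6$ is used in the formulas below through its representatives $w_{ij}\in\{1,3,5,7\}$, and $w_i=w_{i1}w_{i2}$. Define the detecting factors $$\delta_1^\sigma(\vec D)=\tfrac18\Big(1+\varepsilon_1\big(\tfrac{-1}{D_1D_3}\big)\Big)\Big(1+\varepsilon_2\big(\tfrac{-1}{D_2D_3}\big)\Big)\Big(1+\varepsilon_1\varepsilon_2\big(\tfrac{-1}{D_1D_2}\big)\Big),\qquad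 \delta_2^\sigma(\vec D)=\tfrac12\Big(1+\varepsilon_1\varepsilon_2\big(\tfrac{-1}{D_1D_2}\big)\Big),$$ $$\delta_3^\sigma(\vec D)=\tfrac18\Big(1-\varepsilon_1\big(\tfrac{-1}{D_1D_3}\big)\Big)\Big(1-\varepsilon_2\big(\tfrac{-1}{D_2D_3}\big)\Big)\Big(1+\varepsilon_1\varepsilon_2\big(\tfrac{-1}{D_1D_2}\big)\Big),\qquad \delta_4^\sigma(\vec D)=\tfrac12\Big(1-\varepsilon_1\varepsilon_2\big(\tfrac{-1}{D_1D_2}\big)\Big),$$ and put $u_h(\vec D)=1$, $s_h(\vec D)=1$ for $h=1,3$, and $u_h(\vec D)=\big(\tfrac{2}{D_{11}D_{21}}\big)$, $s_h(\vec D)=\big(\tfrac{2}{D_1D_2}\big)$ for $h=2,4$. Let $$\begin{aligned}f_h^\sigma(\vec w)=\ &\delta_h^\sigma(\vec w)\Big(\tfrac{\varepsilon_1}{w_{21}w_{31}}\Big)\Big(\tfrac{\varepsilon_2}{w_{11}w_{31}}\Big)u_h(\vec w)\,\Phi(w_{11},w_{21},w_{31})\\ &\times\Big\{\mathbf 1_{\sigma\ne(1,-1)}\tfrac12\big(1+\eta(\varepsilon_1w_1w_3+2,\varepsilon_2w_2w_3)s_h(\vec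 w)\big)\big(\tfrac{-1}{w_{11}w_{31}}\big)\\ &\quad+\mathbf 1_{\sigma\ne(-1,1)}\tfrac12\big(1+\eta(\varepsilon_1w_1w_3,\varepsilon_2w_2w_3+2)s_h(\vec w)\big)\big(\tfrac{-1}{w_{21}w_{31}}\big)\\ &\quad+\mathbf 1_{\sigma\ne(-1,-1)}\tfrac12\big(1+\eta(\varepsilon_1w_1w_3,\varepsilon_2w_2w_3)s_h(\vec w)\big)\big(\tfrac{-1}{w_{11}w_{21}}\big)\Big\},\end{aligned}$$ $$\begin{aligned}r_h^\sigma(\vec D)=\ &\delta_h^\sigma(\vec D)\,\tfrac12\big(1+s_h(\vec D)\big)\,u_h(\vec D)\Big\{-\mathbf 1_{\varepsilon_1=\varepsilon_2}\,\psi(D_1D_2)-\mathbf 1_{\varepsilon_2=1}\,\psi(D_2D_3)\\ &-\mathbf 1_{\varepsilon_1=1}\,\psi(D_1D_3)+\mathbf 1_{\sigma=(1,1)}\,\psi(D_1D_2D_3)\Big\}.\end{aligned}$$ **Proposition.** There is an absolute constant $C$ such that for all $h\in\{1,2,3,4\}$, $\sigma\in\{\pm1\}^2$ and real $X\ge1$,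 $$\Bigg|B_h^\sigma(X;D_4)-\frac1{m_h}\sum_{\vec w\in H^6}f_h^\sigma(\vec w)\sum^{\natural}_{\substack{\Delta(\vec D)\le X/T_h\\ \vec D\equiv\vec w\,(8)}}2^{-\omega(\vec D)}g(\vec D)-\frac1{m_h}\sum^{\natural}_{\Delta(\vec D)\le X/T_h}r_h^\sigma(\vec D)\,2^{-\omega(\vec D)}g(\vec D)\Bigg|\le C\sqrt X .$$ Moreover $f_h^\sigma$ is integer-valued with $|f_h^\sigma(\vec w)|\le3$ for all $\vec w\in H^6$, and $r_h^\sigma$ is integer-valued with $|r_h^\sigma(\vec D)|\le4$ for all tuples $\vec D$ of odd positive integers. -/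

import Mathlib

namespace BiquadraticD4

/-! ### Biquadratic fields, admissible triples, and the counting function -/

/-- The four types of biquadratic fields, according to the residues modulo `4` of the
squarefree integers `d₁, d₂, d₃`. -/
inductive FieldType
  | one
  | two
  | three
  | four

/-- The number `m_h` of (ordered) admissible triples of type `h` attached to one field. -/
def FieldType.m : FieldType → ℕ
  | .one => 6
  | .two => 2
  | .three => 2
  | .four => 2

/-- The factor `τ_h` with `disc = τ_h d₁ d₂ d₃`. -/
def FieldType.tau : FieldType → ℕ
  | .one => 1
  | .two => 16
  | .three => 16
  | .four => 64

/-- `T_h = τ_h` for `h = 1, 3` and `T_h = 4 τ_h` for `h = 2, 4`. -/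
def FieldType.T : FieldType → ℕ
  | .one => FieldType.tau .one
  | .two => 4 * FieldType.tau .two
  | .three => FieldType.tau .three
  | .four => 4 * FieldType.tau .four

/-- Admissible triples: distinct squarefree integers `dᵢ ≠ 1` with
`d₃ = d₁ d₂ / gcd(d₁, d₂)²`. -/
def Admissible (d₁ d₂ d₃ : ℤ) : Prop :=
  Squarefree d₁ ∧ Squarefree d₂ ∧ Squarefree d₃ ∧
  d₁ ≠ 1 ∧ d₂ ≠ 1 ∧ d₃ ≠ 1 ∧
  d₁ ≠ d₂ ∧ d₁ ≠ d₃ ∧ d₂ ≠ d₃ ∧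
  d₃ * (Int.gcd d₁ d₂ : ℤ) ^ 2 = d₁ * d₂

/-- The congruences modulo `4` that define type `h`. -/
def FieldType.Congr : FieldType → ℤ → ℤ → ℤ → Prop
  | .one, d₁, d₂, d₃ => d₁ ≡ 1 [ZMOD 4] ∧ d₂ ≡ 1 [ZMOD 4] ∧ d₃ ≡ 1 [ZMOD 4]
  | .two, d₁, d₂, d₃ => d₁ ≡ 2 [ZMOD 4] ∧ d₂ ≡ 2 [ZMOD 4] ∧ d₃ ≡ 1 [ZMOD 4]
  | .three, d₁, d₂, d₃ => d₁ ≡ 3 [ZMOD 4] ∧ d₂ ≡ 3 [ZMOD 4] ∧ d₃ ≡ 1 [ZMOD 4]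
  | .four, d₁, d₂, d₃ => d₁ ≡ 2 [ZMOD 4] ∧ d₂ ≡ 2 [ZMOD 4] ∧ d₃ ≡ 3 [ZMOD 4]

/-- The set `S_h^σ(X)` of admissible triples of type `h` with `τ_h d₁ d₂ d₃ ≤ X` and
`(sign d₁, sign d₂) = σ`. -/
def triples (h : FieldType) (σ : ℤˣ × ℤˣ) (X : ℝ) : Set (ℤ × ℤ × ℤ) :=
  {d | Admissible d.1 d.2.1 d.2.2 ∧ h.Congr d.1 d.2.1 d.2.2 ∧
    (h.tau : ℝ) * ((d.1 * d.2.1 * d.2.2 : ℤ) : ℝ) ≤ X ∧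
    Int.sign d.1 = (σ.1 : ℤ) ∧ Int.sign d.2.1 = (σ.2 : ℤ)}

/-- The field `ℚ(√d₁, √d₂, √d₃)` inside a fixed algebraic closure of `ℚ`. -/
noncomputable def multiquadraticField (d₁ d₂ d₃ : ℤ) :
    IntermediateField ℚ (AlgebraicClosure ℚ) :=
  IntermediateField.adjoin ℚ
    {x : AlgebraicClosure ℚ |
      x ^ 2 = (d₁ : AlgebraicClosure ℚ) ∨ x ^ 2 = (d₂ : AlgebraicClosure ℚ) ∨
        x ^ 2 = (d₃ : AlgebraicClosure ℚ)}

/-- `K` admits a `G`-extension: it lies in a finite Galois extension `F` of `ℚ` with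
Galois group isomorphic to `G`. -/
def AdmitsExtension (G : Type) [Group G] (K : IntermediateField ℚ (AlgebraicClosure ℚ)) :
    Prop :=
  ∃ F : IntermediateField ℚ (AlgebraicClosure ℚ),
    K ≤ F ∧ FiniteDimensional ℚ F ∧ IsGalois ℚ F ∧ Nonempty ((F ≃ₐ[ℚ] F) ≃* G)

open Classical in
/-- The indicator `1_{D₄}(d₁, d₂, d₃)`; here `D₄` is the dihedral group of order `8`. -/
noncomputable def indD4 (d : ℤ × ℤ × ℤ) : ℝ :=
  if AdmitsExtension (DihedralGroup 4) (multiquadraticField d.1 d.2.1 d.2.2) then 1 else 0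

/-- `B_h^σ(X; D₄)`. The sum is finite, see `triples_finite`. -/
noncomputable def countD4 (h : FieldType) (σ : ℤˣ × ℤˣ) (X : ℝ) : ℝ :=
  1 / (h.m : ℝ) * ∑ᶠ d ∈ triples h σ X, indD4 d

/-! ### Characters and weights

Six-tuples `(D₁₁, D₁₂, D₂₁, D₂₂, D₃₁, D₃₂)` are functions `D : Fin 3 → Fin 2 → ℕ`, so that
`D₁₁ = D 0 0`, `D₁₂ = D 0 1`, …, `D₃₂ = D 2 1`.  Every symbol `(a / n)` below has `n` odd and
positive, so that it is a Jacobi symbol. -/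

/-- Six-tuples of natural numbers. -/
abbrev Tuple := Fin 3 → Fin 2 → ℕ

/-- `η(a, b) = (-1)^(((a - 1) / 2) ((b - 1) / 2))`, used for odd `a, b` only. -/
def eta (a b : ℤ) : ℤ := ((Int.negOnePow ((a - 1) / 2 * ((b - 1) / 2)) : ℤˣ) : ℤ)

/-- `Φ(a, b, c) = η(a, b + 2) η(b, c + 2) η(c, a + 2)`. -/
def Phi (a b c : ℤ) : ℤ := eta a (b + 2) * eta b (c + 2) * eta c (a + 2)

/-- `ψ(n) = 1` if every prime divisor of `n` is `1` modulo `4`, else `ψ(n) = 0`. -/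
def psi (n : ℕ) : ℚ := if ∀ p ∈ n.primeFactors, p % 4 = 1 then 1 else 0

/-- The indicator of a decidable proposition. -/
def ind (p : Prop) [Decidable p] : ℚ := if p then 1 else 0

/-- `D₁₁ D₁₂ D₃₁ D₃₂`. -/
def prod13 (D : Tuple) : ℕ := D 0 0 * D 0 1 * D 2 0 * D 2 1

/-- `D₂₁ D₂₂ D₃₁ D₃₂`. -/
def prod23 (D : Tuple) : ℕ := D 1 0 * D 1 1 * D 2 0 * D 2 1

/-- `D₁₁ D₁₂ D₂₁ D₂₂`. -/
def prod12 (D : Tuple) : ℕ := D 0 0 * D 0 1 * D 1 0 * D 1 1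

/-- The product of all six entries. -/
def prodAll (D : Tuple) : ℕ := D 0 0 * D 0 1 * D 1 0 * D 1 1 * D 2 0 * D 2 1

/-- `Δ(D)`, the square of the product of all six entries. -/
def Delta (D : Tuple) : ℕ := prodAll D ^ 2

/-- `ω(D)`, the number of distinct primes dividing the product of the entries. -/
def omega (D : Tuple) : ℕ := (prodAll D).primeFactors.card

/-- `g(D) = (D₂₂ D₃₂ / D₁₁) (D₁₂ D₃₂ / D₂₁) (D₁₂ D₂₂ / D₃₁)`. -/
def g (D : Tuple) : ℤ :=
  jacobiSym ((D 1 1 * D 2 1 : ℕ) : ℤ) (D 0 0) *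
    jacobiSym ((D 0 1 * D 2 1 : ℕ) : ℤ) (D 1 0) *
    jacobiSym ((D 0 1 * D 1 1 : ℕ) : ℤ) (D 2 0)

/-- The factor in front of the weights that expresses the congruences defining type `h`. -/
def detect (h : FieldType) (σ : ℤˣ × ℤˣ) (D : Tuple) : ℚ :=
  let ε₁ : ℤ := σ.1
  let ε₂ : ℤ := σ.2
  match h with
  | .one =>
    1 / 8 * (1 + ε₁ * jacobiSym (-1) (prod13 D)) * (1 + ε₂ * jacobiSym (-1) (prod23 D)) *
      (1 + ε₁ * ε₂ * jacobiSym (-1) (prod12 D))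
  | .two => 1 / 2 * (1 + ε₁ * ε₂ * jacobiSym (-1) (prod12 D))
  | .three =>
    1 / 8 * (1 - ε₁ * jacobiSym (-1) (prod13 D)) * (1 - ε₂ * jacobiSym (-1) (prod23 D)) *
      (1 + ε₁ * ε₂ * jacobiSym (-1) (prod12 D))
  | .four => 1 / 2 * (1 - ε₁ * ε₂ * jacobiSym (-1) (prod12 D))

/-- The three-term factor `{…}` of `f_h^σ`.  The argument `s` is `1` for `h = 1, 3` and
`(2 / w₁₁ w₁₂ w₂₁ w₂₂)` for `h = 2, 4`. -/
def cyclicTerms (σ : ℤˣ × ℤˣ) (s : ℤ) (w : Tuple) : ℚ :=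
  let ε₁ : ℤ := σ.1
  let ε₂ : ℤ := σ.2
  ind (σ ≠ (1, -1)) * (1 / 2 * (1 + eta (ε₁ * prod13 w + 2) (ε₂ * prod23 w) * s)) *
      jacobiSym (-1) (w 0 0 * w 2 0) +
    ind (σ ≠ (-1, 1)) * (1 / 2 * (1 + eta (ε₁ * prod13 w) (ε₂ * prod23 w + 2) * s)) *
      jacobiSym (-1) (w 1 0 * w 2 0) +
    ind (σ ≠ (-1, -1)) * (1 / 2 * (1 + eta (ε₁ * prod13 w) (ε₂ * prod23 w) * s)) *
      jacobiSym (-1) (w 0 0 * w 1 0)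

/-- The explicit expression of `f_h^σ` on tuples of odd positive integers. -/
def fTuple (h : FieldType) (σ : ℤˣ × ℤˣ) (w : Tuple) : ℚ :=
  let common : ℚ := detect h σ w * jacobiSym (σ.1 : ℤ) (w 1 0 * w 2 0) *
    jacobiSym (σ.2 : ℤ) (w 0 0 * w 2 0) * Phi (w 0 0) (w 1 0) (w 2 0)
  match h with
  | .one => common * cyclicTerms σ 1 w
  | .two => common * jacobiSym 2 (w 0 0 * w 1 0) * cyclicTerms σ (jacobiSym 2 (prod12 w)) w
  | .three => common * cyclicTerms σ 1 w
  | .four => common * jacobiSym 2 (w 0 0 * w 1 0) * cyclicTerms σ (jacobiSym 2 (prod12 w)) w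

/-- `H = (ℤ/8ℤ)ˣ`. -/
abbrev H := (ZMod 8)ˣ

/-- The weight `f_h^σ(·; D₄)` on `H⁶`, computed on the representatives `1, 3, 5, 7`. -/
def f (h : FieldType) (σ : ℤˣ × ℤˣ) (w : Fin 3 → Fin 2 → H) : ℚ :=
  fTuple h σ fun i j => ((w i j : ZMod 8)).val

/-- The four-term factor `{…}` of `r_h^σ`. -/
def psiTerms (σ : ℤˣ × ℤˣ) (D : Tuple) : ℚ :=
  -(ind (σ ≠ (1, -1) ∧ σ ≠ (-1, 1)) * psi (prod12 D)) -
    ind (σ ≠ (1, -1) ∧ σ ≠ (-1, -1)) * psi (prod23 D) -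
    ind (σ ≠ (-1, 1) ∧ σ ≠ (-1, -1)) * psi (prod13 D) +
    ind (σ = (1, 1)) * psi (prodAll D)

/-- The weight `r_h^σ(·; D₄)`. -/
def r (h : FieldType) (σ : ℤˣ × ℤˣ) (D : Tuple) : ℚ :=
  match h with
  | .one => detect .one σ D * psiTerms σ D
  | .two => detect .two σ D * (1 / 2 * (1 + jacobiSym 2 (prod12 D))) *
      jacobiSym 2 (D 0 0 * D 1 0) * psiTerms σ D
  | .three => detect .three σ D * psiTerms σ D
  | .four => detect .four σ D * (1 / 2 * (1 + jacobiSym 2 (prod12 D))) *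
      jacobiSym 2 (D 0 0 * D 1 0) * psiTerms σ D

/-! ### The sums `∑♮` -/

/-- The tuples over which `∑♮` with `Δ(D) ≤ x` runs: the entries are positive, odd, squarefree
and pairwise coprime. -/
def naturalTuples (x : ℝ) : Set Tuple :=
  {D | (∀ i j, Odd (D i j) ∧ Squarefree (D i j)) ∧
    (∀ i j k l, (i, j) ≠ (k, l) → Nat.Coprime (D i j) (D k l)) ∧ (Delta D : ℝ) ≤ x}

/-- The linked character sum `∑♮ 2^{-ω(D)} g(D)` over `Δ(D) ≤ x`, `D ≡ w (mod 8)`. -/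
noncomputable def linkedSum (w : Fin 3 → Fin 2 → H) (x : ℝ) : ℝ :=
  ∑ᶠ D ∈ {D ∈ naturalTuples x | ∀ i j, ((D i j : ℕ) : ZMod 8) = (w i j : ZMod 8)},
    ((2 : ℝ) ^ omega D)⁻¹ * (g D : ℝ)

/-- The sum `∑♮ r_h^σ(D) 2^{-ω(D)} g(D)` over `Δ(D) ≤ x`. -/
noncomputable def psiSum (h : FieldType) (σ : ℤˣ × ℤˣ) (x : ℝ) : ℝ :=
  ∑ᶠ D ∈ naturalTuples x, (r h σ D : ℝ) * ((2 : ℝ) ^ omega D)⁻¹ * (g D : ℝ)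

/-! ### The sums above are finite -/

theorem triples_finite (h : FieldType) (σ : ℤˣ × ℤˣ) (X : ℝ) : (triples h σ X).Finite := by
  refine Set.Finite.subset
    (Set.Finite.prod (Set.finite_Icc (-⌊X⌋) ⌊X⌋)
      (Set.Finite.prod (Set.finite_Icc (-⌊X⌋) ⌊X⌋) (Set.finite_Icc (-⌊X⌋) ⌊X⌋))) ?_
  rintro ⟨a, b, c⟩ ⟨⟨ha, hb, hc, -, -, -, -, -, -, hd⟩, -, hX, -, -⟩
  simp only at ha hb hc hd hX
  have ha0 := ha.ne_zero
  have hb0 := hb.ne_zero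
  have hc0 := hc.ne_zero
  have hpos : 0 < a * b * c := by
    have h1 : 0 < (a * b) ^ 2 := by positivity
    have h2 : (a * b) ^ 2 = a * b * c * (Int.gcd a b : ℤ) ^ 2 := by rw [sq, ← hd]; ring
    rw [h2] at h1
    exact pos_of_mul_pos_left h1 (by positivity)
  have hle : a * b * c ≤ ⌊X⌋ := by
    rw [Int.le_floor]
    have ht : (1 : ℝ) ≤ h.tau := by cases h <;> norm_num [FieldType.tau]
    have : (0 : ℝ) < ((a * b * c : ℤ) : ℝ) := by exact_mod_cast hpos
    nlinarith
  have habs : |a| * |b| * |c| ≤ ⌊X⌋ := by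
    rw [← abs_mul, ← abs_mul, abs_of_pos hpos]; exact hle
  have h1 : 1 ≤ |a| := Int.one_le_abs ha0
  have h2 : 1 ≤ |b| := Int.one_le_abs hb0
  have h3 : 1 ≤ |c| := Int.one_le_abs hc0
  have h12 : 1 ≤ |a| * |b| := one_le_mul_of_one_le_of_one_le h1 h2
  have A : |a| ≤ ⌊X⌋ := by nlinarith
  have B : |b| ≤ ⌊X⌋ := by nlinarith
  have C : |c| ≤ ⌊X⌋ := by nlinarith
  exact ⟨abs_le.mp A, abs_le.mp B, abs_le.mp C⟩

theorem naturalTuples_finite (x : ℝ) : (naturalTuples x).Finite := by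
  refine Set.Finite.subset
    (Set.Finite.pi' fun _ : Fin 3 => Set.Finite.pi' fun _ : Fin 2 =>
      Set.finite_Iic ⌊x⌋₊) ?_
  rintro D ⟨hD, -, hx⟩ i j
  have hne : ∀ i j, D i j ≠ 0 := fun i j => (hD i j).2.ne_zero
  have hP : prodAll D ≠ 0 := by simp [prodAll, hne]
  have hle : D i j ≤ Delta D := by
    refine Nat.le_of_dvd (Nat.pos_of_ne_zero (pow_ne_zero 2 hP)) ?_
    refine Dvd.dvd.trans ?_ (dvd_pow_self _ two_ne_zero)
    unfold prodAll
    fin_cases i <;> fin_cases j <;> simp only [Fin.zero_eta, Fin.mk_one, Fin.reduceFinMk]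
    · exact ⟨D 0 1 * D 1 0 * D 1 1 * D 2 0 * D 2 1, by ring⟩
    · exact ⟨D 0 0 * D 1 0 * D 1 1 * D 2 0 * D 2 1, by ring⟩
    · exact ⟨D 0 0 * D 0 1 * D 1 1 * D 2 0 * D 2 1, by ring⟩
    · exact ⟨D 0 0 * D 0 1 * D 1 0 * D 2 0 * D 2 1, by ring⟩
    · exact ⟨D 0 0 * D 0 1 * D 1 0 * D 1 1 * D 2 1, by ring⟩
    · exact ⟨D 0 0 * D 0 1 * D 1 0 * D 1 1 * D 2 0, by ring⟩
  exact Nat.le_floor (le_trans (by exact_mod_cast hle) hx)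

end BiquadraticD4

namespace BiquadraticD4

/-! ### Legendre's theorem on ternary diagonal forms -/

/-! A biquadratic field lies in a `D₄`-extension exactly when one of the conics `dᵢ x² + dⱼ y² = z²`
has a rational point (`admitsExtension_dihedral_iff`). In one direction, a generator `θ` of a
non-normal quartic subfield has `θ² = u + v √dᵢ`, and its norm gives the point. In the other, a
point gives `θ = √(u + v √dᵢ)`, whose Galois closure is dihedral.

Write `d₁ = ε₁ e D₁ D₃`, `d₂ = ε₂ e D₂ D₃`, `d₃ = ε₁ ε₂ D₁ D₂` with `e ∈ {1, 2}` and `D₁ D₂ D₃` odd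
and squarefree. By Legendre's theorem (`conicSolvable_iff`, proved here by the pigeonhole principle
and descent) each conic amounts to one excluded sign pattern and Legendre symbols at the odd primes:
`d₂` modulo `p ∣ D₁`, `d₁` modulo `p ∣ D₂`, `d₃` modulo `p ∣ D₃`, where exactly one of the three
radicands carries an extra factor `-1`, in a place depending on the conic.

Inclusion-exclusion over the three conics (`ind_someConic`) gives both weights. The single conics
give `f`. If two conics are solvable together, then at some primes both `d` and `-d` are squares,
which forces `p ≡ 1 (mod 4)`; the signs `-1` then play no role, and these terms give `r` with its
factors `ψ`. The factors `(1 + …) / 2` in the weights equal `1` wherever the local conditions hold,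
by the product formula (`localCond_formula`): they record the condition at `2`, which the other
places imply.

Each local condition is `2^{-ω}` times a sum of Jacobi symbols over divisors
(`sum_divisors_jacobiSym`), that is, over factorizations `Dᵢ = Dᵢ₁ Dᵢ₂`. Quadratic reciprocity
(`splitChar_eq`) rewrites the resulting character as `g` times a function of residues modulo `8`, so
`sum_weights` identifies the main terms with a count of triples `(D₁, D₂, D₃)`. That count differs
from the count of fields only in triples not giving an admissible triple; there two of the `Dᵢ`
equal `1`, so there are at most `3 √X` of them (`abs_sum_sub_le`). -/

theorem exists_lt_of_mul_sq_lt {a b c x y z : ℕ} (hx : b * c < x * x) (hy : a * c < y * y)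
    (hz : a * b < z * z) : a * b * c < x * y * z := by
  have h : (a * b * c) * (a * b * c) < (x * y * z) * (x * y * z) := by
    calc (a * b * c) * (a * b * c) = (b * c) * (a * c) * (a * b) := by ring
      _ < (x * x) * (y * y) * (z * z) :=
        Nat.mul_lt_mul'' (Nat.mul_lt_mul'' hx hy) hz
      _ = _ := by ring
  exact lt_of_mul_self_lt_mul_self₀ (Nat.zero_le _) h

/-- Pigeonhole: the box `0 ≤ x ≤ √(bc)`, `0 ≤ y ≤ √(ac)`, `0 ≤ z ≤ √(ab)` has more than `abc`
integer points, so two of them agree under three linear forms modulo `a`, `b`, `c`. Their difference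
is the solution. -/
theorem legendre_small_solution {a b c : ℕ} (ha : 0 < a) (hb : 0 < b) (hc : 0 < c) (t u v : ℤ) :
    ∃ x y z : ℤ, (x ≠ 0 ∨ y ≠ 0 ∨ z ≠ 0) ∧ x ^ 2 ≤ b * c ∧ y ^ 2 ≤ a * c ∧ z ^ 2 ≤ a * b ∧
      (a : ℤ) ∣ b * y - t * z ∧ (b : ℤ) ∣ a * x - u * z ∧ (c : ℤ) ∣ a * x - v * y := by
  have : NeZero a := ⟨ha.ne'⟩
  have : NeZero b := ⟨hb.ne'⟩
  have : NeZero c := ⟨hc.ne'⟩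
  let S : Finset (ℕ × ℕ × ℕ) := Finset.range (Nat.sqrt (b * c) + 1) ×ˢ
    (Finset.range (Nat.sqrt (a * c) + 1) ×ˢ Finset.range (Nat.sqrt (a * b) + 1))
  let F : ℕ × ℕ × ℕ → ZMod a × ZMod b × ZMod c := fun p =>
    (((b * p.2.1 - t * p.2.2 : ℤ) : ZMod a), ((a * p.1 - u * p.2.2 : ℤ) : ZMod b),
      ((a * p.1 - v * p.2.1 : ℤ) : ZMod c))
  have hcard : (Finset.univ : Finset (ZMod a × ZMod b × ZMod c)).card < S.card := by
    simp only [Finset.card_univ, Fintype.card_prod, ZMod.card, S, Finset.card_product,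
      Finset.card_range]
    rw [← mul_assoc, ← mul_assoc]
    exact exists_lt_of_mul_sq_lt (Nat.lt_succ_sqrt _) (Nat.lt_succ_sqrt _) (Nat.lt_succ_sqrt _)
  obtain ⟨p, hp, q, hq, hpq, hF⟩ := Finset.exists_ne_map_eq_of_card_lt_of_maps_to hcard
    (f := F) (fun _ _ => Finset.mem_univ _)
  have key : ∀ {n m k : ℕ}, m < Nat.sqrt n + 1 → k < Nat.sqrt n + 1 →
      ((m : ℤ) - k) ^ 2 ≤ n := by
    intro n m k hm hk
    have h1 : ((Nat.sqrt n : ℕ) : ℤ) * (Nat.sqrt n : ℕ) ≤ n := by exact_mod_cast Nat.sqrt_le n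
    have h2 : |(m : ℤ) - k| ≤ Nat.sqrt n := by rw [abs_le]; constructor <;> omega
    calc ((m : ℤ) - k) ^ 2 = |(m : ℤ) - k| * |(m : ℤ) - k| := by rw [abs_mul_abs_self]; ring
      _ ≤ (Nat.sqrt n : ℤ) * (Nat.sqrt n : ℤ) := by gcongr
      _ ≤ n := h1
  simp only [S, Finset.mem_product, Finset.mem_range] at hp hq
  simp only [F, Prod.mk.injEq, ZMod.intCast_eq_intCast_iff_dvd_sub] at hF
  refine ⟨q.1 - p.1, q.2.1 - p.2.1, q.2.2 - p.2.2, ?_, ?_, ?_, ?_, ?_, ?_, ?_⟩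
  · by_contra! h
    apply hpq
    refine Prod.ext ?_ (Prod.ext ?_ ?_) <;> omega
  · exact_mod_cast key hq.1 hp.1
  · exact_mod_cast key hq.2.1 hp.2.1
  · exact_mod_cast key hq.2.2 hp.2.2
  · convert hF.1 using 1; ring
  · convert hF.2.1 using 1; ring
  · convert hF.2.2 using 1; ring

/-- Since `t² ≡ ab`, the form `a (a x² - b z²)` splits modulo `n` into linear factors `(a x - t z)(a
x + t z)`. -/
theorem dvd_of_dvd_linear {n a b t x z : ℤ} (hna : IsCoprime n a) (ht : n ∣ t ^ 2 - a * b)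
    (h : n ∣ a * x - t * z) : n ∣ a * x ^ 2 - b * z ^ 2 := by
  refine hna.dvd_of_dvd_mul_left ?_
  have : a * (a * x ^ 2 - b * z ^ 2) = (a * x - t * z) * (a * x + t * z) +
    (t ^ 2 - a * b) * z ^ 2 := by ring
  rw [this]
  exact dvd_add (h.mul_right _) (ht.mul_right _)

theorem eq_one_of_coprime_of_sq {a b : ℕ} {x : ℤ} (h : Squarefree (a * b)) (hx : x ^ 2 = a * b) :
    a = 1 ∧ b = 1 := by
  have h1 : x.natAbs ^ 2 = a * b := by zify; rw [sq_abs]; exact_mod_cast hx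
  rw [← h1] at h
  have h2 := h x.natAbs (by rw [sq])
  rw [Nat.isUnit_iff] at h2
  rw [h2, one_pow] at h1
  exact ⟨Nat.eq_one_of_mul_eq_one_right h1.symm, Nat.eq_one_of_mul_eq_one_left h1.symm⟩

/-- For the small solution, `a x² + b y² - c z²` is a multiple of `abc` strictly between `-abc` and
`2abc`, hence `0` or `abc`. The second case is repaired by an identity. -/
theorem legendre_positive {a b c : ℕ} (h : Squarefree (a * b * c))
    (ha : ∃ t : ℤ, (a : ℤ) ∣ t ^ 2 - b * c) (hb : ∃ t : ℤ, (b : ℤ) ∣ t ^ 2 - a * c)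
    (hc : ∃ t : ℤ, (c : ℤ) ∣ t ^ 2 + a * b) :
    ∃ x y z : ℤ, (x ≠ 0 ∨ y ≠ 0 ∨ z ≠ 0) ∧ a * x ^ 2 + b * y ^ 2 = c * z ^ 2 := by
  -- For `a = b = 1` the bound `z² ≤ ab` need not be strict; here `-1` is a square modulo `c`, and
  -- `c` is a sum of two squares.
  by_cases h11 : a = 1 ∧ b = 1
  · obtain ⟨rfl, rfl⟩ := h11
    obtain ⟨t, ht⟩ := hc
    have : IsSquare (-1 : ZMod c) := by
      refine ⟨(t : ZMod c), ?_⟩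
      rw [← ZMod.intCast_zmod_eq_zero_iff_dvd] at ht
      push_cast at ht
      linear_combination -ht
    obtain ⟨x, y, hxy⟩ := Nat.eq_sq_add_sq_of_isSquare_mod_neg_one this
    refine ⟨x, y, 1, by simp, ?_⟩
    rw [hxy]; push_cast; ring
  have habc := h.ne_zero
  have ha0 : 0 < a := Nat.pos_of_ne_zero (by rintro rfl; simp at habc)
  have hb0 : 0 < b := Nat.pos_of_ne_zero (by rintro rfl; simp at habc)
  have hc0 : 0 < c := Nat.pos_of_ne_zero (by rintro rfl; simp at habc)
  have cab_c : Nat.Coprime (a * b) c := Nat.coprime_of_squarefree_mul h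
  have cab : Nat.Coprime a b := Nat.coprime_of_squarefree_mul h.of_mul_left
  have cac : Nat.Coprime a c := cab_c.coprime_mul_right
  have cbc : Nat.Coprime b c := cab_c.coprime_mul_left
  obtain ⟨t, ht⟩ := ha
  obtain ⟨u, hu⟩ := hb
  obtain ⟨v, hv⟩ := hc
  obtain ⟨x, y, z, hne, hx, hy, hz, h1, h2, h3⟩ := legendre_small_solution ha0 hb0 hc0 t u v
  have d1 : (a : ℤ) ∣ a * x ^ 2 + b * y ^ 2 - c * z ^ 2 := by
    have := dvd_of_dvd_linear (Nat.isCoprime_iff_coprime.mpr cab) ht h1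
    rw [show (a : ℤ) * x ^ 2 + b * y ^ 2 - c * z ^ 2 = a * x ^ 2 + (b * y ^ 2 - c * z ^ 2) by ring]
    exact dvd_add (dvd_mul_right _ _) this
  have d2 : (b : ℤ) ∣ a * x ^ 2 + b * y ^ 2 - c * z ^ 2 := by
    have := dvd_of_dvd_linear (Nat.isCoprime_iff_coprime.mpr cab.symm) hu h2
    rw [show (a : ℤ) * x ^ 2 + b * y ^ 2 - c * z ^ 2 = b * y ^ 2 + (a * x ^ 2 - c * z ^ 2) by ring]
    exact dvd_add (dvd_mul_right _ _) this
  have d3 : (c : ℤ) ∣ a * x ^ 2 + b * y ^ 2 - c * z ^ 2 := by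
    have := dvd_of_dvd_linear (b := -b) (Nat.isCoprime_iff_coprime.mpr cac.symm)
      (by convert hv using 1; ring) h3
    rw [show (a : ℤ) * x ^ 2 + b * y ^ 2 - c * z ^ 2 =
      (a * x ^ 2 - -b * y ^ 2) - c * z ^ 2 by ring]
    exact dvd_sub this (dvd_mul_right _ _)
  have d : ((a : ℤ) * b * c) ∣ a * x ^ 2 + b * y ^ 2 - c * z ^ 2 := by
    refine IsCoprime.mul_dvd ?_ (IsCoprime.mul_dvd ?_ d1 d2) d3
    · exact_mod_cast Nat.isCoprime_iff_coprime.mpr cab_c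
    · exact Nat.isCoprime_iff_coprime.mpr cab
  obtain ⟨k, hk⟩ := d
  have hN : (0 : ℤ) < a * b * c := by positivity
  have ax : (a : ℤ) * x ^ 2 ≤ a * b * c := by
    rw [mul_assoc]; gcongr
  have by' : (b : ℤ) * y ^ 2 ≤ a * b * c := by
    rw [show (a : ℤ) * b * c = b * (a * c) by ring]; gcongr
  have cz : (c : ℤ) * z ^ 2 < a * b * c := by
    have hz' : z ^ 2 < (a : ℤ) * b := lt_of_le_of_ne hz fun he =>
      h11 (eq_one_of_coprime_of_sq h.of_mul_left he)
    rw [show (a : ℤ) * b * c = c * (a * b) by ring]; gcongr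
  -- Equality would make the squarefree numbers `bc` and `ac` perfect squares, hence `a = b = c =
  -- 1`.
  have sum_lt : (a : ℤ) * x ^ 2 + b * y ^ 2 < 2 * (a * b * c) := by
    by_contra! hcon
    have e1 : (a : ℤ) * x ^ 2 = a * (b * c) := by linarith
    have e2 : (b : ℤ) * y ^ 2 = b * (a * c) := by linarith
    have ha' : (a : ℤ) ≠ 0 := by positivity
    have hb' : (b : ℤ) ≠ 0 := by positivity
    have e1' := mul_left_cancel₀ ha' e1
    have e2' := mul_left_cancel₀ hb' e2
    have hbc : Squarefree (b * c) := by
      rw [mul_assoc] at h; exact h.of_mul_right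
    have hac : Squarefree (a * c) := by
      rw [mul_comm a b, mul_assoc] at h; exact h.of_mul_right
    exact h11 ⟨(eq_one_of_coprime_of_sq hac e2').1, (eq_one_of_coprime_of_sq hbc e1').1⟩
  have hk0 : k = 0 ∨ k = 1 := by
    have p1 : (0 : ℤ) ≤ a * x ^ 2 := by positivity
    have p2 : (0 : ℤ) ≤ b * y ^ 2 := by positivity
    have p3 : (0 : ℤ) ≤ c * z ^ 2 := by positivity
    have l1 : -1 < k := by
      by_contra! hk'; nlinarith
    have l2 : k < 2 := by
      by_contra! hk'; nlinarith
    omega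
  rcases hk0 with rfl | rfl
  · exact ⟨x, y, z, hne, by linarith⟩
  -- The identity `a (xz + by)² + b (yz - ax)² = (a x² + b y²)(z² + ab)`, combined with `a x² + b y²
  -- = c (z² + ab)`.
  · refine ⟨x * z + b * y, y * z - a * x, z ^ 2 + a * b, Or.inr (Or.inr (by positivity)), ?_⟩
    linear_combination (z ^ 2 + a * b) * hk

/-- **Legendre's theorem**, sufficiency. -/
theorem legendre {a b c : ℤ} (h : Squarefree (a * b * c)) (hpos : ¬(0 < a ∧ 0 < b ∧ 0 < c))
    (hneg : ¬(a < 0 ∧ b < 0 ∧ c < 0)) (ha : ∃ t : ℤ, a ∣ t ^ 2 + b * c)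
    (hb : ∃ t : ℤ, b ∣ t ^ 2 + a * c) (hc : ∃ t : ℤ, c ∣ t ^ 2 + a * b) :
    ∃ x y z : ℤ, (x ≠ 0 ∨ y ≠ 0 ∨ z ≠ 0) ∧ a * x ^ 2 + b * y ^ 2 + c * z ^ 2 = 0 := by
  have core : ∀ {a b c : ℤ}, Squarefree (a * b * c) → 0 < a → 0 < b → c < 0 →
      (∃ t : ℤ, a ∣ t ^ 2 + b * c) → (∃ t : ℤ, b ∣ t ^ 2 + a * c) →
      (∃ t : ℤ, c ∣ t ^ 2 + a * b) →
      ∃ x y z : ℤ, (x ≠ 0 ∨ y ≠ 0 ∨ z ≠ 0) ∧ a * x ^ 2 + b * y ^ 2 + c * z ^ 2 = 0 := by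
    intro a b c h ha hb hc h1 h2 h3
    lift a to ℕ using ha.le
    lift b to ℕ using hb.le
    obtain ⟨c, rfl⟩ : ∃ n : ℕ, c = -n := ⟨c.natAbs, by omega⟩
    have hs : Squarefree (a * b * c) := by
      rw [← Int.squarefree_natAbs] at h
      simpa [Int.natAbs_mul] using h
    obtain ⟨x, y, z, hne, he⟩ := legendre_positive hs
      (by simpa [sub_eq_add_neg] using h1) (by simpa [sub_eq_add_neg] using h2) (by simpa using h3)
    exact ⟨x, y, z, hne, by linear_combination he⟩
  have core2 : ∀ {a b c : ℤ}, Squarefree (a * b * c) →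
      (0 < a ∧ 0 < b ∧ c < 0 ∨ a < 0 ∧ b < 0 ∧ 0 < c) →
      (∃ t : ℤ, a ∣ t ^ 2 + b * c) → (∃ t : ℤ, b ∣ t ^ 2 + a * c) →
      (∃ t : ℤ, c ∣ t ^ 2 + a * b) →
      ∃ x y z : ℤ, (x ≠ 0 ∨ y ≠ 0 ∨ z ≠ 0) ∧ a * x ^ 2 + b * y ^ 2 + c * z ^ 2 = 0 := by
    intro a b c h hs h1 h2 h3
    rcases hs with ⟨p, q, r⟩ | ⟨p, q, r⟩
    · exact core h p q r h1 h2 h3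
    · obtain ⟨x, y, z, hne, he⟩ := core (a := -a) (b := -b) (c := -c)
        (by rw [← Int.squarefree_natAbs] at h ⊢; simpa [Int.natAbs_mul] using h) (by omega) (by omega)
        (by omega) (by simpa using h1) (by simpa using h2) (by simpa using h3)
      exact ⟨x, y, z, hne, by linear_combination -he⟩
  have a0 : a ≠ 0 := by rintro rfl; simp at h
  have b0 : b ≠ 0 := by rintro rfl; simp at h
  have c0 : c ≠ 0 := by rintro rfl; simp at h
  have hcases : (0 < a ∧ 0 < b ∧ c < 0 ∨ a < 0 ∧ b < 0 ∧ 0 < c) ∨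
      (0 < a ∧ 0 < c ∧ b < 0 ∨ a < 0 ∧ c < 0 ∧ 0 < b) ∨
      (0 < c ∧ 0 < b ∧ a < 0 ∨ c < 0 ∧ b < 0 ∧ 0 < a) := by omega
  rcases hcases with hs | hs | hs
  · exact core2 h hs ha hb hc
  · obtain ⟨x, y, z, hne, he⟩ := core2 (a := a) (b := c) (c := b)
      (by rwa [mul_right_comm]) hs (by simpa [mul_comm] using ha) hc hb
    exact ⟨x, z, y, by tauto, by linear_combination he⟩
  · obtain ⟨x, y, z, hne, he⟩ := core2 (a := c) (b := b) (c := a)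
      (by rwa [show c * b * a = a * b * c by ring]) hs (by simpa [mul_comm] using hc)
      (by simpa [mul_comm] using hb) (by simpa [mul_comm] using ha)
    exact ⟨z, y, x, by tauto, by linear_combination he⟩

/-! ### Solvability of `a x² + b y² = z²` -/

/-- The conic `a x² + b y² = z²` has a rational point. -/
def ConicSolvable (a b : ℤ) : Prop :=
  ∃ x y z : ℤ, (x ≠ 0 ∨ y ≠ 0 ∨ z ≠ 0) ∧ a * x ^ 2 + b * y ^ 2 = z ^ 2

theorem ConicSolvable.symm {a b : ℤ} : ConicSolvable a b → ConicSolvable b a := by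
  rintro ⟨x, y, z, h, he⟩
  exact ⟨y, x, z, by tauto, by linear_combination he⟩

theorem exists_dvd_sq_add_of_coprime {a b m : ℤ} (hab : IsCoprime a b)
    (ha : ∃ t : ℤ, a ∣ t ^ 2 + m) (hb : ∃ t : ℤ, b ∣ t ^ 2 + m) : ∃ t : ℤ, a * b ∣ t ^ 2 + m := by
  have hab' := hab
  obtain ⟨u, v, huv⟩ := hab
  obtain ⟨s, k, hs⟩ := ha
  obtain ⟨t, l, ht⟩ := hb
  -- By Bézout this number is `s` modulo `a` and `t` modulo `b`.
  refine ⟨s + u * a * (t - s), hab'.mul_dvd ?_ ?_⟩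
  · refine ⟨k + u * (t - s) * (2 * s + u * a * (t - s)), ?_⟩
    linear_combination hs
  · refine ⟨l - v * (t - s) * (t + s + u * a * (t - s)), ?_⟩
    linear_combination ht + (t - s) * (s + t + u * a * (t - s)) * huv

theorem exists_dvd_sq_add_nat {n : ℕ} (hn : Squarefree n) (m : ℤ)
    (h : ∀ p : ℕ, p.Prime → p ∣ n → ∃ t : ℤ, (p : ℤ) ∣ t ^ 2 + m) :
    ∃ t : ℤ, (n : ℤ) ∣ t ^ 2 + m := by
  induction n using Nat.recOnPosPrimePosCoprime with
  | zero => simp at hn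
  | one => exact ⟨0, by simp⟩
  | prime_pow p k hp hk =>
    have hk1 : k = 1 := (Nat.squarefree_pow_iff hp.ne_one hk.ne').mp hn |>.2
    subst hk1
    simpa using h p hp (by simp)
  | coprime a b ha hb hab iha ihb =>
    push_cast
    refine exists_dvd_sq_add_of_coprime (Nat.isCoprime_iff_coprime.mpr hab) ?_ ?_
    · exact iha hn.of_mul_left fun p hp hd => h p hp (hd.mul_right _)
    · exact ihb hn.of_mul_right fun p hp hd => h p hp (hd.mul_left _)

theorem exists_dvd_sq_sub {n : ℤ} (hn : Squarefree n) (m : ℤ)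
    (h : ∀ p : ℕ, p.Prime → p ≠ 2 → (p : ℤ) ∣ n → jacobiSym m p = 1) :
    ∃ t : ℤ, n ∣ t ^ 2 + -m := by
  obtain ⟨t, ht⟩ := exists_dvd_sq_add_nat (n := n.natAbs) (by rwa [Int.squarefree_natAbs]) (-m) (by
    intro p hp hd
    rcases eq_or_ne p 2 with rfl | h2
    -- Modulo `2` every number is its own square, so no condition at `2` is needed.
    · refine ⟨m, ?_⟩
      rcases Int.even_or_odd' m with ⟨k, rfl | rfl⟩
      · exact ⟨2 * k ^ 2 - k, by push_cast; ring⟩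
      · exact ⟨2 * k ^ 2 + k, by push_cast; ring⟩
    · have : Fact p.Prime := ⟨hp⟩
      obtain ⟨r, hr⟩ := ZMod.isSquare_of_jacobiSym_eq_one
        (h p hp h2 (Int.natCast_dvd.mpr hd))
      refine ⟨(r.val : ℤ), ?_⟩
      rw [← ZMod.intCast_zmod_eq_zero_iff_dvd]
      push_cast
      rw [ZMod.natCast_zmod_val, hr]; ring)
  exact ⟨t, Int.natAbs_dvd.mp ht⟩

/-- Infinite descent: dividing a solution by `p` repeatedly shows that every power of `p` divides
its coordinates. -/
theorem not_conicSolvable_of_forall_dvd {a b : ℤ} {p : ℕ} (hp : p.Prime)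
    (h : ∀ x y z : ℤ, a * x ^ 2 + b * y ^ 2 = z ^ 2 →
      (p : ℤ) ∣ x ∧ (p : ℤ) ∣ y ∧ (p : ℤ) ∣ z) : ¬ ConicSolvable a b := by
  have key : ∀ (k : ℕ) (x y z : ℤ), a * x ^ 2 + b * y ^ 2 = z ^ 2 →
      (p : ℤ) ^ k ∣ x ∧ (p : ℤ) ^ k ∣ y ∧ (p : ℤ) ^ k ∣ z := by
    intro k
    induction k with
    | zero => simp
    | succ k ih =>
      intro x y z he
      obtain ⟨⟨x, rfl⟩, ⟨y, rfl⟩, ⟨z, rfl⟩⟩ := h x y z he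
      have hp0 : (p : ℤ) ^ 2 ≠ 0 := by have := hp.pos; positivity
      obtain ⟨h1, h2, h3⟩ := ih x y z (mul_left_cancel₀ hp0 (by linear_combination he))
      rw [pow_succ']
      exact ⟨mul_dvd_mul_left _ h1, mul_dvd_mul_left _ h2, mul_dvd_mul_left _ h3⟩
  have zero : ∀ x : ℤ, (∀ k : ℕ, (p : ℤ) ^ k ∣ x) → x = 0 := by
    intro x hx
    refine Int.eq_zero_of_abs_lt_dvd (hx x.natAbs) ?_
    rw [Int.abs_eq_natAbs]
    exact_mod_cast Nat.lt_pow_self hp.one_lt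
  rintro ⟨x, y, z, hne, he⟩
  have hx := zero x fun k => (key k x y z he).1
  have hy := zero y fun k => (key k x y z he).2.1
  have hz := zero z fun k => (key k x y z he).2.2
  tauto

theorem dvd_of_sq_dvd_squarefree_mul {p m x : ℤ} (hp : Prime p) (hm : Squarefree m)
    (h : p ^ 2 ∣ m * x ^ 2) : p ∣ x := by
  by_contra hx
  have hx2 : IsCoprime (p ^ 2) (x ^ 2) := by
    refine IsCoprime.pow ?_
    exact (Irreducible.coprime_iff_not_dvd hp.irreducible).mpr hx
  have := hx2.dvd_of_dvd_mul_right h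
  rw [sq] at this
  exact hp.not_isUnit (hm p this)

/-- If `GB` were a nonresidue, `z² ≡ GB y² (mod p)` would force `p ∣ y` and `p ∣ z`; then `p² ∣ GA
x²` with `GA` squarefree gives `p ∣ x`, and descent applies. -/
theorem jacobiSym_eq_one_of_conic {A B G : ℤ} (h : Squarefree (A * B * G))
    (hs : ConicSolvable (G * A) (G * B)) {p : ℕ} (hp : p.Prime)
    (hd : (p : ℤ) ∣ A) : jacobiSym (G * B) p = 1 := by
  have : Fact p.Prime := ⟨hp⟩
  have hpp : Prime (p : ℤ) := Nat.prime_iff_prime_int.mp hp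
  have hnd : ¬ (p : ℤ) ∣ G * B := by
    intro hd'
    refine hpp.not_isUnit (h p ?_)
    rw [show A * B * G = A * (G * B) by ring]
    exact mul_dvd_mul hd hd'
  by_contra hne
  have hJ : jacobiSym (G * B) p = -1 := by
    rcases jacobiSym.trichotomy (G * B) p with h0 | h1 | h1
    · rw [jacobiSym.eq_zero_iff_not_coprime] at h0
      exfalso
      apply h0
      rw [Int.gcd_comm]
      exact Int.isCoprime_iff_gcd_eq_one.mp
        ((Irreducible.coprime_iff_not_dvd hpp.irreducible).mpr hnd)
    · exact absurd h1 hne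
    · exact h1
  refine not_conicSolvable_of_forall_dvd hp ?_ hs
  intro x y z he
  have h1 : (p : ℤ) ∣ z ^ 2 - G * B * y ^ 2 := by
    rw [← he]
    obtain ⟨k, rfl⟩ := hd
    exact ⟨G * k * x ^ 2, by ring⟩
  obtain ⟨hz, hy⟩ := jacobiSym.prime_dvd_of_eq_neg_one hJ h1
  refine ⟨?_, hy, hz⟩
  have hGA : Squarefree (G * A) := by
    rw [show A * B * G = (G * A) * B by ring] at h; exact h.of_mul_left
  refine dvd_of_sq_dvd_squarefree_mul hpp hGA ?_
  rw [show G * A * x ^ 2 = z ^ 2 - G * B * y ^ 2 by linear_combination he]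
  exact dvd_sub (pow_dvd_pow_of_dvd hz 2) ((pow_dvd_pow_of_dvd hy 2).mul_left _)

/-- A solution has `G ∣ z`, so a factor `G` can be cancelled. When `ABG` is squarefree the new
coefficients are pairwise coprime, as Legendre's theorem requires. -/
theorem conicSolvable_iff_ternary {A B G : ℤ} (hG : Squarefree G) :
    ConicSolvable (G * A) (G * B) ↔
      ∃ x y z : ℤ, (x ≠ 0 ∨ y ≠ 0 ∨ z ≠ 0) ∧ A * x ^ 2 + B * y ^ 2 = G * z ^ 2 := by
  have hG0 := hG.ne_zero
  constructor
  · rintro ⟨x, y, z, hne, he⟩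
    have : G ∣ z := by
      have h2 : G ∣ z ^ 2 := ⟨A * x ^ 2 + B * y ^ 2, by linear_combination -he⟩
      exact (hG.dvd_pow_iff_dvd two_ne_zero).mp h2
    obtain ⟨w, rfl⟩ := this
    refine ⟨x, y, w, ?_, mul_left_cancel₀ hG0 (by linear_combination he)⟩
    rcases hne with h | h | h
    · exact Or.inl h
    · exact Or.inr (Or.inl h)
    · exact Or.inr (Or.inr (right_ne_zero_of_mul h))
  · rintro ⟨x, y, z, hne, he⟩
    refine ⟨x, y, G * z, ?_, by linear_combination G * he⟩
    simpa [hG0] using hne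

/-- Legendre's criterion for `G A x² + G B y² = z²`. -/
theorem conicSolvable_iff {A B G : ℤ} (hG : 0 < G) (h : Squarefree (A * B * G)) :
    ConicSolvable (G * A) (G * B) ↔ ¬ (A < 0 ∧ B < 0) ∧
      (∀ p : ℕ, p.Prime → p ≠ 2 → (p : ℤ) ∣ A → jacobiSym (G * B) p = 1) ∧
      (∀ p : ℕ, p.Prime → p ≠ 2 → (p : ℤ) ∣ B → jacobiSym (G * A) p = 1) ∧
      (∀ p : ℕ, p.Prime → p ≠ 2 → (p : ℤ) ∣ G → jacobiSym (-(A * B)) p = 1) := by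
  have hGs : Squarefree G := h.of_mul_right
  constructor
  · intro hs
    refine ⟨?_, fun p hp _ hd => jacobiSym_eq_one_of_conic h hs hp hd, fun p hp _ hd =>
      jacobiSym_eq_one_of_conic (by rwa [mul_comm B A]) hs.symm hp hd, fun p hp _ hd => ?_⟩
    · rintro ⟨hA, hB⟩
      obtain ⟨x, y, z, hne, he⟩ := hs
      have e1 : G * (-A) * x ^ 2 + G * (-B) * y ^ 2 + z ^ 2 = 0 := by linear_combination -he
      have hA' : 0 < G * (-A) := by apply mul_pos <;> omega
      have hB' : 0 < G * (-B) := by apply mul_pos <;> omega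
      have hx : 0 ≤ G * (-A) * x ^ 2 := by positivity
      have hy : 0 ≤ G * (-B) * y ^ 2 := by positivity
      have hz : 0 ≤ z ^ 2 := by positivity
      have hx0 : G * (-A) * x ^ 2 = 0 := by omega
      have hy0 : G * (-B) * y ^ 2 = 0 := by omega
      have hz0 : z ^ 2 = 0 := by omega
      have := hA'.ne'
      have := hB'.ne'
      simp_all
    · obtain ⟨x, y, z, hne, he⟩ := (conicSolvable_iff_ternary hGs).mp hs
      -- The condition at `p ∣ G` is the one already proved, applied to the rearranged equation `G
      -- z² - B y² = A x²`.
      have h' : Squarefree (G * -B * A) := by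
        rw [← Int.squarefree_natAbs] at h ⊢
        convert h using 1
        simp only [Int.natAbs_mul, Int.natAbs_neg]; ring
      have := jacobiSym_eq_one_of_conic h' ((conicSolvable_iff_ternary
        h.of_mul_left.of_mul_left).mpr ⟨z, y, x, by tauto, by linear_combination -he⟩) hp hd
      rwa [mul_neg] at this
  · rintro ⟨hneg, h1, h2, h3⟩
    rw [conicSolvable_iff_ternary hGs]
    have hs : Squarefree (A * B * -G) := by
      rw [← Int.squarefree_natAbs] at h ⊢
      simpa [Int.natAbs_mul] using h
    obtain ⟨x, y, z, hne, he⟩ := legendre hs (by omega) (by omega)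
      (by simpa [mul_comm] using exists_dvd_sq_sub h.of_mul_left.of_mul_left (G * B) h1)
      (by simpa [mul_comm] using exists_dvd_sq_sub h.of_mul_left.of_mul_right (G * A) h2)
      (by
        obtain ⟨t, ht⟩ := exists_dvd_sq_sub hGs (-(A * B)) h3
        exact ⟨t, by simpa using ht⟩)
    exact ⟨x, y, z, hne, by linear_combination he⟩

/-! ### The dihedral group of order eight as a Galois group -/

theorem conicSolvable_of_rat {a b : ℤ} {x y z : ℚ} (hne : x ≠ 0 ∨ y ≠ 0 ∨ z ≠ 0)
    (h : a * x ^ 2 + b * y ^ 2 = z ^ 2) : ConicSolvable a b := by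
  refine ⟨x.num * (y.den * z.den), y.num * (x.den * z.den), z.num * (x.den * y.den), ?_, ?_⟩
  · simpa using hne
  · have hx : (x.den : ℚ) ≠ 0 := by simp
    have hy : (y.den : ℚ) ≠ 0 := by simp
    have hz : (z.den : ℚ) ≠ 0 := by simp
    have : ((a * (x.num * (y.den * z.den)) ^ 2 + b * (y.num * (x.den * z.den)) ^ 2 : ℤ) : ℚ) =
        ((z.num * (x.den * y.den)) ^ 2 : ℤ) := by
      push_cast
      rw [← Rat.num_div_den x, ← Rat.num_div_den y, ← Rat.num_div_den z] at h
      field_simp at h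
      linear_combination h
    exact_mod_cast this

/-! ### Recognizing the dihedral group from generators and relations. -/

section Group

variable {G : Type*} [Group G] {R S : G}

theorem pow_mul_eq_mul_pow_three (hSR : R * S = S * R ^ 3) (n : ℕ) :
    R ^ n * S = S * R ^ (3 * n) := by
  induction n with
  | zero => simp
  | succ n ih => rw [pow_succ', mul_assoc, ih, ← mul_assoc, hSR, mul_assoc, ← pow_add]; ring_nf

/-- The homomorphism from the dihedral group of order `8` given by its presentation. -/
def dihedralLift (hR : R ^ 4 = 1) (hS : S * S = 1) (hSR : R * S = S * R ^ 3) :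
    DihedralGroup 4 →* G :=
  MonoidHom.mk' (fun x => match x with
    | .r i => R ^ i.val
    | .sr i => S * R ^ i.val) (by
      -- The exponent `3` plays the role of `-1`, so that only natural powers of `R` occur.
      have key : ∀ i j : ZMod 4, (j - i).val = (3 * i.val + j.val) % 4 := by decide
      rintro (i | i) (j | j)
      · simp only [DihedralGroup.r_mul_r, ← pow_add, ZMod.val_add]
        exact (pow_eq_pow_mod _ hR).symm
      · simp only [DihedralGroup.r_mul_sr, key]
        rw [← mul_assoc, pow_mul_eq_mul_pow_three hSR, mul_assoc, ← pow_add,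
          ← pow_eq_pow_mod _ hR]
      · simp only [DihedralGroup.sr_mul_r, ZMod.val_add]
        rw [mul_assoc, ← pow_add, ← pow_eq_pow_mod _ hR]
      · simp only [DihedralGroup.sr_mul_sr, key]
        rw [mul_assoc, ← mul_assoc (R ^ i.val), pow_mul_eq_mul_pow_three hSR, mul_assoc,
          ← mul_assoc S, hS, one_mul, ← pow_add, ← pow_eq_pow_mod _ hR])

theorem nonempty_mulEquiv_dihedral (hR : R ^ 4 = 1) (hS : S * S = 1) (hSR : R * S = S * R ^ 3)
    (h2 : R ^ 2 ≠ 1) (hne : ∀ n, S ≠ R ^ n)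
    (hall : ∀ g : G, ∃ n, g = R ^ n ∨ g = S * R ^ n) : Nonempty (G ≃* DihedralGroup 4) := by
  refine ⟨(MulEquiv.ofBijective (dihedralLift hR hS hSR) ⟨?_, ?_⟩).symm⟩
  · rw [injective_iff_map_eq_one]
    rintro (i | i) hi
    · have h1 : R ≠ 1 := by rintro rfl; simp at h2
      have h3 : R ^ 3 ≠ 1 := by
        intro h; apply h1; rw [pow_succ, h, one_mul] at hR; exact hR
      change R ^ i.val = 1 at hi
      rw [DihedralGroup.one_def]
      congr 1
      fin_cases i
      · rfl
      · exact absurd ((pow_one R).symm.trans hi) h1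
      · exact absurd hi h2
      · exact absurd hi h3
    · change S * R ^ i.val = 1 at hi
      refine absurd ?_ (hne (3 * i.val))
      calc S = S * (R ^ 4) ^ i.val := by rw [hR]; simp
        _ = S * R ^ i.val * R ^ (3 * i.val) := by rw [mul_assoc, ← pow_add, ← pow_mul]; ring_nf
        _ = _ := by rw [hi, one_mul]
  · intro g
    have hn : ∀ n : ℕ, R ^ ((n : ZMod 4)).val = R ^ n := by
      intro n; rw [ZMod.val_natCast]; exact (pow_eq_pow_mod _ hR).symm
    obtain ⟨n, rfl | rfl⟩ := hall g
    · exact ⟨.r n, hn n⟩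
    · exact ⟨.sr n, by change S * R ^ ((n : ZMod 4)).val = _; rw [hn]⟩

end Group

theorem map_eq_or_eq_neg {E : Type*} [Field E] [Algebra ℚ E] (σ : E ≃ₐ[ℚ] E) {x : E} {a : ℤ}
    (hx : x ^ 2 = a) : σ x = x ∨ σ x = -x := by
  apply sq_eq_sq_iff_eq_or_eq_neg.mp
  rw [← map_pow, hx, map_intCast]

/-! ### From a dihedral extension to a rational point on a conic. -/

section Forward

variable {E : Type*} [Field E] [Algebra ℚ E] [FiniteDimensional ℚ E] [IsGalois ℚ E]
  {R S : E ≃ₐ[ℚ] E}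

theorem exists_rat_of_fixed (hgen : ∀ σ : E ≃ₐ[ℚ] E, ∃ n, σ = R ^ n ∨ σ = S * R ^ n) {x : E}
    (hR : R x = x) (hS : S x = x) : ∃ q : ℚ, algebraMap ℚ E q = x := by
  refine (IsGalois.mem_range_algebraMap_iff_fixed x).mpr fun σ => ?_
  have hn : ∀ n : ℕ, (R ^ n) x = x := by
    intro n
    induction n with
    | zero => simp
    | succ n ih => rw [pow_succ, AlgEquiv.mul_apply, hR, ih]
  obtain ⟨n, rfl | rfl⟩ := hgen σ
  · exact hn n
  · rw [AlgEquiv.mul_apply, hn, hS]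

/-- Take `θ ≠ 0` fixed by `S` and negated by `R²`. Then `θ² = u + v α`, `(R θ)² = u - v α` and `θ ·
R θ = c β` with rational `u, v, c`; multiplying the first two gives `u² - a v² = b c²`. -/
theorem conicSolvable_of_dihedral (hSS : S * S = 1) (hR : R ^ 4 = 1) (hSR : R * S = S * R ^ 3)
    (hne1 : R ^ 2 ≠ 1) (hneS : R ^ 2 ≠ S)
    (hgen : ∀ σ : E ≃ₐ[ℚ] E, ∃ n, σ = R ^ n ∨ σ = S * R ^ n) {a b : ℤ} {α β : E}
    (hα : α ^ 2 = a) (hβ : β ^ 2 = b) (hα0 : α ≠ 0) (hβ0 : β ≠ 0) (hRα : R α = -α) (hSα : S α = α)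
    (hRβ : R β = -β) (hSβ : S β = -β) : ConicSolvable a b := by
  have hSR2 : ∀ x, S (R (R x)) = R (R (S x)) := by
    have h : R * (R * S) = S * (R * R) := by
      have := pow_mul_eq_mul_pow_three hSR 2
      rw [show 3 * 2 = 4 + 2 by rfl, pow_add, hR, one_mul, sq, mul_assoc] at this
      exact this
    intro x
    exact (DFunLike.congr_fun h x).symm
  have hSR1 : ∀ x, S (R x) = R (R (R (S x))) := by
    have h : R * (R * (R * S)) = S * R := by
      have := pow_mul_eq_mul_pow_three hSR 3
      rw [show 3 * 3 = 4 + 4 + 1 by rfl, pow_add, pow_add, hR, one_mul, one_mul, pow_one, pow_succ,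
        sq, mul_assoc, mul_assoc] at this
      exact this
    intro x
    exact (DFunLike.congr_fun h x).symm
  have hR4 : ∀ x, R (R (R (R x))) = x := fun x => by
    simpa [pow_succ, AlgEquiv.mul_apply] using DFunLike.congr_fun hR x
  -- Otherwise `R²` would fix the fixed field of `S` and hence, by the Galois correspondence, lie in
  -- the group generated by `S`.
  obtain ⟨x, hxS, hxR⟩ : ∃ x : E, S x = x ∧ R (R x) ≠ x := by
    by_contra! hcon
    have hmem : R ^ 2 ∈ Subgroup.zpowers S := by
      rw [← IntermediateField.fixingSubgroup_fixedField (Subgroup.zpowers S),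
        IntermediateField.mem_fixingSubgroup_iff]
      intro x hx
      rw [sq]
      exact hcon x (hx ⟨S, Subgroup.mem_zpowers S⟩)
    obtain ⟨k, hk⟩ := hmem
    have hS2 : S ^ (2 : ℤ) = 1 := by rw [zpow_two, hSS]
    rcases Int.even_or_odd' k with ⟨m, rfl | rfl⟩
    · apply hne1
      rw [← hk]; simp [zpow_mul, hS2]
    · apply hneS
      rw [← hk]; simp [zpow_add, zpow_mul, hS2]
  -- Projection of `x` to the `-1`-eigenspace of `R²`.
  set θ : E := x - R (R x) with hθ
  have hθ0 : θ ≠ 0 := sub_ne_zero.mpr hxR.symm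
  have hSθ : S θ = θ := by rw [hθ, map_sub, hSR2, hxS]
  have hRRθ : R (R θ) = -θ := by rw [hθ]; simp only [map_sub, hR4]; ring
  have hRθ0 : R θ ≠ 0 := by simpa using hθ0
  have hSRθ : S (R θ) = -R θ := by rw [hSR1, hSθ, hRRθ, map_neg]
  obtain ⟨c, hc⟩ := exists_rat_of_fixed hgen (x := θ * R θ / β)
    (by rw [map_div₀, map_mul, hRRθ, hRβ]; field_simp)
    (by rw [map_div₀, map_mul, hSθ, hSRθ, hSβ]; field_simp)
  obtain ⟨u, hu⟩ := exists_rat_of_fixed hgen (x := (θ ^ 2 + R θ ^ 2) / 2)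
    (by simp only [map_div₀, map_add, map_pow, hRRθ, map_ofNat]; ring)
    (by simp only [map_div₀, map_add, map_pow, hSθ, hSRθ, map_ofNat]; ring)
  obtain ⟨v, hv⟩ := exists_rat_of_fixed hgen (x := (θ ^ 2 - R θ ^ 2) / (2 * α))
    (by simp only [map_div₀, map_sub, map_mul, map_pow, hRRθ, map_ofNat, hRα]; field_simp; ring)
    (by simp only [map_div₀, map_sub, map_mul, map_pow, hSθ, hSRθ, map_ofNat, hSα]; ring)
  refine conicSolvable_of_rat (x := v) (y := c) (z := u) (Or.inr (Or.inl ?_)) ?_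
  · rintro rfl
    rw [map_zero] at hc
    exact div_ne_zero (mul_ne_zero hθ0 hRθ0) hβ0 hc.symm
  · apply (algebraMap ℚ E).injective
    simp only [map_add, map_mul, map_pow, map_intCast, hu, hv, hc]
    rw [← hα, ← hβ]
    have : CharZero E := algebraRat.charZero E
    field_simp
    ring

/-- The signs by which `R` and `S` act on `x₁, x₂, x₃` are nontrivial because no `dᵢ` is a square,
and the pair for `x₃` is the product of the other two. So the pairs are `(-, +)`, `(-, -)`, `(+, -)`
in some order, and the first two serve as `α` and `β`. -/
theorem conicSolvable_of_mulEquiv (φ : (E ≃ₐ[ℚ] E) ≃* DihedralGroup 4) {d₁ d₂ d₃ m : ℤ}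
    (h₁ : ¬ IsSquare (d₁ : ℚ)) (h₂ : ¬ IsSquare (d₂ : ℚ)) (h₃ : ¬ IsSquare (d₃ : ℚ))
    (hm : d₃ * m ^ 2 = d₁ * d₂) {x₁ x₂ x₃ : E}
    (hx₁ : x₁ ^ 2 = d₁) (hx₂ : x₂ ^ 2 = d₂) (hx₃ : x₃ ^ 2 = d₃) :
    ConicSolvable d₁ d₂ ∨ ConicSolvable d₁ d₃ ∨ ConicSolvable d₂ d₃ := by
  have : CharZero E := algebraRat.charZero E
  obtain ⟨R, hRφ⟩ : ∃ R, φ R = .r 1 := φ.surjective _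
  obtain ⟨S, hSφ⟩ : ∃ S, φ S = .sr 0 := φ.surjective _
  have hR : R ^ 4 = 1 := φ.injective (by rw [map_pow, hRφ, map_one]; decide)
  have hSS : S * S = 1 := φ.injective (by rw [map_mul, hSφ, map_one]; decide)
  have hSR : R * S = S * R ^ 3 :=
    φ.injective (by rw [map_mul, map_mul, map_pow, hSφ, hRφ]; decide)
  have hne1 : R ^ 2 ≠ 1 := fun h => by
    have := congrArg φ h
    rw [map_pow, hRφ, map_one] at this
    revert this; decide
  have hneS : R ^ 2 ≠ S := fun h => by
    have := congrArg φ h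
    rw [map_pow, hRφ, hSφ] at this
    revert this; decide
  have hgen : ∀ σ : E ≃ₐ[ℚ] E, ∃ n, σ = R ^ n ∨ σ = S * R ^ n := by
    intro σ
    rcases hσ : φ σ with i | i
    · refine ⟨i.val, Or.inl (φ.injective ?_)⟩
      rw [hσ, map_pow, hRφ, DihedralGroup.r_one_pow, ZMod.natCast_zmod_val]
    · refine ⟨i.val, Or.inr (φ.injective ?_)⟩
      rw [hσ, map_mul, map_pow, hRφ, hSφ, DihedralGroup.r_one_pow, ZMod.natCast_zmod_val,
        DihedralGroup.sr_mul_r, zero_add]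
  have nz : ∀ {d : ℤ} {x : E}, ¬ IsSquare (d : ℚ) → x ^ 2 = d → x ≠ 0 := by
    rintro d x hd hx rfl
    apply hd
    have : (d : E) = 0 := by rw [← hx]; simp
    have : d = 0 := by exact_mod_cast this
    simp [this]
  have notboth : ∀ {d : ℤ} {x : E}, ¬ IsSquare (d : ℚ) → x ^ 2 = d → ¬ (R x = x ∧ S x = x) := by
    rintro d x hd hx ⟨h1, h2⟩
    obtain ⟨q, rfl⟩ := exists_rat_of_fixed hgen h1 h2
    apply hd
    refine ⟨q, (algebraMap ℚ E).injective ?_⟩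
    rw [map_intCast, ← hx, map_mul, sq]
  have n₁ := nz h₁ hx₁
  have n₂ := nz h₂ hx₂
  have n₃ := nz h₃ hx₃
  have hx12 : ∃ c : ℚ, x₃ = c * (x₁ * x₂) := by
    have : (x₃ * m) ^ 2 = (x₁ * x₂) ^ 2 := by
      rw [mul_pow, mul_pow, hx₁, hx₂, hx₃]; exact_mod_cast hm
    have hm0 : (m : E) ≠ 0 := by
      intro h0
      rw [h0, mul_zero] at this
      exact pow_ne_zero 2 (mul_ne_zero n₁ n₂) (by rw [← this]; ring)
    rcases sq_eq_sq_iff_eq_or_eq_neg.mp this with h | h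
    · exact ⟨(m : ℚ)⁻¹, by push_cast; field_simp; linear_combination h⟩
    · exact ⟨-(m : ℚ)⁻¹, by push_cast; field_simp; linear_combination h⟩
  obtain ⟨c, hc⟩ := hx12
  have hσ3 : ∀ σ : E ≃ₐ[ℚ] E, σ x₃ = c * (σ x₁ * σ x₂) := by
    intro σ; rw [hc]; simp
  have main : ∀ {a b : ℤ} {α β : E}, α ^ 2 = a → β ^ 2 = b → α ≠ 0 → β ≠ 0 → R α = -α →
      S α = α → R β = -β → S β = -β → ConicSolvable a b :=
    fun h1 h2 h3 h4 h5 h6 h7 h8 =>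
      conicSolvable_of_dihedral hSS hR hSR hne1 hneS hgen h1 h2 h3 h4 h5 h6 h7 h8
  have b₁ := notboth h₁ hx₁
  have b₂ := notboth h₂ hx₂
  have b₃ := notboth h₃ hx₃
  have R3 := hσ3 R
  have S3 := hσ3 S
  -- All sixteen sign patterns on `x₁, x₂`; each either makes some `xᵢ` rational or exhibits the
  -- required pair.
  rcases map_eq_or_eq_neg R hx₁ with R1 | R1 <;> rcases map_eq_or_eq_neg S hx₁ with S1 | S1 <;>
  rcases map_eq_or_eq_neg R hx₂ with R2 | R2 <;> rcases map_eq_or_eq_neg S hx₂ with S2 | S2 <;>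
  rw [R1, R2] at R3 <;> rw [S1, S2] at S3 <;>
  simp only [mul_neg, neg_mul, neg_neg, ← hc] at R3 S3 <;>
  first
    | exact (b₁ ⟨R1, S1⟩).elim
    | exact (b₂ ⟨R2, S2⟩).elim
    | exact (b₃ ⟨R3, S3⟩).elim
    | exact Or.inl (main hx₁ hx₂ n₁ n₂ R1 S1 R2 S2)
    | exact Or.inl (main hx₂ hx₁ n₂ n₁ R2 S2 R1 S1).symm
    | exact Or.inr (Or.inl (main hx₁ hx₃ n₁ n₃ R1 S1 R3 S3))
    | exact Or.inr (Or.inl (main hx₃ hx₁ n₃ n₁ R3 S3 R1 S1).symm)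
    | exact Or.inr (Or.inr (main hx₂ hx₃ n₂ n₃ R2 S2 R3 S3))
    | exact Or.inr (Or.inr (main hx₃ hx₂ n₃ n₂ R3 S3 R2 S2).symm)

end Forward

/-! ### From a quartic generator to a dihedral Galois group. -/

section Backward

variable {E : Type*} [Field E] [Algebra ℚ E]

theorem exists_map_eq_neg [FiniteDimensional ℚ E] [IsGalois ℚ E] {a : ℤ} {x : E}
    (ha : ¬ IsSquare (a : ℚ)) (hx : x ^ 2 = a) : ∃ σ : E ≃ₐ[ℚ] E, σ x = -x := by
  by_contra! hcon
  obtain ⟨q, rfl⟩ := (IsGalois.mem_range_algebraMap_iff_fixed x).mpr fun σ =>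
    (map_eq_or_eq_neg σ hx).resolve_right (hcon σ)
  apply ha
  refine ⟨q, (algebraMap ℚ E).injective ?_⟩
  rw [map_intCast, ← hx, map_mul, sq]

/-- None of `α`, `β`, `α β` is rational, so each is negated by some automorphism; products of these
automorphisms realize the two patterns. -/
theorem exists_sign_pattern [FiniteDimensional ℚ E] [IsGalois ℚ E] {a b : ℤ} {α β : E}
    (ha : ¬ IsSquare (a : ℚ)) (hb : ¬ IsSquare (b : ℚ)) (hab : ¬ IsSquare ((a * b : ℤ) : ℚ))
    (hα : α ^ 2 = a) (hβ : β ^ 2 = b) :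
    (∃ σ : E ≃ₐ[ℚ] E, σ α = -α ∧ σ β = -β) ∧ ∃ σ : E ≃ₐ[ℚ] E, σ α = α ∧ σ β = -β := by
  have : CharZero E := algebraRat.charZero E
  have hαβ : (α * β) ^ 2 = (a * b : ℤ) := by rw [mul_pow, hα, hβ]; push_cast; rfl
  obtain ⟨σ, hσ⟩ := exists_map_eq_neg ha hα
  obtain ⟨τ, hτ⟩ := exists_map_eq_neg hb hβ
  obtain ⟨ρ, hρ⟩ := exists_map_eq_neg hab hαβ
  have hne : α * β ≠ 0 := by
    intro h0
    apply hab
    have : ((a * b : ℤ) : E) = 0 := by rw [← hαβ, h0]; simp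
    have h' : a * b = 0 := by exact_mod_cast this
    rw [h']; simp
  have hρ' : (ρ α = -α ∧ ρ β = β) ∨ (ρ α = α ∧ ρ β = -β) := by
    rw [map_mul] at hρ
    rcases map_eq_or_eq_neg ρ hα with h1 | h1 <;> rcases map_eq_or_eq_neg ρ hβ with h2 | h2
    · rw [h1, h2] at hρ; exact absurd (self_eq_neg.mp hρ) hne
    · exact Or.inr ⟨h1, h2⟩
    · exact Or.inl ⟨h1, h2⟩
    · rw [h1, h2, neg_mul_neg] at hρ; exact absurd (self_eq_neg.mp hρ) hne
  rcases map_eq_or_eq_neg σ hβ with h1 | h1 <;> rcases map_eq_or_eq_neg τ hα with h2 | h2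
  · exact ⟨⟨σ * τ, by simp [*], by simp [*]⟩, τ, h2, hτ⟩
  · exact ⟨⟨τ, h2, hτ⟩, σ * τ, by simp [*], by simp [*]⟩
  · exact ⟨⟨σ, hσ, h1⟩, τ, h2, hτ⟩
  · refine ⟨⟨σ, hσ, h1⟩, ?_⟩
    rcases hρ' with ⟨h3, h4⟩ | ⟨h3, h4⟩
    · exact ⟨σ * ρ, by simp [*], by simp [*]⟩
    · exact ⟨ρ, h3, h4⟩

/-- An automorphism is determined by its values on `θ` and `θ'`. It maps `θ` to `±θ` or `±θ'`
according to its sign on `α`, and `θ θ' = c β` then fixes the image of `θ'` by its sign on `β`. The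
eight possibilities are the symmetries of a square with vertices `±θ, ±θ'`. -/
theorem nonempty_galois_mulEquiv_dihedral [FiniteDimensional ℚ E] [IsGalois ℚ E] {a b : ℤ}
    {α β θ θ' : E} {u v c : ℤ}
    (ha : ¬ IsSquare (a : ℚ)) (hb : ¬ IsSquare (b : ℚ)) (hab : ¬ IsSquare ((a * b : ℤ) : ℚ))
    (hα : α ^ 2 = a) (hβ : β ^ 2 = b) (hθ : θ ^ 2 = u + v * α) (hθ' : θ' ^ 2 = u - v * α)
    (hθθ' : θ * θ' = c * β) (hv : v ≠ 0) (hc : c ≠ 0) (hβ0 : β ≠ 0)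
    (hext : ∀ σ τ : E ≃ₐ[ℚ] E, σ θ = τ θ → σ θ' = τ θ' → σ = τ) :
    Nonempty ((E ≃ₐ[ℚ] E) ≃* DihedralGroup 4) := by
  have : CharZero E := algebraRat.charZero E
  have hcE : (c : E) ≠ 0 := by exact_mod_cast hc
  have hvE : (v : E) ≠ 0 := by exact_mod_cast hv
  have hθ0 : θ ≠ 0 := by rintro rfl; rw [zero_mul] at hθθ'; exact mul_ne_zero hcE hβ0 hθθ'.symm
  have hθ'0 : θ' ≠ 0 := by
    rintro rfl; rw [mul_zero] at hθθ'; exact mul_ne_zero hcE hβ0 hθθ'.symm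
  have map1 : ∀ σ : E ≃ₐ[ℚ] E, σ α = -α → σ θ = θ' ∨ σ θ = -θ' := by
    intro σ h
    apply sq_eq_sq_iff_eq_or_eq_neg.mp
    rw [← map_pow, hθ, hθ', map_add, map_mul, h]; simp [sub_eq_add_neg]
  have map2 : ∀ σ : E ≃ₐ[ℚ] E, σ α = α → σ θ = θ ∨ σ θ = -θ := by
    intro σ h
    apply sq_eq_sq_iff_eq_or_eq_neg.mp
    rw [← map_pow, hθ, map_add, map_mul, h]; simp
  have mapβ : ∀ σ : E ≃ₐ[ℚ] E, σ θ * σ θ' = c * σ β := by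
    intro σ; rw [← map_mul, hθθ']; simp
  obtain ⟨⟨σ, hσα, hσβ⟩, τ, hτα, hτβ⟩ := exists_sign_pattern ha hb hab hα hβ
  -- An automorphism negating both `α` and `β` is this rotation or its inverse; in the latter case
  -- its cube is taken.
  obtain ⟨R, hR, hR'⟩ : ∃ R : E ≃ₐ[ℚ] E, R θ = θ' ∧ R θ' = -θ := by
    have h := mapβ σ
    rw [hσβ, mul_neg, ← hθθ'] at h
    rcases map1 σ hσα with h1 | h1
    · refine ⟨σ, h1, mul_left_cancel₀ hθ'0 ?_⟩
      rw [h1] at h; linear_combination h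
    · have h2 : σ θ' = θ := mul_left_cancel₀ hθ'0 (by rw [h1] at h; linear_combination -h)
      exact ⟨σ * σ * σ, by simp [h1, h2], by simp [h1, h2]⟩
  have hRn : (R ^ 2) θ = -θ ∧ (R ^ 2) θ' = -θ' := by simp [sq, hR, hR']
  -- An automorphism fixing `α` and negating `β` is this reflection up to the central element `R²`.
  obtain ⟨S, hS, hS'⟩ : ∃ S : E ≃ₐ[ℚ] E, S θ = θ ∧ S θ' = -θ' := by
    have h := mapβ τ
    rw [hτβ, mul_neg, ← hθθ'] at h
    rcases map2 τ hτα with h1 | h1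
    · refine ⟨τ, h1, mul_left_cancel₀ hθ0 ?_⟩
      rw [h1] at h; linear_combination h
    · have h2 : τ θ' = θ' := mul_left_cancel₀ hθ0 (by rw [h1] at h; linear_combination -h)
      exact ⟨R * R * τ, by simp [h1, hR, hR'], by simp [h2, hR, hR']⟩
  have neg_ne : ∀ {x : E}, x ≠ 0 → -x ≠ x := fun hx h => hx (neg_eq_self.mp h)
  have hvα : (v : E) * α ≠ 0 := by
    refine mul_ne_zero hvE ?_
    rintro rfl
    apply ha
    have : (a : E) = 0 := by rw [← hα]; simp
    have : a = 0 := by exact_mod_cast this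
    simp [this]
  have hne1 : θ ≠ θ' := by
    rintro rfl
    apply neg_ne hvα
    linear_combination hθ - hθ'
  have hne2 : θ ≠ -θ' := by
    rintro h
    apply neg_ne hvα
    rw [h, neg_sq] at hθ
    linear_combination hθ - hθ'
  have hR4 : R ^ 4 = 1 := hext _ _ (by simp [pow_succ, hR, hR']) (by simp [pow_succ, hR, hR'])
  refine nonempty_mulEquiv_dihedral (R := R) (S := S) hR4 ?_ ?_ ?_ ?_ ?_
  · exact hext _ _ (by simp [hS]) (by simp [hS'])
  · exact hext _ _ (by simp [pow_succ, hS, hS', hR, hR']) (by simp [pow_succ, hS', hS, hR, hR'])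
  · intro h
    have := hRn.1
    rw [h] at this
    exact neg_ne hθ0 this.symm
  · intro n h
    rw [pow_eq_pow_mod n hR4] at h
    have hn := Nat.mod_lt n (show 4 > 0 by norm_num)
    have e1 := DFunLike.congr_fun h θ
    have e2 := DFunLike.congr_fun h θ'
    rw [hS] at e1
    rw [hS'] at e2
    interval_cases n % 4
    · exact neg_ne hθ'0 (by simpa using e2)
    · exact hne1 (by simpa [hR] using e1)
    · exact neg_ne hθ0 (by simpa [hRn] using e1.symm)
    · exact hne2 (by simpa [pow_succ, hR, hR'] using e1)
  · intro g
    have hgα := map_eq_or_eq_neg g hα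
    have hgβ := map_eq_or_eq_neg g hβ
    have h := mapβ g
    have fin : ∀ k : ℕ, (R ^ k) θ = g θ → (R ^ k) θ' = g θ' →
        ∃ n, g = R ^ n ∨ g = S * R ^ n := fun k h1 h2 => ⟨k, Or.inl (hext _ _ h1.symm h2.symm)⟩
    have fin' : ∀ k : ℕ, (S * R ^ k) θ = g θ → (S * R ^ k) θ' = g θ' →
        ∃ n, g = R ^ n ∨ g = S * R ^ n := fun k h1 h2 => ⟨k, Or.inr (hext _ _ h1.symm h2.symm)⟩
    have hg' : ∀ {x y : E}, x ≠ 0 → g θ = x → x * y = c * g β → g θ' = y := by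
      intro x y hx h1 h2
      rw [← h2, h1] at h
      exact mul_left_cancel₀ hx h
    have nθ := neg_ne_zero.mpr hθ0
    have nθ' := neg_ne_zero.mpr hθ'0
    rcases hgα with h1 | h1 <;> rcases hgβ with h2 | h2
    · rcases map2 g h1 with h3 | h3
      · have h4 := hg' (y := θ') hθ0 h3 (by rw [h2, hθθ'])
        exact fin 0 (by simp [h3]) (by simp [h4])
      · have h4 := hg' (y := -θ') nθ h3 (by rw [h2, neg_mul_neg, hθθ'])
        exact fin 2 (by simp [h3, hRn]) (by simp [h4, hRn])
    · rcases map2 g h1 with h3 | h3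
      · have h4 := hg' (y := -θ') hθ0 h3 (by rw [h2, mul_neg, hθθ', mul_neg])
        exact fin' 0 (by simp [h3, hS]) (by simp [h4, hS'])
      · have h4 := hg' (y := θ') nθ h3 (by rw [h2, neg_mul, hθθ', mul_neg])
        exact fin' 2 (by simp [h3, hS, hRn]) (by simp [h4, hS', hRn])
    · rcases map1 g h1 with h3 | h3
      · have h4 := hg' (y := θ) hθ'0 h3 (by rw [h2, mul_comm, hθθ'])
        exact fin' 3 (by simp [pow_succ, h3, hS', hR, hR'])
          (by simp [pow_succ, h4, hS, hR, hR'])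
      · have h4 := hg' (y := -θ) nθ' h3 (by rw [h2, neg_mul_neg, mul_comm, hθθ'])
        exact fin' 1 (by simp [h3, hS', hR]) (by simp [h4, hS, hR'])
    · rcases map1 g h1 with h3 | h3
      · have h4 := hg' (y := -θ) hθ'0 h3 (by rw [h2, mul_neg, mul_comm, hθθ', mul_neg])
        exact fin 1 (by simp [h3, hR]) (by simp [h4, hR'])
      · have h4 := hg' (y := θ) nθ' h3 (by rw [h2, neg_mul, mul_comm, hθθ', mul_neg])
        exact fin 3 (by simp [pow_succ, h3, hR, hR']) (by simp [pow_succ, h4, hR, hR'])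

end Backward

/-! ### Dihedral extensions containing a given biquadratic field. -/

theorem exists_dihedral_extension {a b : ℤ} (ha : ¬ IsSquare (a : ℚ)) (hb : ¬ IsSquare (b : ℚ))
    (hab : ¬ IsSquare ((a * b : ℤ) : ℚ)) (hs : ConicSolvable a b) :
    ∃ F : IntermediateField ℚ (AlgebraicClosure ℚ),
      (∀ x : AlgebraicClosure ℚ, x ^ 2 = a ∨ x ^ 2 = b → x ∈ F) ∧
      FiniteDimensional ℚ F ∧ IsGalois ℚ F ∧ Nonempty ((F ≃ₐ[ℚ] F) ≃* DihedralGroup 4) := by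
  obtain ⟨v, c, u, hne, he⟩ := hs
  have hc : c ≠ 0 := by
    rintro rfl
    have he' : a * v ^ 2 = u ^ 2 := by linear_combination he
    have hv : v ≠ 0 := by
      rintro rfl
      have : u = 0 := by simpa using he'.symm
      simp [this] at hne
    have hvq : (v : ℚ) ≠ 0 := by exact_mod_cast hv
    refine ha ⟨u / v, ?_⟩
    field_simp
    exact_mod_cast he'
  have hv : v ≠ 0 := by
    rintro rfl
    have he' : b * c ^ 2 = u ^ 2 := by linear_combination he
    have hcq : (c : ℚ) ≠ 0 := by exact_mod_cast hc
    refine hb ⟨u / c, ?_⟩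
    field_simp
    exact_mod_cast he'
  obtain ⟨α, hα⟩ := IsAlgClosed.exists_pow_nat_eq (a : AlgebraicClosure ℚ) (n := 2) two_pos
  obtain ⟨β, hβ⟩ := IsAlgClosed.exists_pow_nat_eq (b : AlgebraicClosure ℚ) (n := 2) two_pos
  obtain ⟨θ, hθ⟩ := IsAlgClosed.exists_pow_nat_eq ((u : AlgebraicClosure ℚ) + v * α)
    (n := 2) two_pos
  have he_cast : (a : AlgebraicClosure ℚ) * v ^ 2 + b * c ^ 2 = u ^ 2 := by exact_mod_cast he
  have hc_cast : (c : AlgebraicClosure ℚ) ≠ 0 := by exact_mod_cast hc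
  have hv_cast : (v : AlgebraicClosure ℚ) ≠ 0 := by exact_mod_cast hv
  have hb0 : (b : AlgebraicClosure ℚ) ≠ 0 := by
    have : b ≠ 0 := by rintro rfl; simp at hb
    exact_mod_cast this
  have hβ0 : β ≠ 0 := by rintro rfl; apply hb0; rw [← hβ]; simp
  have hN : ((u : AlgebraicClosure ℚ) + v * α) * (u - v * α) = b * c ^ 2 := by
    linear_combination -he_cast - v ^ 2 * hα
  have hθ0 : θ ≠ 0 := by
    rintro rfl
    rw [← hθ] at hN
    have : (b : AlgebraicClosure ℚ) * c ^ 2 = 0 := by rw [← hN]; simp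
    exact mul_ne_zero hb0 (pow_ne_zero 2 hc_cast) this
  -- Defining `θ'` as a quotient, and not as a chosen square root of `u - v α`, fixes its sign.
  obtain ⟨θ', hθθ'⟩ : ∃ θ', θ * θ' = c * β := ⟨c * β / θ, by field_simp⟩
  have hθ' : θ' ^ 2 = u - v * α := by
    have h2 : θ ^ 2 ≠ 0 := pow_ne_zero 2 hθ0
    apply mul_left_cancel₀ h2
    rw [← mul_pow, hθθ', mul_pow, hβ, hθ, hN]; ring
  let p : Polynomial ℚ := (Polynomial.X ^ 2 - Polynomial.C (u : ℚ)) ^ 2 -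
    Polynomial.C ((v ^ 2 * a : ℤ) : ℚ)
  have hp : p.Monic := by
    have h1 : (Polynomial.X ^ 2 - Polynomial.C (u : ℚ)).Monic :=
      Polynomial.monic_X_pow_sub_C _ two_ne_zero
    refine (h1.pow 2).sub_of_left ?_
    rw [Polynomial.degree_pow, Polynomial.degree_X_pow_sub_C two_pos]
    exact lt_of_le_of_lt Polynomial.degree_C_le (by norm_num)
  have hp0 : p ≠ 0 := hp.ne_zero
  have hroot : ∀ x : AlgebraicClosure ℚ,
      x ∈ p.rootSet (AlgebraicClosure ℚ) ↔ (x ^ 2 - u) ^ 2 = v ^ 2 * a := by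
    intro x
    rw [Polynomial.mem_rootSet_of_ne hp0]
    simp [p, sub_eq_zero]
  have hroot' : ∀ x : AlgebraicClosure ℚ,
      x ∈ p.rootSet (AlgebraicClosure ℚ) → x = θ ∨ x = -θ ∨ x = θ' ∨ x = -θ' := by
    intro x hx
    rw [hroot] at hx
    have : (x ^ 2 - θ ^ 2) * (x ^ 2 - θ' ^ 2) = 0 := by
      rw [hθ, hθ']; linear_combination hx - v ^ 2 * hα
    rcases mul_eq_zero.mp this with h | h
    · rcases sq_eq_sq_iff_eq_or_eq_neg.mp (sub_eq_zero.mp h) with h | h <;> simp [h]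
    · rcases sq_eq_sq_iff_eq_or_eq_neg.mp (sub_eq_zero.mp h) with h | h <;> simp [h]
  let F : IntermediateField ℚ (AlgebraicClosure ℚ) :=
    IntermediateField.adjoin ℚ (p.rootSet (AlgebraicClosure ℚ))
  have hsplit : p.IsSplittingField ℚ F :=
    IntermediateField.adjoin_rootSet_isSplittingField (IsAlgClosed.splits _)
  have hfd : FiniteDimensional ℚ F := Polynomial.IsSplittingField.finiteDimensional F p
  have hnormal : Normal ℚ F := Normal.of_isSplittingField p
  have hgal : IsGalois ℚ F := ⟨⟩
  have mθ : θ ∈ F := IntermediateField.subset_adjoin _ _ <| by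
    rw [hroot, hθ]; linear_combination v ^ 2 * hα
  have mθ' : θ' ∈ F := IntermediateField.subset_adjoin _ _ <| by
    rw [hroot, hθ']; linear_combination v ^ 2 * hα
  have mα : α ∈ F := by
    rw [show α = (θ ^ 2 - u) / v by rw [hθ]; field_simp; ring]
    exact div_mem (sub_mem (pow_mem mθ 2) (intCast_mem _ _)) (intCast_mem _ _)
  have mβ : β ∈ F := by
    rw [show β = θ * θ' / c by rw [hθθ']; field_simp]
    exact div_mem (mul_mem mθ mθ') (intCast_mem _ _)
  refine ⟨F, ?_, hfd, hgal, ?_⟩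
  · rintro x (hx | hx)
    · rw [← hα] at hx
      rcases sq_eq_sq_iff_eq_or_eq_neg.mp hx with rfl | rfl
      exacts [mα, neg_mem mα]
    · rw [← hβ] at hx
      rcases sq_eq_sq_iff_eq_or_eq_neg.mp hx with rfl | rfl
      exacts [mβ, neg_mem mβ]
  · refine nonempty_galois_mulEquiv_dihedral (E := F) (α := ⟨α, mα⟩) (β := ⟨β, mβ⟩)
      (θ := ⟨θ, mθ⟩) (θ' := ⟨θ', mθ'⟩) (u := u) (v := v) (c := c) ha hb hab ?_ ?_ ?_ ?_ ?_ hv hc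
      ?_ ?_
    · exact Subtype.ext (by simpa using hα)
    · exact Subtype.ext (by simpa using hβ)
    · exact Subtype.ext (by simpa using hθ)
    · exact Subtype.ext (by simpa using hθ')
    · exact Subtype.ext (by simpa using hθθ')
    · intro h; exact hβ0 (congrArg Subtype.val h)
    · intro σ τ h1 h2
      have h3 : ∀ ρ : F ≃ₐ[ℚ] F, ∀ x (hx : x ∈ F), ρ ⟨-x, neg_mem hx⟩ = -ρ ⟨x, hx⟩ :=
        fun ρ x hx => map_neg ρ ⟨x, hx⟩
      have : (σ : F →ₐ[ℚ] F) = τ := by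
        refine IntermediateField.algHom_ext_of_eq_adjoin ℚ
          (s := p.rootSet (AlgebraicClosure ℚ)) rfl ?_
        intro x hx
        change σ ⟨x, _⟩ = τ ⟨x, _⟩
        rcases hroot' x hx with rfl | rfl | h | h
        · exact h1
        · rw [h3 σ _ mθ, h3 τ _ mθ, h1]
        · subst h; exact h2
        · subst h; rw [h3 σ _ mθ', h3 τ _ mθ', h2]
      exact AlgEquiv.ext fun x => DFunLike.congr_fun this x

theorem not_isSquare_of_squarefree {d : ℤ} (hd : Squarefree d) (h1 : d ≠ 1) :
    ¬ IsSquare (d : ℚ) := by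
  rw [Rat.isSquare_intCast_iff]
  rintro ⟨r, rfl⟩
  have := hd r dvd_rfl
  rcases Int.isUnit_iff.mp this with rfl | rfl <;> simp at h1

/-- A biquadratic field embeds into a dihedral extension if and only if one of three conics has a
rational point. -/
theorem admitsExtension_dihedral_iff {d₁ d₂ d₃ : ℤ} (h : Admissible d₁ d₂ d₃) :
    AdmitsExtension (DihedralGroup 4) (multiquadraticField d₁ d₂ d₃) ↔
      ConicSolvable d₁ d₂ ∨ ConicSolvable d₁ d₃ ∨ ConicSolvable d₂ d₃ := by
  obtain ⟨s₁, s₂, s₃, n₁, n₂, n₃, -, -, -, hd⟩ := h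
  have q₁ := not_isSquare_of_squarefree s₁ n₁
  have q₂ := not_isSquare_of_squarefree s₂ n₂
  have q₃ := not_isSquare_of_squarefree s₃ n₃
  constructor
  · rintro ⟨F, hKF, hfd, hgal, ⟨φ⟩⟩
    have root : ∀ d : ℤ, d = d₁ ∨ d = d₂ ∨ d = d₃ → ∃ x : F, x ^ 2 = d := by
      intro d hd
      obtain ⟨x, hx⟩ := IsAlgClosed.exists_pow_nat_eq (d : AlgebraicClosure ℚ) (n := 2) two_pos
      refine ⟨⟨x, hKF (IntermediateField.subset_adjoin _ _ ?_)⟩, Subtype.ext (by simpa using hx)⟩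
      rcases hd with rfl | rfl | rfl
      exacts [Or.inl hx, Or.inr (Or.inl hx), Or.inr (Or.inr hx)]
    obtain ⟨x₁, hx₁⟩ := root d₁ (by simp)
    obtain ⟨x₂, hx₂⟩ := root d₂ (by simp)
    obtain ⟨x₃, hx₃⟩ := root d₃ (by simp)
    exact conicSolvable_of_mulEquiv φ q₁ q₂ q₃ hd hx₁ hx₂ hx₃
  -- The relation `d ~ a b` modulo squares is symmetric in the three radicands, so one statement
  -- serves all three conics.
  · have key : ∀ {a b d m n : ℤ}, ¬ IsSquare (a : ℚ) → ¬ IsSquare (b : ℚ) → ¬ IsSquare (d : ℚ) →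
        m ≠ 0 → n ≠ 0 → d * m ^ 2 = a * b * n ^ 2 → ConicSolvable a b →
        ∃ F : IntermediateField ℚ (AlgebraicClosure ℚ),
          (∀ x : AlgebraicClosure ℚ, x ^ 2 = a ∨ x ^ 2 = b ∨ x ^ 2 = d → x ∈ F) ∧
          FiniteDimensional ℚ F ∧ IsGalois ℚ F ∧ Nonempty ((F ≃ₐ[ℚ] F) ≃* DihedralGroup 4) := by
      intro a b d m n ha hb hd0 hm hn hd hs
      have hab : ¬ IsSquare ((a * b : ℤ) : ℚ) := by
        rintro ⟨r, hr⟩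
        apply hd0
        have hmq : (m : ℚ) ≠ 0 := by exact_mod_cast hm
        have hd' : (d : ℚ) * m ^ 2 = (a * b : ℤ) * n ^ 2 := by exact_mod_cast hd
        refine ⟨r * n / m, ?_⟩
        rw [hr] at hd'
        field_simp
        linear_combination hd'
      obtain ⟨F, hF, h1, h2, h3⟩ := exists_dihedral_extension ha hb hab hs
      refine ⟨F, ?_, h1, h2, h3⟩
      rintro x (hx | hx | hx)
      · exact hF x (Or.inl hx)
      · exact hF x (Or.inr hx)
      · obtain ⟨α, hα⟩ := IsAlgClosed.exists_pow_nat_eq (a : AlgebraicClosure ℚ) (n := 2) two_pos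
        obtain ⟨β, hβ⟩ := IsAlgClosed.exists_pow_nat_eq (b : AlgebraicClosure ℚ) (n := 2) two_pos
        have hm_cast : (m : AlgebraicClosure ℚ) ≠ 0 := by exact_mod_cast hm
        have : (x * m) ^ 2 = (α * β * n) ^ 2 := by
          simp only [mul_pow, hx, hα, hβ]; exact_mod_cast hd
        have hmem : α * β * n ∈ F :=
          mul_mem (mul_mem (hF α (Or.inl hα)) (hF β (Or.inr hβ))) (intCast_mem _ _)
        have hxm : x * m ∈ F := by
          rcases sq_eq_sq_iff_eq_or_eq_neg.mp this with h | h <;> rw [h]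
          exacts [hmem, neg_mem hmem]
        rw [show x = x * m / m by field_simp]
        exact div_mem hxm (intCast_mem _ _)
    have g0 : (Int.gcd d₁ d₂ : ℤ) ≠ 0 := by
      have := s₁.ne_zero
      simp [Int.gcd_eq_zero_iff, this]
    rintro (hs | hs | hs)
    · obtain ⟨F, hF, h1⟩ := key (n := 1) q₁ q₂ q₃ g0 one_ne_zero (by linear_combination hd) hs
      exact ⟨F, IntermediateField.adjoin_le_iff.mpr fun x hx => hF x hx, h1⟩
    · obtain ⟨F, hF, h1⟩ := key (d := d₂) (m := d₁) (n := Int.gcd d₁ d₂) q₁ q₃ q₂ s₁.ne_zero g0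
        (by linear_combination -d₁ * hd) hs
      exact ⟨F, IntermediateField.adjoin_le_iff.mpr fun x hx => hF x (by
        rcases hx with h | h | h <;> tauto), h1⟩
    · obtain ⟨F, hF, h1⟩ := key (d := d₁) (m := d₂) (n := Int.gcd d₁ d₂) q₂ q₃ q₁ s₂.ne_zero g0
        (by linear_combination -d₂ * hd) hs
      exact ⟨F, IntermediateField.adjoin_le_iff.mpr fun x hx => hF x (by
        rcases hx with h | h | h <;> tauto), h1⟩

theorem odd_prod_iff (D : Tuple) : Odd (prodAll D) ↔ ∀ i j, Odd (D i j) := by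
  simp only [prodAll, Nat.odd_mul, Fin.forall_fin_succ]
  simp only [Fin.succ_zero_eq_one, Fin.succ_one_eq_two, IsEmpty.forall_iff, and_true]
  tauto

/-! ### The signs `η` and Jacobi symbols of `-1` -/

theorem eta_eq_ite {a b : ℤ} (ha : Odd a) (hb : Odd b) :
    eta a b = if a % 4 = 3 ∧ b % 4 = 3 then -1 else 1 := by
  obtain ⟨k, rfl⟩ := ha
  obtain ⟨l, rfl⟩ := hb
  have h1 : (2 * k + 1 - 1) / 2 = k := by omega
  have h2 : (2 * l + 1 - 1) / 2 = l := by omega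
  rw [eta, h1, h2]
  rcases Int.even_or_odd k with hk | hk
  · rw [Int.negOnePow_even _ (hk.mul_right l), if_neg]
    · rfl
    · obtain ⟨m, rfl⟩ := hk; omega
  · rcases Int.even_or_odd l with hl | hl
    · rw [Int.negOnePow_even _ (hl.mul_left k), if_neg]
      · rfl
      · obtain ⟨m, rfl⟩ := hl; omega
    · rw [Int.negOnePow_odd _ (hk.mul hl), if_pos]
      · rfl
      · obtain ⟨m, rfl⟩ := hl; obtain ⟨n, rfl⟩ := hk; omega

theorem jacobiSym_neg_one_eq_ite {n : ℕ} (hn : Odd n) :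
    jacobiSym (-1) n = if n % 4 = 3 then -1 else 1 := by
  rw [jacobiSym.at_neg_one hn, ZMod.χ₄_nat_eq_if_mod_four]
  have := Nat.odd_iff.mp hn
  split_ifs <;> first | rfl | omega

theorem jacobiSym_neg_one_eq_or {n : ℕ} (hn : Odd n) :
    jacobiSym (-1) n = 1 ∨ jacobiSym (-1) n = -1 := by
  rw [jacobiSym_neg_one_eq_ite hn]; split_ifs <;> simp

theorem eta_comm (a b : ℤ) : eta a b = eta b a := by rw [eta, eta, mul_comm]

theorem eta_mul_left {a b c : ℤ} (ha : Odd a) (hb : Odd b) (hc : Odd c) :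
    eta (a * b) c = eta a c * eta b c := by
  rw [eta_eq_ite (ha.mul hb) hc, eta_eq_ite ha hc, eta_eq_ite hb hc, Int.mul_emod]
  rcases Int.odd_iff.mp ha with h1
  rcases Int.odd_iff.mp hb with h2
  have h3 : a % 4 = 1 ∨ a % 4 = 3 := by omega
  have h4 : b % 4 = 1 ∨ b % 4 = 3 := by omega
  rcases h3 with h3 | h3 <;> rcases h4 with h4 | h4 <;> by_cases h5 : c % 4 = 3 <;>
    simp [h3, h4, h5]

theorem eta_mul_right {a b c : ℤ} (ha : Odd a) (hb : Odd b) (hc : Odd c) :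
    eta a (b * c) = eta a b * eta a c := by
  rw [eta_comm, eta_mul_left hb hc ha, eta_comm b, eta_comm c]

theorem eta_eq_one_or {a b : ℤ} (ha : Odd a) (hb : Odd b) : eta a b = 1 ∨ eta a b = -1 := by
  rw [eta_eq_ite ha hb]; split_ifs <;> simp

theorem eta_neg_one {n : ℕ} (hn : Odd n) : eta (-1) n = jacobiSym (-1) n := by
  have h : (n : ℤ) % 4 = 3 ↔ n % 4 = 3 := by omega
  rw [eta_eq_ite (by decide) (by exact_mod_cast hn), jacobiSym_neg_one_eq_ite hn]
  simp [h]

theorem eta_one {n : ℤ} (hn : Odd n) : eta 1 n = 1 := by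
  rw [eta_eq_ite (by decide) hn]; simp

theorem eta_self {n : ℕ} (hn : Odd n) : eta n n = jacobiSym (-1) n := by
  have h : (n : ℤ) % 4 = 3 ↔ n % 4 = 3 := by omega
  rw [eta_eq_ite (by exact_mod_cast hn) (by exact_mod_cast hn), jacobiSym_neg_one_eq_ite hn]
  simp [h]

/-- For odd `b`, `b + 2 ≡ -b (mod 4)`, so the shift acts as a change of sign. -/
theorem eta_add_two_right {a b : ℤ} (ha : Odd a) (hb : Odd b) :
    eta a (b + 2) = eta a b * eta (-1) a := by
  have hb2 : Odd (b + 2) := hb.add_even even_two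
  rw [eta_eq_ite ha hb2, eta_eq_ite ha hb, eta_eq_ite (by decide) ha]
  have h4 : b % 4 = 1 ∧ (b + 2) % 4 = 3 ∨ b % 4 = 3 ∧ (b + 2) % 4 = 1 := by
    have := Int.odd_iff.mp hb; omega
  rcases h4 with ⟨h, h'⟩ | ⟨h, h'⟩ <;> by_cases h5 : a % 4 = 3 <;> simp [h, h', h5]

theorem eta_add_two_left {a b : ℤ} (ha : Odd a) (hb : Odd b) :
    eta (a + 2) b = eta a b * eta (-1) b := by
  rw [eta_comm, eta_add_two_right hb ha, eta_comm b]

theorem jacobiSym_mul_swap {a b : ℕ} (ha : Odd a) (hb : Odd b) (hab : a.Coprime b) :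
    jacobiSym a b * jacobiSym b a = eta a b := by
  have h1 : jacobiSym b a * jacobiSym b a = 1 := by
    rw [← sq]; exact jacobiSym.sq_one (by simpa using hab.symm)
  have e1 : (a : ℤ) % 4 = 3 ↔ a % 4 = 3 := by omega
  have e2 : (b : ℤ) % 4 = 3 ↔ b % 4 = 3 := by omega
  rw [← jacobiSym.quadratic_reciprocity_if (Nat.odd_iff.mp ha) (Nat.odd_iff.mp hb),
    eta_eq_ite (by exact_mod_cast ha) (by exact_mod_cast hb)]
  simp only [e1, e2]
  split_ifs
  · linear_combination -h1
  · exact h1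

theorem eta_unit {ε : ℤˣ} {n : ℕ} (hn : Odd n) : eta (ε : ℤ) n = jacobiSym ε n := by
  rcases Int.units_eq_one_or ε with rfl | rfl
  · rw [Units.val_one, eta_one (by exact_mod_cast hn), jacobiSym.one_left]
  · exact eta_neg_one hn

theorem odd_unit (ε : ℤˣ) : Odd (ε : ℤ) := by
  rcases Int.units_eq_one_or ε with rfl | rfl <;> decide

/-! ### The characters on factorizations -/

/-- The ramification of `d₁` and `d₂` at `2`. -/
def FieldType.e : FieldType → ℕ
  | .one => 1
  | .two => 2
  | .three => 1
  | .four => 2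

/-- `d₁` as a function of `D₁, D₂, D₃`. -/
def radicand₁ (h : FieldType) (σ : ℤˣ × ℤˣ) (a c : ℕ) : ℤ := σ.1 * (h.e * (a * c))

/-- `d₂` as a function of `D₁, D₂, D₃`. -/
def radicand₂ (h : FieldType) (σ : ℤˣ × ℤˣ) (b c : ℕ) : ℤ := σ.2 * (h.e * (b * c))

/-- `d₃` as a function of `D₁, D₂, D₃`. -/
def radicand₃ (σ : ℤˣ × ℤˣ) (a b : ℕ) : ℤ := σ.1 * σ.2 * (a * b)

/-- `(κ₁ d₂ / k) (κ₂ d₁ / l) (κ₃ d₃ / m)`. -/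
def splitChar (h : FieldType) (σ : ℤˣ × ℤˣ) (κ₁ κ₂ κ₃ : ℤ) (a b c k l m : ℕ) : ℤ :=
  jacobiSym (κ₁ * radicand₂ h σ b c) k * jacobiSym (κ₂ * radicand₁ h σ a c) l *
    jacobiSym (κ₃ * radicand₃ σ a b) m

/-- `D₁₁ D₁₂` and so on. -/
def rowProd (D : Tuple) (i : Fin 3) : ℕ := D i 0 * D i 1

theorem prod13_eq (D : Tuple) : prod13 D = rowProd D 0 * rowProd D 2 := by
  simp only [prod13, rowProd]; ring

theorem prod23_eq (D : Tuple) : prod23 D = rowProd D 1 * rowProd D 2 := by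
  simp only [prod23, rowProd]; ring

theorem prod12_eq (D : Tuple) : prod12 D = rowProd D 0 * rowProd D 1 := by
  simp only [prod12, rowProd]; ring

theorem prodAll_eq (D : Tuple) : prodAll D = rowProd D 0 * rowProd D 1 * rowProd D 2 := by
  simp only [prodAll, rowProd]; ring

/-- Expanding by multiplicativity, the symbols with some `Dᵢ₂` upstairs form `g`. The symbols among
`D₁₁, D₂₁, D₃₁` occur in pairs `(x / y)(y / x)`, which reciprocity turns into `η`. -/
theorem splitChar_eq (h : FieldType) (σ : ℤˣ × ℤˣ) (κ₁ κ₂ κ₃ : ℤ) {D : Tuple}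
    (hodd : ∀ i j, Odd (D i j))
    (hcop : ∀ i j k l, (i, j) ≠ (k, l) → Nat.Coprime (D i j) (D k l)) :
    splitChar h σ κ₁ κ₂ κ₃ (rowProd D 0) (rowProd D 1) (rowProd D 2) (D 0 0) (D 1 0) (D 2 0) =
      g D * (jacobiSym κ₁ (D 0 0) * jacobiSym κ₂ (D 1 0) * jacobiSym κ₃ (D 2 0)) *
        (jacobiSym σ.2 (D 0 0 * D 2 0) * jacobiSym σ.1 (D 1 0 * D 2 0) *
          jacobiSym h.e (D 0 0 * D 1 0)) *
        (eta (D 0 0) (D 1 0) * eta (D 1 0) (D 2 0) * eta (D 2 0) (D 0 0)) := by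
  have hne : ∀ i j, NeZero (D i j) := fun i j => ⟨(hodd i j).pos.ne'⟩
  rw [← jacobiSym_mul_swap (hodd 0 0) (hodd 1 0) (hcop _ _ _ _ (by decide)),
    ← jacobiSym_mul_swap (hodd 1 0) (hodd 2 0) (hcop _ _ _ _ (by decide)),
    ← jacobiSym_mul_swap (hodd 2 0) (hodd 0 0) (hcop _ _ _ _ (by decide))]
  simp only [splitChar, radicand₁, radicand₂, radicand₃, rowProd, g, Nat.cast_mul,
    jacobiSym.mul_left, jacobiSym.mul_right]
  ring

/-! ### The weights as combinations of characters -/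

/-- Since `(1 / n) = 1`, the symbol with numerator `e` treats all four types uniformly. -/
theorem fTuple_eq (h : FieldType) (σ : ℤˣ × ℤˣ) (w : Tuple) :
    fTuple h σ w = detect h σ w * jacobiSym (σ.1 : ℤ) (w 1 0 * w 2 0) *
      jacobiSym (σ.2 : ℤ) (w 0 0 * w 2 0) * Phi (w 0 0) (w 1 0) (w 2 0) *
      jacobiSym h.e (w 0 0 * w 1 0) * cyclicTerms σ (jacobiSym h.e (prod12 w)) w := by
  cases h <;> simp [fTuple, FieldType.e, jacobiSym.one_left]

theorem r_eq (h : FieldType) (σ : ℤˣ × ℤˣ) (D : Tuple) :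
    r h σ D = detect h σ D * (1 / 2 * (1 + jacobiSym h.e (prod12 D))) *
      jacobiSym h.e (D 0 0 * D 1 0) * psiTerms σ D := by
  cases h <;> simp [r, FieldType.e, jacobiSym.one_left] <;> norm_num

theorem Phi_eq {a b c : ℕ} (ha : Odd a) (hb : Odd b) (hc : Odd c) :
    Phi a b c = eta a b * eta b c * eta c a *
      (jacobiSym (-1) a * jacobiSym (-1) b * jacobiSym (-1) c) := by
  have ha' : Odd (a : ℤ) := by exact_mod_cast ha
  have hb' : Odd (b : ℤ) := by exact_mod_cast hb
  have hc' : Odd (c : ℤ) := by exact_mod_cast hc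
  rw [Phi, eta_add_two_right ha' hb', eta_add_two_right hb' hc', eta_add_two_right hc' ha',
    eta_neg_one ha, eta_neg_one hb, eta_neg_one hc]
  ring

/-- The factor `(1 + η s) / 2` attached to the pair `(d₁, d₂)`. -/
def half12 (h : FieldType) (σ : ℤˣ × ℤˣ) (a b c : ℕ) : ℚ :=
  1 / 2 * (1 + eta (σ.1 * (a * c : ℕ)) (σ.2 * (b * c : ℕ)) * jacobiSym h.e (a * b))

/-- The factor `(1 + η s) / 2` attached to the pair `(d₁, d₃)`. -/
def half13 (h : FieldType) (σ : ℤˣ × ℤˣ) (a b c : ℕ) : ℚ :=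
  1 / 2 * (1 + eta (σ.1 * (a * c : ℕ)) (σ.2 * (b * c : ℕ) + 2) * jacobiSym h.e (a * b))

/-- The factor `(1 + η s) / 2` attached to the pair `(d₂, d₃)`. -/
def half23 (h : FieldType) (σ : ℤˣ × ℤˣ) (a b c : ℕ) : ℚ :=
  1 / 2 * (1 + eta (σ.1 * (a * c : ℕ) + 2) (σ.2 * (b * c : ℕ)) * jacobiSym h.e (a * b))

/-- `Φ` supplies `(-1 / D₁₁ D₂₁ D₃₁)`, and each cyclic term cancels two of these three symbols. The
survivor is the sign `-1` in the local conditions of the corresponding conic. -/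
theorem fTuple_mul_g (h : FieldType) (σ : ℤˣ × ℤˣ) {D : Tuple} (hodd : ∀ i j, Odd (D i j))
    (hcop : ∀ i j k l, (i, j) ≠ (k, l) → Nat.Coprime (D i j) (D k l)) {a b c : ℕ}
    (ha : rowProd D 0 = a) (hb : rowProd D 1 = b) (hc : rowProd D 2 = c) :
    fTuple h σ D * g D = detect h σ D *
      (ind (σ ≠ (1, -1)) * half23 h σ a b c *
          splitChar h σ 1 (-1) 1 a b c (D 0 0) (D 1 0) (D 2 0) +
        ind (σ ≠ (-1, 1)) * half13 h σ a b c *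
          splitChar h σ (-1) 1 1 a b c (D 0 0) (D 1 0) (D 2 0) +
        ind (σ ≠ (-1, -1)) * half12 h σ a b c *
          splitChar h σ 1 1 (-1) a b c (D 0 0) (D 1 0) (D 2 0)) := by
  subst ha hb hc
  have hne : ∀ i j, NeZero (D i j) := fun i j => ⟨(hodd i j).pos.ne'⟩
  rw [fTuple_eq, cyclicTerms, Phi_eq (hodd 0 0) (hodd 1 0) (hodd 2 0), half12, half13, half23,
    splitChar_eq h σ _ _ _ hodd hcop, splitChar_eq h σ _ _ _ hodd hcop,
    splitChar_eq h σ _ _ _ hodd hcop, prod12_eq, prod13_eq, prod23_eq]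
  simp only [jacobiSym.one_left, jacobiSym.mul_right (-1)]
  rcases jacobiSym_neg_one_eq_or (hodd 0 0) with h0 | h0 <;>
  rcases jacobiSym_neg_one_eq_or (hodd 1 0) with h1 | h1 <;>
  rcases jacobiSym_neg_one_eq_or (hodd 2 0) with h2 | h2 <;>
  · rw [h0, h1, h2]
    push_cast
    ring

/-- The sign relating the character `(d₂ / x) (d₁ / y) (d₃ / z)` to the weight `g`. -/
def kernel (σ : ℤˣ × ℤˣ) (x y z : ℕ) : ℤ :=
  jacobiSym σ.2 (x * z) * jacobiSym σ.1 (y * z) * (eta x y * eta y z * eta z x)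

section Kernel

variable {σ : ℤˣ × ℤˣ} {x y z : ℕ}

theorem odd_of_mod_four {n : ℕ} (h : n % 4 = 1) : Odd n := Nat.odd_iff.mpr (by omega)

theorem jacobiSym_unit_of_mod_four (ε : ℤˣ) {n : ℕ} (h : n % 4 = 1) : jacobiSym ε n = 1 := by
  rcases Int.units_eq_one_or ε with rfl | rfl
  · simp [jacobiSym.one_left]
  · rw [Units.val_neg, Units.val_one, jacobiSym_neg_one_eq_ite (odd_of_mod_four h)]; simp [h]

theorem jacobiSym_unit_mul_self (ε : ℤˣ) {n : ℕ} (h : Odd n) :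
    jacobiSym ε n * jacobiSym ε n = 1 := by
  rcases Int.units_eq_one_or ε with rfl | rfl
  · simp [jacobiSym.one_left]
  · rcases jacobiSym_neg_one_eq_or h with h | h <;> simp [h]

theorem eta_of_mod_four_left {n : ℕ} (h : n % 4 = 1) {m : ℤ} (hm : Odd m) : eta n m = 1 := by
  rw [eta_eq_ite (by exact_mod_cast odd_of_mod_four h) hm, if_neg]
  omega

theorem eta_of_mod_four_right {n : ℕ} (h : n % 4 = 1) {m : ℤ} (hm : Odd m) : eta m n = 1 := by
  rw [eta_comm, eta_of_mod_four_left h hm]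

/-- Every `η` has an argument `≡ 1 (mod 4)`, and since `σ.1 = σ.2` the two remaining symbols at `z`
cancel. -/
theorem kernel_eq_one_of_12 (hσ : σ ≠ (1, -1) ∧ σ ≠ (-1, 1)) (hx : x % 4 = 1) (hy : y % 4 = 1)
    (hz : Odd z) : kernel σ x y z = 1 := by
  have hz' : Odd (z : ℤ) := by exact_mod_cast hz
  have hx' : Odd (x : ℤ) := by exact_mod_cast odd_of_mod_four hx
  have : σ.1 = σ.2 := by
    obtain ⟨s, t⟩ := σ
    rcases Int.units_eq_one_or s with rfl | rfl <;> rcases Int.units_eq_one_or t with rfl | rfl <;>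
      simp_all
  rw [kernel, jacobiSym.mul_right' _ (by omega) hz.pos.ne', jacobiSym.mul_right' _ (by omega)
    hz.pos.ne', jacobiSym_unit_of_mod_four _ hx, jacobiSym_unit_of_mod_four _ hy, this,
    eta_of_mod_four_right hy hx', eta_of_mod_four_left hy hz', eta_of_mod_four_right hx hz']
  linear_combination jacobiSym_unit_mul_self σ.2 hz

theorem kernel_eq_one_of_23 (hσ : σ ≠ (1, -1) ∧ σ ≠ (-1, -1)) (hy : y % 4 = 1) (hz : z % 4 = 1)
    (hx : Odd x) : kernel σ x y z = 1 := by
  have hx' : Odd (x : ℤ) := by exact_mod_cast hx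
  have hz' : Odd (z : ℤ) := by exact_mod_cast odd_of_mod_four hz
  have : σ.2 = 1 := by
    obtain ⟨s, t⟩ := σ
    rcases Int.units_eq_one_or s with rfl | rfl <;> rcases Int.units_eq_one_or t with rfl | rfl <;>
      simp_all
  rw [kernel, jacobiSym.mul_right' _ (by omega : y ≠ 0) (by omega), jacobiSym_unit_of_mod_four _ hy,
    jacobiSym_unit_of_mod_four _ hz, this, Units.val_one, jacobiSym.one_left,
    eta_of_mod_four_right hy hx', eta_of_mod_four_left hy hz', eta_of_mod_four_left hz hx']
  norm_num

theorem kernel_eq_one_of_13 (hσ : σ ≠ (-1, 1) ∧ σ ≠ (-1, -1)) (hx : x % 4 = 1) (hz : z % 4 = 1)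
    (hy : Odd y) : kernel σ x y z = 1 := by
  have hy' : Odd (y : ℤ) := by exact_mod_cast hy
  have hz' : Odd (z : ℤ) := by exact_mod_cast odd_of_mod_four hz
  have : σ.1 = 1 := by
    obtain ⟨s, t⟩ := σ
    rcases Int.units_eq_one_or s with rfl | rfl <;> rcases Int.units_eq_one_or t with rfl | rfl <;>
      simp_all
  rw [kernel, jacobiSym.mul_right' _ (by omega : x ≠ 0) (by omega), jacobiSym_unit_of_mod_four _ hx,
    jacobiSym_unit_of_mod_four _ hz, this, Units.val_one, jacobiSym.one_left,
    eta_of_mod_four_left hx hy', eta_of_mod_four_right hz hy', eta_of_mod_four_right hx hz']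
  norm_num

end Kernel

theorem mod_four_eq_one_of_primeFactors {n : ℕ} (hn : n ≠ 0)
    (h : ∀ p ∈ n.primeFactors, p % 4 = 1) : n % 4 = 1 := by
  induction n using Nat.recOnMul with
  | zero => simp at hn
  | one => rfl
  | prime p hp => exact h p (by simp [hp])
  | mul a b iha ihb =>
    have ha : a ≠ 0 := left_ne_zero_of_mul hn
    have hb : b ≠ 0 := right_ne_zero_of_mul hn
    rw [Nat.primeFactors_mul ha hb] at h
    rw [Nat.mul_mod, iha ha fun p hp => h p (Finset.mem_union_left _ hp),
      ihb hb fun p hp => h p (Finset.mem_union_right _ hp)]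

/-- Every prime divisor is `1` modulo `4`. -/
def Split (n : ℕ) : Prop := ∀ p ∈ n.primeFactors, p % 4 = 1

instance (n : ℕ) : Decidable (Split n) := inferInstanceAs (Decidable (∀ p ∈ n.primeFactors, _))

theorem psi_eq (n : ℕ) : psi n = ind (Split n) := rfl

theorem split_mul {a b : ℕ} (ha : a ≠ 0) (hb : b ≠ 0) : Split (a * b) ↔ Split a ∧ Split b := by
  simp only [Split, Nat.primeFactors_mul ha hb, Finset.mem_union, or_imp, forall_and]

theorem Split.mod_four {n m : ℕ} (h : Split n) (hn : n ≠ 0) (hm : m ∣ n) : m % 4 = 1 :=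
  mod_four_eq_one_of_primeFactors (ne_zero_of_dvd_ne_zero hn hm) fun p hp =>
    h p (Nat.primeFactors_mono hm hn hp)

theorem ind_eq_one {p : Prop} [Decidable p] (h : p) : ind p = 1 := if_pos h

theorem ind_eq_zero {p : Prop} [Decidable p] (h : ¬ p) : ind p = 0 := if_neg h

/-- The four-term factor of `r_h^σ` in terms of `D₁, D₂, D₃`. -/
def rowTerms (σ : ℤˣ × ℤˣ) (a b c : ℕ) : ℚ :=
  -(ind (σ ≠ (1, -1) ∧ σ ≠ (-1, 1)) * ind (Split (a * b))) -
    ind (σ ≠ (1, -1) ∧ σ ≠ (-1, -1)) * ind (Split (b * c)) -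
    ind (σ ≠ (-1, 1) ∧ σ ≠ (-1, -1)) * ind (Split (a * c)) +
    ind (σ = (1, 1)) * ind (Split (a * b * c))

theorem ind_mul_ind_mul {p q : Prop} [Decidable p] [Decidable q] {x : ℚ}
    (h : p → q → x = 1) : ind p * ind q * x = ind p * ind q := by
  by_cases hp : p <;> by_cases hq : q <;> simp [ind, hp, hq]
  exact h hp hq

/-- In each of the four terms the sign condition and the factor `ψ` together force the kernel to be
`1`. This is why `r` contains neither `Φ` nor symbols of `ε₁`, `ε₂` outside the detecting factor. -/
theorem rowTerms_mul_kernel (σ : ℤˣ × ℤˣ) {a b c x y z : ℕ} (h : a * b * c ≠ 0) (hx : x ∣ a)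
    (hy : y ∣ b) (hz : z ∣ c) (ox : Odd x) (oy : Odd y) (oz : Odd z) :
    rowTerms σ a b c * kernel σ x y z = rowTerms σ a b c := by
  have ha : a ≠ 0 := left_ne_zero_of_mul (left_ne_zero_of_mul h)
  have hb : b ≠ 0 := right_ne_zero_of_mul (left_ne_zero_of_mul h)
  have hc : c ≠ 0 := right_ne_zero_of_mul h
  have h1 := ind_mul_ind_mul (p := σ ≠ (1, -1) ∧ σ ≠ (-1, 1)) (q := Split (a * b))
    (x := kernel σ x y z) fun hσ hs => by
      rw [kernel_eq_one_of_12 hσ (hs.mod_four (mul_ne_zero ha hb) (hx.mul_right _))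
        (hs.mod_four (mul_ne_zero ha hb) (hy.mul_left _)) oz, Int.cast_one]
  have h2 := ind_mul_ind_mul (p := σ ≠ (1, -1) ∧ σ ≠ (-1, -1)) (q := Split (b * c))
    (x := kernel σ x y z) fun hσ hs => by
      rw [kernel_eq_one_of_23 hσ (hs.mod_four (mul_ne_zero hb hc) (hy.mul_right _))
        (hs.mod_four (mul_ne_zero hb hc) (hz.mul_left _)) ox, Int.cast_one]
  have h3 := ind_mul_ind_mul (p := σ ≠ (-1, 1) ∧ σ ≠ (-1, -1)) (q := Split (a * c))
    (x := kernel σ x y z) fun hσ hs => by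
      rw [kernel_eq_one_of_13 hσ (hs.mod_four (mul_ne_zero ha hc) (hx.mul_right _))
        (hs.mod_four (mul_ne_zero ha hc) (hz.mul_left _)) oy, Int.cast_one]
  have h4 := ind_mul_ind_mul (p := σ = (1, 1)) (q := Split (a * b * c))
    (x := kernel σ x y z) fun hσ hs => by
      rw [kernel_eq_one_of_12 (by subst hσ; decide)
        (hs.mod_four h ((hx.mul_right _).mul_right _))
        (hs.mod_four h ((hy.mul_left _).mul_right _)) oz, Int.cast_one]
  rw [rowTerms]
  linear_combination -h1 - h2 - h3 + h4

theorem psiTerms_eq (σ : ℤˣ × ℤˣ) {D : Tuple} {a b c : ℕ}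
    (ha : rowProd D 0 = a) (hb : rowProd D 1 = b) (hc : rowProd D 2 = c) :
    psiTerms σ D = rowTerms σ a b c := by
  subst ha hb hc
  simp only [psiTerms, rowTerms, psi_eq, prod12_eq, prod13_eq, prod23_eq, prodAll_eq]

theorem r_mul_g (h : FieldType) (σ : ℤˣ × ℤˣ) {D : Tuple} (hodd : ∀ i j, Odd (D i j))
    (hcop : ∀ i j k l, (i, j) ≠ (k, l) → Nat.Coprime (D i j) (D k l)) {a b c : ℕ}
    (ha : rowProd D 0 = a) (hb : rowProd D 1 = b) (hc : rowProd D 2 = c) :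
    r h σ D * g D = detect h σ D * (1 / 2 * (1 + jacobiSym h.e (a * b))) * rowTerms σ a b c *
      splitChar h σ 1 1 1 a b c (D 0 0) (D 1 0) (D 2 0) := by
  rw [r_eq, psiTerms_eq σ ha hb hc, prod12_eq, ha, hb]
  have hk := rowTerms_mul_kernel σ (a := a) (b := b) (c := c) (x := D 0 0) (y := D 1 0)
    (z := D 2 0) (by
      rw [← ha, ← hb, ← hc, ← prodAll_eq]
      exact ((odd_prod_iff D).mpr hodd).pos.ne') ⟨D 0 1, ha.symm⟩ ⟨D 1 1, hb.symm⟩ ⟨D 2 1, hc.symm⟩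
      (hodd 0 0) (hodd 1 0) (hodd 2 0)
  have hs : splitChar h σ 1 1 1 a b c (D 0 0) (D 1 0) (D 2 0) = g D *
      kernel σ (D 0 0) (D 1 0) (D 2 0) * jacobiSym h.e (D 0 0 * D 1 0) := by
    rw [← ha, ← hb, ← hc, splitChar_eq h σ _ _ _ hodd hcop, kernel]
    simp only [jacobiSym.one_left]
    ring
  rw [hs]
  push_cast
  linear_combination -detect h σ D * (1 / 2 * (1 + jacobiSym h.e (a * b))) *
    jacobiSym h.e (D 0 0 * D 1 0) * g D * hk

/-! ### Local conditions and divisor sums -/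

/-- The symbol `(m / p)` is `1` at every prime divisor `p` of `n`. -/
def LocallyOne (m : ℤ) (n : ℕ) : Prop := ∀ p ∈ n.primeFactors, jacobiSym m p = 1

instance (m : ℤ) (n : ℕ) : Decidable (LocallyOne m n) :=
  inferInstanceAs (Decidable (∀ p ∈ n.primeFactors, _))

theorem LocallyOne.jacobiSym {m : ℤ} {n : ℕ} (hn : n ≠ 0) (h : LocallyOne m n) :
    jacobiSym m n = 1 := by
  rw [← Nat.prod_primeFactorsList hn, jacobiSym.list_prod_right fun p hp =>
    (Nat.prime_of_mem_primeFactorsList hp).ne_zero]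
  refine List.prod_eq_one fun x hx => ?_
  obtain ⟨p, hp, rfl⟩ := List.mem_map.mp hx
  exact h p (List.mem_toFinset.mpr hp)

/-- By multiplicativity the sum is `∏ (1 + (m / p))` over `p ∣ n`, with each factor `0` or `2`. -/
theorem sum_divisors_jacobiSym {n : ℕ} (hn : Squarefree n) {m : ℤ} (hmn : m.gcd n = 1) :
    ∑ k ∈ n.divisors, jacobiSym m k = 2 ^ n.primeFactors.card * if LocallyOne m n then 1 else 0 := by
  have key : ∑ k ∈ n.divisors, jacobiSym m k = ∏ p ∈ n.primeFactors, (1 + jacobiSym m p) := by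
    -- An arithmetic function must vanish at `0`, whereas the symbol with denominator `0` is `1`.
    let F : ArithmeticFunction ℤ := ⟨fun k => if k = 0 then 0 else jacobiSym m k, by simp⟩
    have hF : F.IsMultiplicative := by
      rw [ArithmeticFunction.IsMultiplicative.iff_ne_zero]
      refine ⟨by simp [F, jacobiSym.one_right], fun {a b} ha hb _ => ?_⟩
      simp [F, ha, hb, jacobiSym.mul_right' m ha hb]
    have := hF.prodPrimeFactors_one_add_of_squarefree hn
    rw [Finset.sum_congr rfl (g := fun k => F k), Finset.prod_congr rfl (g := fun p => 1 + F p)]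
    · exact this.symm
    · intro p hp
      simp [F, (Nat.prime_of_mem_primeFactors hp).ne_zero]
    · intro k hk
      simp [F, (Nat.pos_of_mem_divisors hk).ne']
  rw [key]
  split_ifs with h
  · rw [Finset.prod_congr rfl (g := fun _ => (2 : ℤ)) fun p hp => by rw [h p hp]; rfl]
    simp
  · rw [LocallyOne] at h
    push Not at h
    obtain ⟨p, hp, hne⟩ := h
    rw [mul_zero]
    refine Finset.prod_eq_zero hp ?_
    have : m.gcd p = 1 :=
      Nat.Coprime.coprime_dvd_right (Nat.dvd_of_mem_primeFactors hp) hmn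
    rcases jacobiSym.eq_one_or_neg_one this with h | h
    · exact absurd h hne
    · rw [h]; rfl

/-- The local conditions at the odd primes attached to a triple of signs. -/
def LocalCond (h : FieldType) (σ : ℤˣ × ℤˣ) (κ₁ κ₂ κ₃ : ℤ) (a b c : ℕ) : Prop :=
  LocallyOne (κ₁ * radicand₂ h σ b c) a ∧ LocallyOne (κ₂ * radicand₁ h σ a c) b ∧
    LocallyOne (κ₃ * radicand₃ σ a b) c

instance (h : FieldType) (σ : ℤˣ × ℤˣ) (κ₁ κ₂ κ₃ : ℤ) (a b c : ℕ) :
    Decidable (LocalCond h σ κ₁ κ₂ κ₃ a b c) := inferInstanceAs (Decidable (_ ∧ _ ∧ _))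

theorem FieldType.e_eq (h : FieldType) : h.e = 1 ∨ h.e = 2 := by cases h <;> simp [FieldType.e]

theorem FieldType.e_coprime (h : FieldType) {n : ℕ} (hn : Odd n) : h.e.Coprime n := by
  rcases h.e_eq with he | he <;> rw [he]
  · exact Nat.coprime_one_left n
  · exact Nat.coprime_two_left.mpr hn

theorem natAbs_unit_mul (ε : ℤˣ) (x : ℤ) : (ε * x).natAbs = x.natAbs := by
  rw [Int.natAbs_mul, Int.natAbs_of_isUnit ε.isUnit, one_mul]

section Coprime

variable {a b c : ℕ} (hodd : Odd (a * b * c)) (hsq : Squarefree (a * b * c))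
include hodd hsq

theorem gcd_radicand₂ (h : FieldType) (σ : ℤˣ × ℤˣ) (κ : ℤˣ) :
    (κ * radicand₂ h σ b c).gcd a = 1 := by
  have hab_c := Nat.coprime_of_squarefree_mul hsq
  have hab := Nat.coprime_of_squarefree_mul hsq.of_mul_left
  rw [Int.gcd_eq_natAbs, natAbs_unit_mul, radicand₂, natAbs_unit_mul]
  simp only [Int.natAbs_mul, Int.natAbs_natCast]
  refine (h.e_coprime (Nat.odd_mul.mp (Nat.odd_mul.mp hodd).1).1).mul_left ?_
  exact hab.symm.mul_left hab_c.symm.coprime_mul_right_right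

theorem gcd_radicand₁ (h : FieldType) (σ : ℤˣ × ℤˣ) (κ : ℤˣ) :
    (κ * radicand₁ h σ a c).gcd b = 1 := by
  have hab_c := Nat.coprime_of_squarefree_mul hsq
  have hab := Nat.coprime_of_squarefree_mul hsq.of_mul_left
  rw [Int.gcd_eq_natAbs, natAbs_unit_mul, radicand₁, natAbs_unit_mul]
  simp only [Int.natAbs_mul, Int.natAbs_natCast]
  refine (h.e_coprime (Nat.odd_mul.mp (Nat.odd_mul.mp hodd).1).2).mul_left ?_
  exact hab.mul_left hab_c.symm.coprime_mul_left_right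

omit hodd in
theorem gcd_radicand₃ (σ : ℤˣ × ℤˣ) (κ : ℤˣ) : (κ * radicand₃ σ a b).gcd c = 1 := by
  have hab_c := Nat.coprime_of_squarefree_mul hsq
  rw [Int.gcd_eq_natAbs, natAbs_unit_mul, radicand₃, mul_assoc, natAbs_unit_mul, natAbs_unit_mul]
  simpa only [Int.natAbs_mul, Int.natAbs_natCast] using hab_c

theorem sum_splitChar (h : FieldType) (σ : ℤˣ × ℤˣ) (κ₁ κ₂ κ₃ : ℤˣ) :
    ∑ k ∈ a.divisors, ∑ l ∈ b.divisors, ∑ m ∈ c.divisors, splitChar h σ κ₁ κ₂ κ₃ a b c k l m =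
      2 ^ (a * b * c).primeFactors.card * if LocalCond h σ κ₁ κ₂ κ₃ a b c then 1 else 0 := by
  have hab_c := Nat.coprime_of_squarefree_mul hsq
  have hab := Nat.coprime_of_squarefree_mul hsq.of_mul_left
  have : ∑ k ∈ a.divisors, ∑ l ∈ b.divisors, ∑ m ∈ c.divisors,
      splitChar h σ κ₁ κ₂ κ₃ a b c k l m =
      (∑ k ∈ a.divisors, jacobiSym (κ₁ * radicand₂ h σ b c) k) *
      (∑ l ∈ b.divisors, jacobiSym (κ₂ * radicand₁ h σ a c) l) *
      ∑ m ∈ c.divisors, jacobiSym (κ₃ * radicand₃ σ a b) m := by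
    simp only [splitChar, ← Finset.mul_sum, ← Finset.sum_mul]
  rw [this, sum_divisors_jacobiSym hsq.of_mul_left.of_mul_left (gcd_radicand₂ hodd hsq h σ κ₁),
    sum_divisors_jacobiSym hsq.of_mul_left.of_mul_right (gcd_radicand₁ hodd hsq h σ κ₂),
    sum_divisors_jacobiSym hsq.of_mul_right (gcd_radicand₃ hsq σ κ₃),
    hab_c.primeFactors_mul, hab.primeFactors_mul, Finset.card_union_of_disjoint,
    Finset.card_union_of_disjoint hab.disjoint_primeFactors, pow_add, pow_add]
  · by_cases h1 : LocallyOne (κ₁ * radicand₂ h σ b c) a <;>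
    by_cases h2 : LocallyOne (κ₂ * radicand₁ h σ a c) b <;>
    by_cases h3 : LocallyOne (κ₃ * radicand₃ σ a b) c <;> simp [LocalCond, h1, h2, h3]
  · rw [← hab.primeFactors_mul]
    exact hab_c.disjoint_primeFactors

end Coprime

/-! ### The conics attached to `D₁, D₂, D₃` -/

section Conic

variable {a b c : ℕ} (hodd : Odd (a * b * c)) (hsq : Squarefree (a * b * c))

/-- Restricting to `p ≠ 2` discards the possible factor `e = 2` of a coefficient. -/
theorem locallyOne_iff {m : ℤ} {n : ℕ} (hn : Odd n) {N : ℤ} {k : ℕ} (hk : k = 1 ∨ k = 2)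
    (hN : N.natAbs = k * n) :
    (∀ p : ℕ, p.Prime → p ≠ 2 → (p : ℤ) ∣ N → jacobiSym m p = 1) ↔ LocallyOne m n := by
  have key : ∀ p : ℕ, p.Prime → (p ≠ 2 ∧ (p : ℤ) ∣ N ↔ p ∣ n) := by
    intro p hp
    rw [Int.natCast_dvd, hN]
    constructor
    · rintro ⟨h2, hd⟩
      rcases hk with rfl | rfl
      · simpa using hd
      · exact ((Nat.Prime.dvd_mul hp).mp hd).resolve_left fun h =>
          h2 ((Nat.prime_dvd_prime_iff_eq hp Nat.prime_two).mp h)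
    · intro hd
      refine ⟨?_, hd.mul_left _⟩
      rintro rfl
      exact (Nat.not_even_iff_odd.mpr hn) (even_iff_two_dvd.mpr hd)
  constructor
  · intro h p hp
    have hp' := Nat.prime_of_mem_primeFactors hp
    obtain ⟨h2, hd⟩ := (key p hp').mpr (Nat.dvd_of_mem_primeFactors hp)
    exact h p hp' h2 hd
  · intro h p hp h2 hd
    exact h p (Nat.mem_primeFactors.mpr ⟨hp, (key p hp).mp ⟨h2, hd⟩, hn.pos.ne'⟩)

theorem unit_mul_neg_iff (ε : ℤˣ) {n : ℤ} (hn : 0 < n) : (ε : ℤ) * n < 0 ↔ ε = -1 := by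
  rcases Int.units_eq_one_or ε with rfl | rfl
  · simp [hn.le]
  · simp [hn]

theorem sigma_ne_iff (σ : ℤˣ × ℤˣ) (s t : ℤˣ) : σ ≠ (s, t) ↔ ¬ (σ.1 = s ∧ σ.2 = t) := by
  rw [Ne, Prod.ext_iff]

include hodd hsq

theorem squarefree_e_mul (h : FieldType) : Squarefree (h.e * (a * b * c)) := by
  rw [Nat.squarefree_mul (h.e_coprime hodd)]
  refine ⟨?_, hsq⟩
  rcases h.e_eq with he | he <;> rw [he]
  · exact squarefree_one
  · exact Nat.prime_two.prime.squarefree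

theorem conicSolvable_radicand₁₂ (h : FieldType) (σ : ℤˣ × ℤˣ) :
    ConicSolvable (radicand₁ h σ a c) (radicand₂ h σ b c) ↔
      σ ≠ (-1, -1) ∧ LocalCond h σ 1 1 (-1) a b c := by
  obtain ⟨⟨oa, ob⟩, oc⟩ : (Odd a ∧ Odd b) ∧ Odd c := by simpa [Nat.odd_mul] using hodd
  have he : 0 < h.e := by rcases h.e_eq with he | he <;> omega
  have pa := oa.pos
  have pb := ob.pos
  have pc := oc.pos
  -- The common factor of `d₁` and `d₂` is `e D₃`, and `-AB = -d₃`, so the extra sign falls on `D₃`.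
  have := conicSolvable_iff (A := σ.1 * a) (B := σ.2 * b) (G := h.e * c) (by positivity) (by
    rw [← Int.squarefree_natAbs]
    convert squarefree_e_mul hodd hsq h using 1
    simp only [Int.natAbs_mul, Int.natAbs_natCast, Int.natAbs_of_isUnit (Units.isUnit _)]; ring)
  rw [radicand₁, radicand₂, show (σ.1 : ℤ) * (h.e * (a * c)) = h.e * c * (σ.1 * a) by ring,
    show (σ.2 : ℤ) * (h.e * (b * c)) = h.e * c * (σ.2 * b) by ring, this,
    unit_mul_neg_iff _ (by positivity), unit_mul_neg_iff _ (by positivity),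
    locallyOne_iff oa (Or.inl rfl) (by rw [natAbs_unit_mul]; simp),
    locallyOne_iff ob (Or.inl rfl) (by rw [natAbs_unit_mul]; simp),
    locallyOne_iff oc h.e_eq (by simp [Int.natAbs_mul]), sigma_ne_iff, LocalCond,
    radicand₁, radicand₂, radicand₃]
  ring_nf

theorem conicSolvable_radicand₁₃ (h : FieldType) (σ : ℤˣ × ℤˣ) :
    ConicSolvable (radicand₁ h σ a c) (radicand₃ σ a b) ↔
      σ ≠ (-1, 1) ∧ LocalCond h σ (-1) 1 1 a b c := by
  obtain ⟨⟨oa, ob⟩, oc⟩ : (Odd a ∧ Odd b) ∧ Odd c := by simpa [Nat.odd_mul] using hodd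
  have he : 0 < h.e := by rcases h.e_eq with he | he <;> omega
  have pa := oa.pos
  have pb := ob.pos
  have pc := oc.pos
  have hε : (σ.1 : ℤ) * σ.1 = 1 := by rw [← Units.val_mul, Int.units_mul_self]; rfl
  -- Now the common factor is `D₁`, and `-AB = -d₂` because `ε₁² = 1`; the extra sign falls on `D₁`.
  have := conicSolvable_iff (A := σ.1 * (h.e * c)) (B := σ.1 * (σ.2 * b)) (G := a)
    (by positivity) (by
    rw [← Int.squarefree_natAbs]
    convert squarefree_e_mul hodd hsq h using 1
    simp only [Int.natAbs_mul, Int.natAbs_natCast, Int.natAbs_of_isUnit (Units.isUnit _)]; ring)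
  rw [radicand₁, radicand₃, show (σ.1 : ℤ) * (h.e * (a * c)) = a * (σ.1 * (h.e * c)) by ring,
    show (σ.1 : ℤ) * σ.2 * (a * b) = a * (σ.1 * (σ.2 * b)) by ring, this,
    unit_mul_neg_iff _ (by positivity),
    show (σ.1 : ℤ) * (σ.2 * b) = (σ.1 * σ.2 : ℤˣ) * b by push_cast; ring,
    unit_mul_neg_iff _ (by positivity),
    locallyOne_iff oc h.e_eq (by rw [natAbs_unit_mul]; simp [Int.natAbs_mul]),
    locallyOne_iff ob (Or.inl rfl) (by rw [natAbs_unit_mul]; simp),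
    locallyOne_iff oa (Or.inl rfl) (by simp), sigma_ne_iff, LocalCond,
    radicand₁, radicand₂, radicand₃]
  have hs : (σ.1 = -1 ∧ σ.1 * σ.2 = -1) ↔ (σ.1 = -1 ∧ σ.2 = 1) := by
    refine and_congr_right fun h1 => ?_
    rw [h1, neg_one_mul, neg_inj]
  rw [hs, show -((σ.1 : ℤ) * (h.e * c) * ((σ.1 * σ.2 : ℤˣ) * b)) = -1 * (σ.2 * (h.e * (b * c))) by
    push_cast; linear_combination -(σ.2 : ℤ) * h.e * b * c * hε, Units.val_mul]
  have e1 : (a : ℤ) * (σ.1 * (h.e * c)) = 1 * (σ.1 * (h.e * (a * c))) := by ring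
  have e2 : (a : ℤ) * (σ.1 * σ.2 * b) = 1 * (σ.1 * σ.2 * (a * b)) := by ring
  rw [e1, e2]
  tauto

theorem conicSolvable_radicand₂₃ (h : FieldType) (σ : ℤˣ × ℤˣ) :
    ConicSolvable (radicand₂ h σ b c) (radicand₃ σ a b) ↔
      σ ≠ (1, -1) ∧ LocalCond h σ 1 (-1) 1 a b c := by
  obtain ⟨⟨oa, ob⟩, oc⟩ : (Odd a ∧ Odd b) ∧ Odd c := by simpa [Nat.odd_mul] using hodd
  have he : 0 < h.e := by rcases h.e_eq with he | he <;> omega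
  have pa := oa.pos
  have pb := ob.pos
  have pc := oc.pos
  have hε : (σ.2 : ℤ) * σ.2 = 1 := by rw [← Units.val_mul, Int.units_mul_self]; rfl
  have := conicSolvable_iff (A := σ.2 * (h.e * c)) (B := σ.1 * (σ.2 * a)) (G := b)
    (by positivity) (by
    rw [← Int.squarefree_natAbs]
    convert squarefree_e_mul hodd hsq h using 1
    simp only [Int.natAbs_mul, Int.natAbs_natCast, Int.natAbs_of_isUnit (Units.isUnit _)]; ring)
  rw [radicand₂, radicand₃, show (σ.2 : ℤ) * (h.e * (b * c)) = b * (σ.2 * (h.e * c)) by ring,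
    show (σ.1 : ℤ) * σ.2 * (a * b) = b * (σ.1 * (σ.2 * a)) by ring, this,
    unit_mul_neg_iff _ (by positivity),
    show (σ.1 : ℤ) * (σ.2 * a) = (σ.1 * σ.2 : ℤˣ) * a by push_cast; ring,
    unit_mul_neg_iff _ (by positivity),
    locallyOne_iff oc h.e_eq (by rw [natAbs_unit_mul]; simp [Int.natAbs_mul]),
    locallyOne_iff oa (Or.inl rfl) (by rw [natAbs_unit_mul]; simp),
    locallyOne_iff ob (Or.inl rfl) (by simp), sigma_ne_iff, LocalCond,
    radicand₁, radicand₂, radicand₃]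
  have hs : (σ.2 = -1 ∧ σ.1 * σ.2 = -1) ↔ (σ.1 = 1 ∧ σ.2 = -1) := by
    rw [and_comm]
    refine and_congr_left fun h1 => ?_
    rw [h1, mul_neg_one, neg_inj]
  rw [hs, show -((σ.2 : ℤ) * (h.e * c) * ((σ.1 * σ.2 : ℤˣ) * a)) = -1 * (σ.1 * (h.e * (a * c))) by
    push_cast; linear_combination -(σ.1 : ℤ) * h.e * a * c * hε, Units.val_mul]
  have e1 : (b : ℤ) * (σ.2 * (h.e * c)) = 1 * (σ.2 * (h.e * (b * c))) := by ring
  have e2 : (b : ℤ) * (σ.1 * σ.2 * a) = 1 * (σ.1 * σ.2 * (a * b)) := by ring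
  rw [e1, e2]
  tauto

end Conic

/-! ### The product formula -/

/-- The six-tuple with `D₁₁ D₁₂ = a`, `D₂₁ D₂₂ = b`, `D₃₁ D₃₂ = c` determined by `D₁₁, D₂₁, D₃₁`. -/
def splitTuple (a b c k l m : ℕ) : Tuple := ![![k, a / k], ![l, b / l], ![m, c / m]]

theorem prodAll_splitTuple {a b c k l m : ℕ} (hk : k ∣ a) (hl : l ∣ b) (hm : m ∣ c) :
    prodAll (splitTuple a b c k l m) = a * b * c := by
  simp [prodAll_eq, rowProd, splitTuple, Nat.mul_div_cancel' hk, Nat.mul_div_cancel' hl,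
    Nat.mul_div_cancel' hm]

theorem coprime_of_squarefree_prodAll {D : Tuple} (h : Squarefree (prodAll D)) (i : Fin 3)
    (j : Fin 2) (k : Fin 3) (l : Fin 2) (hne : (i, j) ≠ (k, l)) : Nat.Coprime (D i j) (D k l) := by
  refine Nat.coprime_of_squarefree_mul (h.squarefree_of_dvd ?_)
  have : prodAll D = ∏ p : Fin 3 × Fin 2, D p.1 p.2 := by
    rw [Fintype.prod_prod_type]
    simp only [Fin.prod_univ_three, Fin.prod_univ_two, prodAll]; ring
  rw [this, ← Finset.prod_pair (f := fun p : Fin 3 × Fin 2 => D p.1 p.2) hne]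
  exact Finset.prod_dvd_prod_of_subset _ _ _ (Finset.subset_univ _)

section Reciprocity

variable {a b c : ℕ} (hodd : Odd (a * b * c)) (hsq : Squarefree (a * b * c))
include hodd hsq

/-- This is the product formula: the three symbols of full denominators `D₁, D₂, D₃` are `1`, and
reciprocity is applied to the factorization with all `Dᵢ₂ = 1`, where `g = 1`. -/
theorem localCond_formula {h : FieldType} {σ : ℤˣ × ℤˣ} {κ₁ κ₂ κ₃ : ℤ}
    (hl : LocalCond h σ κ₁ κ₂ κ₃ a b c) :
    jacobiSym κ₁ a * jacobiSym κ₂ b * jacobiSym κ₃ c * kernel σ a b c * jacobiSym h.e (a * b) =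
      1 := by
  have habc := hodd.pos.ne'
  have ha : a ≠ 0 := left_ne_zero_of_mul (left_ne_zero_of_mul habc)
  have hb : b ≠ 0 := right_ne_zero_of_mul (left_ne_zero_of_mul habc)
  have hc : c ≠ 0 := right_ne_zero_of_mul habc
  have hp := prodAll_splitTuple (dvd_refl a) (dvd_refl b) (dvd_refl c)
  have hs := splitChar_eq h σ κ₁ κ₂ κ₃ (D := splitTuple a b c a b c)
    ((odd_prod_iff _).mp (by rwa [hp])) (coprime_of_squarefree_prodAll (by rwa [hp]))
  have hs1 : splitChar h σ κ₁ κ₂ κ₃ a b c a b c = 1 := by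
    rw [splitChar, hl.1.jacobiSym ha, hl.2.1.jacobiSym hb, hl.2.2.jacobiSym hc]; rfl
  have pa := Nat.pos_of_ne_zero ha
  have pb := Nat.pos_of_ne_zero hb
  have pc := Nat.pos_of_ne_zero hc
  simp only [rowProd, splitTuple, g, Matrix.cons_val_zero, Matrix.cons_val_one, Matrix.cons_val,
    Nat.div_self pa, Nat.div_self pb, Nat.div_self pc, mul_one, Nat.cast_one, jacobiSym.one_left,
    one_mul] at hs
  rw [hs1] at hs
  rw [kernel]
  linear_combination -hs

omit hsq in
theorem eta_radicands (σ : ℤˣ × ℤˣ) :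
    eta (σ.1 * (a * c : ℕ)) (σ.2 * (b * c : ℕ)) =
      eta σ.1 σ.2 * kernel σ a b c * jacobiSym (-1) c := by
  obtain ⟨⟨oa, ob⟩, oc⟩ : (Odd a ∧ Odd b) ∧ Odd c := by simpa [Nat.odd_mul] using hodd
  have za : Odd (a : ℤ) := by exact_mod_cast oa
  have zb : Odd (b : ℤ) := by exact_mod_cast ob
  have zc : Odd (c : ℤ) := by exact_mod_cast oc
  have u1 := odd_unit σ.1
  have u2 := odd_unit σ.2
  have expand : ∀ {x : ℤ}, Odd x → eta x (σ.2 * (b * c)) = eta x σ.2 * (eta x b * eta x c) :=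
    fun hx => by rw [eta_mul_right hx u2 (zb.mul zc), eta_mul_right hx zb zc]
  push_cast
  rw [eta_mul_left u1 (za.mul zc) (u2.mul (zb.mul zc)), eta_mul_left za zc (u2.mul (zb.mul zc)),
    expand u1, expand za, expand zc, eta_comm a σ.2, eta_comm c σ.2, eta_unit oa, eta_unit oc,
    eta_unit ob, eta_unit oc, eta_self oc, eta_comm a c, eta_comm c b, kernel,
    jacobiSym.mul_right' _ oa.pos.ne' oc.pos.ne', jacobiSym.mul_right' _ ob.pos.ne' oc.pos.ne']
  ring

/-- Here `η(ε₁, ε₂)` is the Hilbert symbol of `(d₁, d₂)` at infinity, and `η · (e / D₁ D₂)` the one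
at `2`. The first is `1` by the sign condition, so the product formula gives the second. -/
theorem half12_eq_one {h : FieldType} {σ : ℤˣ × ℤˣ} (hσ : σ ≠ (-1, -1))
    (hl : LocalCond h σ 1 1 (-1) a b c) : half12 h σ a b c = 1 := by
  have h1 := localCond_formula hodd hsq hl
  have h2 : eta σ.1 σ.2 = 1 := by
    obtain ⟨s, t⟩ := σ
    rcases Int.units_eq_one_or s with rfl | rfl <;> rcases Int.units_eq_one_or t with rfl | rfl <;>
      first | exact absurd rfl hσ | decide
  rw [jacobiSym.one_left, jacobiSym.one_left] at h1
  have h3 : eta (σ.1 * (a * c : ℕ)) (σ.2 * (b * c : ℕ)) * jacobiSym h.e (a * b) = 1 := by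
    rw [eta_radicands hodd, h2]; linear_combination h1
  have h4 : (eta (σ.1 * (a * c : ℕ)) (σ.2 * (b * c : ℕ)) : ℚ) * jacobiSym h.e (a * b) = 1 := by
    exact_mod_cast h3
  rw [half12, h4]; norm_num

/-- The argument for `(d₁, d₂)` applies, since the Hilbert symbols satisfy `(d₁, d₃) = (d₁, d₁ d₂) =
(d₁, -d₂)`; the shift by `2` realizes the sign of `-d₂`. -/
theorem half13_eq_one {h : FieldType} {σ : ℤˣ × ℤˣ} (hσ : σ ≠ (-1, 1))
    (hl : LocalCond h σ (-1) 1 1 a b c) : half13 h σ a b c = 1 := by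
  obtain ⟨⟨oa, ob⟩, oc⟩ : (Odd a ∧ Odd b) ∧ Odd c := by simpa [Nat.odd_mul] using hodd
  have za : Odd (a : ℤ) := by exact_mod_cast oa
  have zb : Odd (b : ℤ) := by exact_mod_cast ob
  have zc : Odd (c : ℤ) := by exact_mod_cast oc
  have h1 := localCond_formula hodd hsq hl
  have h2 : eta σ.1 σ.2 * eta (-1) σ.1 = 1 := by
    obtain ⟨s, t⟩ := σ
    rcases Int.units_eq_one_or s with rfl | rfl <;> rcases Int.units_eq_one_or t with rfl | rfl <;>
      first | exact absurd rfl hσ | decide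
  rw [jacobiSym.one_left, jacobiSym.one_left] at h1
  have hm : Odd (-1 : ℤ) := by decide
  have e1 : eta (-1) (σ.1 * (a * c : ℕ)) =
      eta (-1) σ.1 * (jacobiSym (-1) a * jacobiSym (-1) c) := by
    push_cast
    rw [eta_mul_right hm (odd_unit _) (za.mul zc), eta_mul_right hm za zc, eta_neg_one oa,
      eta_neg_one oc]
  have hc : jacobiSym (-1) c * jacobiSym (-1) c = 1 := by
    rcases jacobiSym_neg_one_eq_or oc with h | h <;> rw [h] <;> rfl
  have h3 : eta (σ.1 * (a * c : ℕ)) (σ.2 * (b * c : ℕ) + 2) * jacobiSym h.e (a * b) = 1 := by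
    rw [eta_add_two_right (by push_cast; exact (odd_unit _).mul (za.mul zc))
      (by push_cast; exact (odd_unit _).mul (zb.mul zc)), e1, eta_radicands hodd]
    linear_combination h2 + eta σ.1 σ.2 * eta (-1) σ.1 * h1 + eta σ.1 σ.2 * eta (-1) σ.1 *
      jacobiSym (-1) a * kernel σ a b c * jacobiSym h.e (a * b) * hc
  have h4 : (eta (σ.1 * (a * c : ℕ)) (σ.2 * (b * c : ℕ) + 2) : ℚ) * jacobiSym h.e (a * b) = 1 := by
    exact_mod_cast h3
  rw [half13, h4]; norm_num

theorem half23_eq_one {h : FieldType} {σ : ℤˣ × ℤˣ} (hσ : σ ≠ (1, -1))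
    (hl : LocalCond h σ 1 (-1) 1 a b c) : half23 h σ a b c = 1 := by
  obtain ⟨⟨oa, ob⟩, oc⟩ : (Odd a ∧ Odd b) ∧ Odd c := by simpa [Nat.odd_mul] using hodd
  have za : Odd (a : ℤ) := by exact_mod_cast oa
  have zb : Odd (b : ℤ) := by exact_mod_cast ob
  have zc : Odd (c : ℤ) := by exact_mod_cast oc
  have h1 := localCond_formula hodd hsq hl
  have h2 : eta σ.1 σ.2 * eta (-1) σ.2 = 1 := by
    obtain ⟨s, t⟩ := σ
    rcases Int.units_eq_one_or s with rfl | rfl <;> rcases Int.units_eq_one_or t with rfl | rfl <;>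
      first | exact absurd rfl hσ | decide
  rw [jacobiSym.one_left, jacobiSym.one_left] at h1
  have hm : Odd (-1 : ℤ) := by decide
  have e1 : eta (-1) (σ.2 * (b * c : ℕ)) =
      eta (-1) σ.2 * (jacobiSym (-1) b * jacobiSym (-1) c) := by
    push_cast
    rw [eta_mul_right hm (odd_unit _) (zb.mul zc), eta_mul_right hm zb zc, eta_neg_one ob,
      eta_neg_one oc]
  have hc : jacobiSym (-1) c * jacobiSym (-1) c = 1 := by
    rcases jacobiSym_neg_one_eq_or oc with h | h <;> rw [h] <;> rfl
  have h3 : eta (σ.1 * (a * c : ℕ) + 2) (σ.2 * (b * c : ℕ)) * jacobiSym h.e (a * b) = 1 := by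
    rw [eta_add_two_left (by push_cast; exact (odd_unit _).mul (za.mul zc))
      (by push_cast; exact (odd_unit _).mul (zb.mul zc)), e1, eta_radicands hodd]
    linear_combination h2 + eta σ.1 σ.2 * eta (-1) σ.2 * h1 + eta σ.1 σ.2 * eta (-1) σ.2 *
      jacobiSym (-1) b * kernel σ a b c * jacobiSym h.e (a * b) * hc
  have h4 : (eta (σ.1 * (a * c : ℕ) + 2) (σ.2 * (b * c : ℕ)) : ℚ) * jacobiSym h.e (a * b) = 1 := by
    exact_mod_cast h3
  rw [half23, h4]; norm_num

end Reciprocity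

/-! ### The sum over factorizations -/

/-- If `d` and `-d` both have symbol `1` at `p`, then so does `-1`. This is the source of `ψ`. -/
theorem locallyOne_both_iff {d : ℤ} {n : ℕ} (hn : Odd n) :
    LocallyOne (1 * d) n ∧ LocallyOne (-1 * d) n ↔ Split n ∧ LocallyOne (1 * d) n := by
  have hodd : ∀ p ∈ n.primeFactors, Odd p := fun p hp =>
    hn.of_dvd_nat (Nat.dvd_of_mem_primeFactors hp)
  constructor
  · rintro ⟨h1, h2⟩
    refine ⟨fun p hp => ?_, h1⟩
    have h3 := h2 p hp
    have h4 := h1 p hp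
    rw [one_mul] at h4
    rw [jacobiSym.mul_left, h4, mul_one, jacobiSym_neg_one_eq_ite (hodd p hp)] at h3
    have := Nat.odd_iff.mp (hodd p hp)
    split_ifs at h3 with h5
    omega
  · rintro ⟨h1, h2⟩
    refine ⟨h2, fun p hp => ?_⟩
    have h4 := h2 p hp
    rw [one_mul] at h4
    rw [jacobiSym.mul_left, h4, mul_one, jacobiSym_neg_one_eq_ite (hodd p hp), if_neg]
    have := h1 p hp
    omega

/-- One of the three conics attached to `D₁, D₂, D₃` is solvable. -/
def SomeConic (h : FieldType) (σ : ℤˣ × ℤˣ) (a b c : ℕ) : Prop :=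
  (σ ≠ (-1, -1) ∧ LocalCond h σ 1 1 (-1) a b c) ∨ (σ ≠ (-1, 1) ∧ LocalCond h σ (-1) 1 1 a b c) ∨
    (σ ≠ (1, -1) ∧ LocalCond h σ 1 (-1) 1 a b c)

instance (h : FieldType) (σ : ℤˣ × ℤˣ) (a b c : ℕ) : Decidable (SomeConic h σ a b c) :=
  inferInstanceAs (Decidable (_ ∨ _ ∨ _))

theorem ind_congr {p q : Prop} [Decidable p] [Decidable q] (h : p ↔ q) : ind p = ind q := by
  simp only [ind, h]

theorem ind_or_or (p q r : Prop) [Decidable p] [Decidable q] [Decidable r] :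
    ind (p ∨ q ∨ r) = ind p + ind q + ind r - ind (q ∧ r) - ind (p ∧ r) - ind (p ∧ q) +
      ind (p ∧ q ∧ r) := by
  by_cases hp : p <;> by_cases hq : q <;> by_cases hr : r <;> simp [ind, hp, hq, hr]

theorem ind_mul_mul_ind {p q : Prop} [Decidable p] [Decidable q] {x : ℚ} (h : p → q → x = 1) :
    ind p * x * ind q = ind (p ∧ q) := by
  by_cases hp : p <;> by_cases hq : q <;> simp [ind, hp, hq]
  exact h hp hq

theorem ind_mul_ind_mul_mul_ind {p s q t : Prop} [Decidable p] [Decidable s] [Decidable q]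
    [Decidable t] {x : ℚ} (h : p → s → q → x = 1) (hiff : p ∧ s ∧ q ↔ t) :
    ind p * ind s * x * ind q = ind t := by
  rw [← ind_congr hiff]
  by_cases hp : p <;> by_cases hs : s <;> by_cases hq : q <;> simp [ind, hp, hs, hq]
  exact h hp hs hq

/-- Inclusion-exclusion. Two conics place their extra sign on different `Dᵢ`, so their intersection
is the sign-free local condition together with `Split` on both of these `Dᵢ`. -/
theorem ind_someConic (h : FieldType) (σ : ℤˣ × ℤˣ) {a b c : ℕ} (hodd : Odd (a * b * c))
    (hsq : Squarefree (a * b * c)) :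
    (ind (σ ≠ (1, -1)) * half23 h σ a b c * ind (LocalCond h σ 1 (-1) 1 a b c) +
        ind (σ ≠ (-1, 1)) * half13 h σ a b c * ind (LocalCond h σ (-1) 1 1 a b c) +
        ind (σ ≠ (-1, -1)) * half12 h σ a b c * ind (LocalCond h σ 1 1 (-1) a b c)) +
      (1 / 2 * (1 + jacobiSym h.e (a * b))) * rowTerms σ a b c * ind (LocalCond h σ 1 1 1 a b c) =
    ind (SomeConic h σ a b c) := by
  obtain ⟨⟨oa, ob⟩, oc⟩ : (Odd a ∧ Odd b) ∧ Odd c := by simpa [Nat.odd_mul] using hodd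
  have ha := oa.pos.ne'
  have hb := ob.pos.ne'
  have hc := oc.pos.ne'
  -- The product formula with trivial kernel leaves `(e / D₁ D₂) = 1`.
  have half : LocalCond h σ 1 1 1 a b c → kernel σ a b c = 1 →
      (1 / 2 * (1 + jacobiSym h.e (a * b)) : ℚ) = 1 := by
    intro hl hk
    have h1 := localCond_formula hodd hsq hl
    rw [hk] at h1
    simp only [jacobiSym.one_left, one_mul] at h1
    rw [h1]; norm_num
  have pair_a := locallyOne_both_iff (d := radicand₂ h σ b c) oa
  have pair_b := locallyOne_both_iff (d := radicand₁ h σ a c) ob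
  have pair_c := locallyOne_both_iff (d := radicand₃ σ a b) oc
  have sab := split_mul ha hb
  have sbc := split_mul hb hc
  have sac := split_mul ha hc
  have sabc := split_mul (mul_ne_zero ha hb) hc
  have t12 := ind_mul_mul_ind (p := σ ≠ (-1, -1)) (q := LocalCond h σ 1 1 (-1) a b c)
    (half12_eq_one hodd hsq)
  have t13 := ind_mul_mul_ind (p := σ ≠ (-1, 1)) (q := LocalCond h σ (-1) 1 1 a b c)
    (half13_eq_one hodd hsq)
  have t23 := ind_mul_mul_ind (p := σ ≠ (1, -1)) (q := LocalCond h σ 1 (-1) 1 a b c)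
    (half23_eq_one hodd hsq)
  have p1 := ind_mul_ind_mul_mul_ind (p := σ ≠ (1, -1) ∧ σ ≠ (-1, 1)) (s := Split (a * b))
    (q := LocalCond h σ 1 1 1 a b c)
    (t := (σ ≠ (-1, 1) ∧ LocalCond h σ (-1) 1 1 a b c) ∧
      (σ ≠ (1, -1) ∧ LocalCond h σ 1 (-1) 1 a b c))
    (fun hσ hs hl => half hl (kernel_eq_one_of_12 hσ (hs.mod_four (mul_ne_zero ha hb)
      (dvd_mul_right _ _)) (hs.mod_four (mul_ne_zero ha hb) (dvd_mul_left _ _)) oc))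
    (by
      rw [sab]
      exact ⟨fun ⟨⟨x, y⟩, ⟨sa, sb⟩, a, b, c⟩ =>
        ⟨⟨y, (pair_a.2 ⟨sa, a⟩).2, b, c⟩, x, a, (pair_b.2 ⟨sb, b⟩).2, c⟩,
        fun ⟨⟨y, a', b, c⟩, x, a, b', _⟩ =>
          ⟨⟨x, y⟩, ⟨(pair_a.1 ⟨a, a'⟩).1, (pair_b.1 ⟨b, b'⟩).1⟩, a, b, c⟩⟩)
  have p2 := ind_mul_ind_mul_mul_ind (p := σ ≠ (1, -1) ∧ σ ≠ (-1, -1)) (s := Split (b * c))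
    (q := LocalCond h σ 1 1 1 a b c)
    (t := (σ ≠ (-1, -1) ∧ LocalCond h σ 1 1 (-1) a b c) ∧
      (σ ≠ (1, -1) ∧ LocalCond h σ 1 (-1) 1 a b c))
    (fun hσ hs hl => half hl (kernel_eq_one_of_23 hσ (hs.mod_four (mul_ne_zero hb hc)
      (dvd_mul_right _ _)) (hs.mod_four (mul_ne_zero hb hc) (dvd_mul_left _ _)) oa))
    (by
      rw [sbc]
      exact ⟨fun ⟨⟨x, y⟩, ⟨sb, sc⟩, a, b, c⟩ =>
        ⟨⟨y, a, b, (pair_c.2 ⟨sc, c⟩).2⟩, x, a, (pair_b.2 ⟨sb, b⟩).2, c⟩,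
        fun ⟨⟨y, a, b, c'⟩, x, _, b', c⟩ =>
          ⟨⟨x, y⟩, ⟨(pair_b.1 ⟨b, b'⟩).1, (pair_c.1 ⟨c, c'⟩).1⟩, a, b, c⟩⟩)
  have p3 := ind_mul_ind_mul_mul_ind (p := σ ≠ (-1, 1) ∧ σ ≠ (-1, -1)) (s := Split (a * c))
    (q := LocalCond h σ 1 1 1 a b c)
    (t := (σ ≠ (-1, -1) ∧ LocalCond h σ 1 1 (-1) a b c) ∧
      (σ ≠ (-1, 1) ∧ LocalCond h σ (-1) 1 1 a b c))
    (fun hσ hs hl => half hl (kernel_eq_one_of_13 hσ (hs.mod_four (mul_ne_zero ha hc)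
      (dvd_mul_right _ _)) (hs.mod_four (mul_ne_zero ha hc) (dvd_mul_left _ _)) ob))
    (by
      rw [sac]
      exact ⟨fun ⟨⟨x, y⟩, ⟨sa, sc⟩, a, b, c⟩ =>
        ⟨⟨y, a, b, (pair_c.2 ⟨sc, c⟩).2⟩, x, (pair_a.2 ⟨sa, a⟩).2, b, c⟩,
        fun ⟨⟨y, a, b, c'⟩, x, a', _, c⟩ =>
          ⟨⟨x, y⟩, ⟨(pair_a.1 ⟨a, a'⟩).1, (pair_c.1 ⟨c, c'⟩).1⟩, a, b, c⟩⟩)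
  have hσ1 : σ = (1, 1) ↔ σ ≠ (-1, -1) ∧ σ ≠ (-1, 1) ∧ σ ≠ (1, -1) := by
    obtain ⟨s, t⟩ := σ
    rcases Int.units_eq_one_or s with rfl | rfl <;> rcases Int.units_eq_one_or t with rfl | rfl <;>
      decide
  have p4 := ind_mul_ind_mul_mul_ind (p := σ = (1, 1)) (s := Split (a * b * c))
    (q := LocalCond h σ 1 1 1 a b c)
    (t := (σ ≠ (-1, -1) ∧ LocalCond h σ 1 1 (-1) a b c) ∧
      (σ ≠ (-1, 1) ∧ LocalCond h σ (-1) 1 1 a b c) ∧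
      (σ ≠ (1, -1) ∧ LocalCond h σ 1 (-1) 1 a b c))
    (fun hσ hs hl => half hl (kernel_eq_one_of_12 (by subst hσ; decide)
      (hs.mod_four hodd.pos.ne' ((dvd_mul_right _ _).mul_right _))
      (hs.mod_four hodd.pos.ne' ((dvd_mul_left _ _).mul_right _)) oc))
    (by
      rw [sabc, sab, hσ1]
      exact ⟨fun ⟨⟨x, y, z⟩, ⟨⟨sa, sb⟩, sc⟩, a, b, c⟩ =>
        ⟨⟨x, a, b, (pair_c.2 ⟨sc, c⟩).2⟩, ⟨y, (pair_a.2 ⟨sa, a⟩).2, b, c⟩,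
          z, a, (pair_b.2 ⟨sb, b⟩).2, c⟩,
        fun ⟨⟨x, a, b, c'⟩, ⟨y, a', _, c⟩, z, _, b', _⟩ =>
          ⟨⟨x, y, z⟩, ⟨⟨(pair_a.1 ⟨a, a'⟩).1, (pair_b.1 ⟨b, b'⟩).1⟩, (pair_c.1 ⟨c, c'⟩).1⟩,
            a, b, c⟩⟩)
  have := ind_or_or (σ ≠ (-1, -1) ∧ LocalCond h σ 1 1 (-1) a b c)
    (σ ≠ (-1, 1) ∧ LocalCond h σ (-1) 1 1 a b c) (σ ≠ (1, -1) ∧ LocalCond h σ 1 (-1) 1 a b c)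
  refine Eq.trans ?_ (this.symm.trans (ind_congr Iff.rfl))
  rw [← t12, ← t13, ← t23, ← p1, ← p2, ← p3, ← p4, rowTerms]
  ring

theorem rowProd_splitTuple {a b c k l m : ℕ} (hk : k ∣ a) (hl : l ∣ b) (hm : m ∣ c) :
    rowProd (splitTuple a b c k l m) 0 = a ∧ rowProd (splitTuple a b c k l m) 1 = b ∧
      rowProd (splitTuple a b c k l m) 2 = c := by
  simp [rowProd, splitTuple, Nat.mul_div_cancel' hk, Nat.mul_div_cancel' hl,
    Nat.mul_div_cancel' hm]

/-- The detecting factor in terms of `D₁, D₂, D₃`. -/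
def detectRow (h : FieldType) (σ : ℤˣ × ℤˣ) (a b c : ℕ) : ℚ := detect h σ (splitTuple a b c a b c)

theorem detect_eq_detectRow (h : FieldType) (σ : ℤˣ × ℤˣ) (D : Tuple) :
    detect h σ D = detectRow h σ (rowProd D 0) (rowProd D 1) (rowProd D 2) := by
  obtain ⟨h0, h1, h2⟩ := rowProd_splitTuple (dvd_refl (rowProd D 0)) (dvd_refl (rowProd D 1))
    (dvd_refl (rowProd D 2))
  cases h <;> simp only [detectRow, detect, prod12_eq, prod13_eq, prod23_eq, h0, h1, h2]

/-- For fixed `D₁, D₂, D₃` the weights are four characters of the factorization, with coefficients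
depending only on `D₁, D₂, D₃`. Summing each character gives `2^ω` times a local condition. -/
theorem sum_splitTuple (h : FieldType) (σ : ℤˣ × ℤˣ) {a b c : ℕ} (hodd : Odd (a * b * c))
    (hsq : Squarefree (a * b * c)) :
    ∑ k ∈ a.divisors, ∑ l ∈ b.divisors, ∑ m ∈ c.divisors,
      (fTuple h σ (splitTuple a b c k l m) + r h σ (splitTuple a b c k l m)) *
        g (splitTuple a b c k l m) =
    detectRow h σ a b c * 2 ^ (a * b * c).primeFactors.card * ind (SomeConic h σ a b c) := by
  have term : ∀ k ∈ a.divisors, ∀ l ∈ b.divisors, ∀ m ∈ c.divisors,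
      (fTuple h σ (splitTuple a b c k l m) + r h σ (splitTuple a b c k l m)) *
        g (splitTuple a b c k l m) = detectRow h σ a b c *
      (ind (σ ≠ (1, -1)) * half23 h σ a b c * (splitChar h σ 1 (-1) 1 a b c k l m : ℤ)) +
      detectRow h σ a b c * (ind (σ ≠ (-1, 1)) * half13 h σ a b c *
          (splitChar h σ (-1) 1 1 a b c k l m : ℤ)) +
      detectRow h σ a b c * (ind (σ ≠ (-1, -1)) * half12 h σ a b c *
          (splitChar h σ 1 1 (-1) a b c k l m : ℤ)) +
      detectRow h σ a b c * ((1 / 2 * (1 + jacobiSym h.e (a * b))) * rowTerms σ a b c *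
        (splitChar h σ 1 1 1 a b c k l m : ℤ)) := by
    intro k hk l hl m hm
    have hk := Nat.dvd_of_mem_divisors hk
    have hl := Nat.dvd_of_mem_divisors hl
    have hm := Nat.dvd_of_mem_divisors hm
    have hp := prodAll_splitTuple hk hl hm
    obtain ⟨h0, h1, h2⟩ := rowProd_splitTuple hk hl hm
    have ho := (odd_prod_iff _).mp (by rwa [hp])
    have hc := coprime_of_squarefree_prodAll (D := splitTuple a b c k l m) (by rwa [hp])
    rw [add_mul, fTuple_mul_g h σ ho hc h0 h1 h2, r_mul_g h σ ho hc h0 h1 h2,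
      detect_eq_detectRow, h0, h1, h2]
    simp only [splitTuple, Matrix.cons_val_zero, Matrix.cons_val_one, Matrix.cons_val]
    ring
  rw [Finset.sum_congr rfl fun k hk => Finset.sum_congr rfl fun l hl =>
    Finset.sum_congr rfl fun m hm => term k hk l hl m hm]
  simp only [Finset.sum_add_distrib, ← Finset.mul_sum]
  have sums : ∀ κ₁ κ₂ κ₃ : ℤˣ, ∑ k ∈ a.divisors, ∑ l ∈ b.divisors, ∑ m ∈ c.divisors,
      ((splitChar h σ κ₁ κ₂ κ₃ a b c k l m : ℤ) : ℚ) =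
      2 ^ (a * b * c).primeFactors.card * ind (LocalCond h σ κ₁ κ₂ κ₃ a b c) := by
    intro κ₁ κ₂ κ₃
    have := congrArg (Int.cast : ℤ → ℚ) (sum_splitChar hodd hsq h σ κ₁ κ₂ κ₃)
    push_cast at this
    exact this
  have s1 := sums 1 (-1) 1
  have s2 := sums (-1) 1 1
  have s3 := sums 1 1 (-1)
  have s4 := sums 1 1 1
  simp only [Units.val_one, Units.val_neg] at s1 s2 s3 s4
  rw [s1, s2, s3, s4, ← ind_someConic h σ hodd hsq]
  ring

/-! ### The weights modulo `8` -/

theorem jacobiSym_congr {a : ℤ} (ha : 4 * a.natAbs ∣ 8) {m n : ℕ} (hm : Odd m) (hn : Odd n)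
    (h : m ≡ n [MOD 8]) : jacobiSym a m = jacobiSym a n := by
  rw [jacobiSym.mod_right a hm, jacobiSym.mod_right a hn, h.of_dvd ha]

theorem eta_congr {a a' b b' : ℤ} (ha : Odd a) (hb : Odd b) (h : a ≡ a' [ZMOD 4])
    (h' : b ≡ b' [ZMOD 4]) : eta a b = eta a' b' := by
  have ha' : Odd a' := by
    rw [Int.odd_iff] at ha ⊢; have := h.eq; omega
  have hb' : Odd b' := by
    rw [Int.odd_iff] at hb ⊢; have := h'.eq; omega
  rw [eta_eq_ite ha hb, eta_eq_ite ha' hb', h.eq, h'.eq]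

/-- Only symbols with numerator `±1` or `2` and values of `η` occur, all periodic modulo `8` on odd
arguments. -/
theorem fTuple_congr (h : FieldType) (σ : ℤˣ × ℤˣ) {D D' : Tuple} (hD : ∀ i j, Odd (D i j))
    (hmod : ∀ i j, D i j ≡ D' i j [MOD 8]) : fTuple h σ D = fTuple h σ D' := by
  have hD' : ∀ i j, Odd (D' i j) := by
    intro i j
    have h1 := hD i j
    have h2 : D i j % 8 = D' i j % 8 := hmod i j
    rw [Nat.odd_iff] at h1 ⊢
    omega
  have ou : ∀ (ε : ℤˣ) {m n : ℕ}, Odd m → Odd n → m ≡ n [MOD 8] →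
      jacobiSym ε m = jacobiSym ε n := fun ε m n hm hn hmn =>
    jacobiSym_congr (by rw [Int.natAbs_of_isUnit ε.isUnit]; decide) hm hn hmn
  have om : ∀ {m n : ℕ}, Odd m → Odd n → m ≡ n [MOD 8] → jacobiSym (-1) m = jacobiSym (-1) n :=
    fun hm hn hmn => jacobiSym_congr (by decide) hm hn hmn
  have oe : ∀ {m n : ℕ}, Odd m → Odd n → m ≡ n [MOD 8] → jacobiSym h.e m = jacobiSym h.e n :=
    fun hm hn hmn => jacobiSym_congr (by cases h <;> decide) hm hn hmn
  have cast : ∀ {m n : ℕ}, m ≡ n [MOD 8] → (m : ℤ) ≡ n [ZMOD 4] := fun hmn =>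
    Int.natCast_modEq_iff.mpr (hmn.of_dvd (by decide))
  have co : ∀ {m : ℕ}, Odd m → Odd (m : ℤ) := fun hm => by exact_mod_cast hm
  have o13 : ∀ {D : Tuple}, (∀ i j, Odd (D i j)) → Odd (prod13 D) := fun hD => by
    simp only [prod13, Nat.odd_mul, hD, and_self]
  have o23 : ∀ {D : Tuple}, (∀ i j, Odd (D i j)) → Odd (prod23 D) := fun hD => by
    simp only [prod23, Nat.odd_mul, hD, and_self]
  have o12 : ∀ {D : Tuple}, (∀ i j, Odd (D i j)) → Odd (prod12 D) := fun hD => by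
    simp only [prod12, Nat.odd_mul, hD, and_self]
  have m13 : prod13 D ≡ prod13 D' [MOD 8] :=
    (((hmod 0 0).mul (hmod 0 1)).mul (hmod 2 0)).mul (hmod 2 1)
  have m23 : prod23 D ≡ prod23 D' [MOD 8] :=
    (((hmod 1 0).mul (hmod 1 1)).mul (hmod 2 0)).mul (hmod 2 1)
  have m12 : prod12 D ≡ prod12 D' [MOD 8] :=
    (((hmod 0 0).mul (hmod 0 1)).mul (hmod 1 0)).mul (hmod 1 1)
  have odd2 : ∀ {D : Tuple}, (∀ i j, Odd (D i j)) → ∀ i k, Odd (D i 0 * D k 0) :=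
    fun hD i k => (hD i 0).mul (hD k 0)
  have mod2 : ∀ i k, D i 0 * D k 0 ≡ D' i 0 * D' k 0 [MOD 8] := fun i k =>
    (hmod i 0).mul (hmod k 0)
  have hdet : detect h σ D = detect h σ D' := by
    cases h <;> simp only [detect, om (o13 hD) (o13 hD') m13, om (o23 hD) (o23 hD') m23,
      om (o12 hD) (o12 hD') m12]
  have x13 := (odd_unit σ.1).mul (co (o13 hD))
  have x23 := (odd_unit σ.2).mul (co (o23 hD))
  have c13 := (cast m13).mul_left σ.1
  have c23 := (cast m23).mul_left σ.2
  rw [fTuple_eq, fTuple_eq, hdet, ou σ.1 (odd2 hD 1 2) (odd2 hD' 1 2) (mod2 1 2),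
    ou σ.2 (odd2 hD 0 2) (odd2 hD' 0 2) (mod2 0 2), oe (odd2 hD 0 1) (odd2 hD' 0 1) (mod2 0 1),
    oe (o12 hD) (o12 hD') m12, Phi_eq (hD 0 0) (hD 1 0) (hD 2 0),
    Phi_eq (hD' 0 0) (hD' 1 0) (hD' 2 0), om (hD 0 0) (hD' 0 0) (hmod 0 0),
    om (hD 1 0) (hD' 1 0) (hmod 1 0), om (hD 2 0) (hD' 2 0) (hmod 2 0),
    eta_congr (co (hD 0 0)) (co (hD 1 0)) (cast (hmod 0 0)) (cast (hmod 1 0)),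
    eta_congr (co (hD 1 0)) (co (hD 2 0)) (cast (hmod 1 0)) (cast (hmod 2 0)),
    eta_congr (co (hD 2 0)) (co (hD 0 0)) (cast (hmod 2 0)) (cast (hmod 0 0)),
    cyclicTerms, cyclicTerms, eta_congr x13 x23 c13 c23,
    eta_congr (x13.add_even even_two) x23 (c13.add_right 2) c23,
    eta_congr x13 (x23.add_even even_two) c13 (c23.add_right 2),
    om (odd2 hD 0 2) (odd2 hD' 0 2) (mod2 0 2), om (odd2 hD 1 2) (odd2 hD' 1 2) (mod2 1 2),
    om (odd2 hD 0 1) (odd2 hD' 0 1) (mod2 0 1)]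

theorem f_eq_fTuple (h : FieldType) (σ : ℤˣ × ℤˣ) {D : Tuple} (hD : ∀ i j, Odd (D i j))
    {w : Fin 3 → Fin 2 → H} (hw : ∀ i j, ((D i j : ℕ) : ZMod 8) = (w i j : ZMod 8)) :
    f h σ w = fTuple h σ D := by
  refine (fTuple_congr h σ hD fun i j => ?_).symm
  rw [← ZMod.natCast_eq_natCast_iff, ZMod.natCast_zmod_val, hw]

/-! ### Rearranging the sums -/

theorem mem_naturalTuples_iff {x : ℝ} {D : Tuple} : D ∈ naturalTuples x ↔
    Odd (prodAll D) ∧ Squarefree (prodAll D) ∧ (Delta D : ℝ) ≤ x := by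
  constructor
  · rintro ⟨h1, h2, h3⟩
    refine ⟨(odd_prod_iff D).mpr fun i j => (h1 i j).1, ?_, h3⟩
    have : prodAll D = ∏ p : Fin 3 × Fin 2, D p.1 p.2 := by
      rw [Fintype.prod_prod_type]
      simp only [Fin.prod_univ_three, Fin.prod_univ_two, prodAll]; ring
    rw [this]
    refine Finset.squarefree_prod_of_pairwise_isCoprime ?_ fun p _ => (h1 p.1 p.2).2
    intro p _ q _ hpq
    exact Nat.coprime_iff_isRelPrime.mp (h2 p.1 p.2 q.1 q.2 hpq)
  · rintro ⟨h1, h2, h3⟩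
    refine ⟨fun i j => ⟨(odd_prod_iff D).mp h1 i j, h2.squarefree_of_dvd ?_⟩,
      coprime_of_squarefree_prodAll h2, h3⟩
    have : prodAll D = ∏ p : Fin 3 × Fin 2, D p.1 p.2 := by
      rw [Fintype.prod_prod_type]
      simp only [Fin.prod_univ_three, Fin.prod_univ_two, prodAll]; ring
    rw [this]
    exact Finset.dvd_prod_of_mem (fun p : Fin 3 × Fin 2 => D p.1 p.2) (Finset.mem_univ (i, j))

/-- The triples `(D₁, D₂, D₃)` with `D₁ D₂ D₃` odd and squarefree and `(D₁ D₂ D₃)² ≤ x`. -/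
def rowTriples (x : ℝ) : Set (ℕ × ℕ × ℕ) :=
  {t | Odd (t.1 * t.2.1 * t.2.2) ∧ Squarefree (t.1 * t.2.1 * t.2.2) ∧
    (((t.1 * t.2.1 * t.2.2) ^ 2 : ℕ) : ℝ) ≤ x}

theorem rowTriples_finite (x : ℝ) : (rowTriples x).Finite := by
  refine Set.Finite.subset ((naturalTuples_finite x).image
    fun D => (rowProd D 0, rowProd D 1, rowProd D 2)) ?_
  rintro ⟨a, b, c⟩ ⟨h1, h2, h3⟩
  have hp := prodAll_splitTuple (dvd_refl a) (dvd_refl b) (dvd_refl c)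
  obtain ⟨e0, e1, e2⟩ := rowProd_splitTuple (dvd_refl a) (dvd_refl b) (dvd_refl c)
  exact ⟨splitTuple a b c a b c, mem_naturalTuples_iff.mpr
    ⟨by rwa [hp], by rwa [hp], by rwa [Delta, hp]⟩, by simp only [e0, e1, e2]⟩

/-- The tuples are fibred over their row products; a point of a fibre is a choice of divisors `Dᵢ₁ ∣
Dᵢ`. -/
theorem sum_naturalTuples (x : ℝ) (F : Tuple → ℝ) :
    ∑ D ∈ (naturalTuples_finite x).toFinset, F D =
      ∑ t ∈ (rowTriples_finite x).toFinset, ∑ k ∈ t.1.divisors, ∑ l ∈ t.2.1.divisors,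
        ∑ m ∈ t.2.2.divisors, F (splitTuple t.1 t.2.1 t.2.2 k l m) := by
  classical
  rw [← Finset.sum_fiberwise_of_maps_to
    (g := fun D : Tuple => (rowProd D 0, rowProd D 1, rowProd D 2))
    (t := (rowTriples_finite x).toFinset)]
  · refine Finset.sum_congr rfl ?_
    rintro ⟨a, b, c⟩ ht
    rw [Set.Finite.mem_toFinset] at ht
    obtain ⟨h1, h2, h3⟩ := ht
    simp only at h1 h2 h3 ⊢
    have ha : a ≠ 0 := left_ne_zero_of_mul (left_ne_zero_of_mul h2.ne_zero)
    have hb : b ≠ 0 := right_ne_zero_of_mul (left_ne_zero_of_mul h2.ne_zero)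
    have hc : c ≠ 0 := right_ne_zero_of_mul h2.ne_zero
    simp only [← Finset.sum_product']
    refine Finset.sum_bij' (fun D _ => (D 0 0, D 1 0, D 2 0))
      (fun s _ => splitTuple a b c s.1 s.2.1 s.2.2) ?_ ?_ ?_ ?_ ?_
    · intro D hD
      obtain ⟨-, hD⟩ := Finset.mem_filter.mp hD
      simp only [Prod.mk.injEq, rowProd] at hD
      simp only [Finset.mem_product, Nat.mem_divisors]
      exact ⟨⟨⟨_, hD.1.symm⟩, ha⟩, ⟨⟨_, hD.2.1.symm⟩, hb⟩, ⟨_, hD.2.2.symm⟩, hc⟩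
    · rintro ⟨k, l, m⟩ hs
      simp only [Finset.mem_product, Nat.mem_divisors] at hs
      obtain ⟨⟨hk, -⟩, ⟨hl, -⟩, hm, -⟩ := hs
      have hp := prodAll_splitTuple hk hl hm
      obtain ⟨e0, e1, e2⟩ := rowProd_splitTuple hk hl hm
      simp only [Finset.mem_filter, Set.Finite.mem_toFinset, mem_naturalTuples_iff, Delta, hp, e0,
        e1, e2, and_true]
      exact ⟨h1, h2, h3⟩
    · intro D hD
      obtain ⟨hD0, hD⟩ := Finset.mem_filter.mp hD
      rw [Set.Finite.mem_toFinset] at hD0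
      simp only [Prod.mk.injEq, rowProd] at hD
      have pos : ∀ i j, 0 < D i j := fun i j => (hD0.1 i j).1.pos
      obtain ⟨e0, e1, e2⟩ := hD
      funext i j
      fin_cases i <;> fin_cases j <;> simp [splitTuple, ← e0, ← e1, ← e2, pos]
    · rintro ⟨k, l, m⟩ hs
      rfl
    · intro D hD
      obtain ⟨hD0, hD⟩ := Finset.mem_filter.mp hD
      rw [Set.Finite.mem_toFinset] at hD0
      simp only [Prod.mk.injEq, rowProd] at hD
      have pos : ∀ i j, 0 < D i j := fun i j => (hD0.1 i j).1.pos
      obtain ⟨e0, e1, e2⟩ := hD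
      congr 1
      funext i j
      fin_cases i <;> fin_cases j <;> simp [splitTuple, ← e0, ← e1, ← e2, pos]
  · intro D hD
    rw [Set.Finite.mem_toFinset, mem_naturalTuples_iff] at hD
    rw [Set.Finite.mem_toFinset]
    refine ⟨?_, ?_, ?_⟩ <;> simp only [← prodAll_eq]
    exacts [hD.1, hD.2.1, hD.2.2]

/-! ### The detecting factor -/

/-- A finite check. The hypothesis on `z` says `z ≡ x y (mod 4)`, which holds for `x = D₁ D₃`, `y =
D₂ D₃`, `z = D₁ D₂`; the residues of `x` and `y` then decide everything. -/
theorem detect_cases (h : FieldType) (σ : ℤˣ × ℤˣ) {x y z : ℕ} (hx : Odd x) (hy : Odd y)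
    (hxyz : z % 4 = if x % 4 = y % 4 then 1 else 3) {D : Tuple} (h13 : prod13 D = x)
    (h23 : prod23 D = y) (h12 : prod12 D = z) :
    detect h σ D = 1 ∧ h.Congr (σ.1 * (h.e * x)) (σ.2 * (h.e * y)) (σ.1 * σ.2 * z) ∨
      detect h σ D = 0 ∧ ¬ h.Congr (σ.1 * (h.e * x)) (σ.2 * (h.e * y)) (σ.1 * σ.2 * z) := by
  have hz : Odd z := by rw [Nat.odd_iff]; split_ifs at hxyz <;> omega
  have hcases : (x % 4 = 1 ∧ y % 4 = 1 ∧ z % 4 = 1) ∨ (x % 4 = 1 ∧ y % 4 = 3 ∧ z % 4 = 3) ∨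
      (x % 4 = 3 ∧ y % 4 = 1 ∧ z % 4 = 3) ∨ (x % 4 = 3 ∧ y % 4 = 3 ∧ z % 4 = 1) := by
    have h1 := Nat.odd_iff.mp hx
    have h2 := Nat.odd_iff.mp hy
    split_ifs at hxyz <;> omega
  obtain ⟨s, t⟩ := σ
  cases h <;> simp only [detect, h13, h23, h12, jacobiSym_neg_one_eq_ite hx,
    jacobiSym_neg_one_eq_ite hy, jacobiSym_neg_one_eq_ite hz, FieldType.Congr, FieldType.e,
    Int.ModEq] <;>
  rcases Int.units_eq_one_or s with rfl | rfl <;> rcases Int.units_eq_one_or t with rfl | rfl <;>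
  rcases hcases with ⟨h1, h2, h3⟩ | ⟨h1, h2, h3⟩ | ⟨h1, h2, h3⟩ | ⟨h1, h2, h3⟩ <;>
  norm_num [h1, h2, h3] <;> omega

theorem mul_mod_four_eq_ite {a b c : ℕ} (ha : Odd a) (hb : Odd b) (hc : Odd c) :
    (a * b) % 4 = if (a * c) % 4 = (b * c) % 4 then 1 else 3 := by
  rw [Nat.mul_mod, Nat.mul_mod a c, Nat.mul_mod b c]
  have ha4 : a % 4 = 1 ∨ a % 4 = 3 := by have := Nat.odd_iff.mp ha; omega
  have hb4 : b % 4 = 1 ∨ b % 4 = 3 := by have := Nat.odd_iff.mp hb; omega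
  have hc4 : c % 4 = 1 ∨ c % 4 = 3 := by have := Nat.odd_iff.mp hc; omega
  rcases ha4 with h1 | h1 <;> rcases hb4 with h2 | h2 <;> rcases hc4 with h3 | h3 <;>
    simp [h1, h2, h3]

theorem detect_eq_one_or_zero (h : FieldType) (σ : ℤˣ × ℤˣ) {D : Tuple}
    (hD : ∀ i j, Odd (D i j)) : detect h σ D = 1 ∨ detect h σ D = 0 := by
  have ho : ∀ i, Odd (rowProd D i) := fun i => (hD i 0).mul (hD i 1)
  rcases detect_cases h σ ((ho 0).mul (ho 2)) ((ho 1).mul (ho 2))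
    (mul_mod_four_eq_ite (ho 0) (ho 1) (ho 2)) (prod13_eq D) (prod23_eq D) (prod12_eq D) with h | h
  exacts [Or.inl h.1, Or.inr h.1]

open Classical in
theorem detectRow_eq (h : FieldType) (σ : ℤˣ × ℤˣ) {a b c : ℕ} (hodd : Odd (a * b * c)) :
    detectRow h σ a b c =
      if h.Congr (radicand₁ h σ a c) (radicand₂ h σ b c) (radicand₃ σ a b) then 1 else 0 := by
  obtain ⟨⟨oa, ob⟩, oc⟩ : (Odd a ∧ Odd b) ∧ Odd c := by simpa [Nat.odd_mul] using hodd
  obtain ⟨e0, e1, e2⟩ := rowProd_splitTuple (dvd_refl a) (dvd_refl b) (dvd_refl c)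
  have := detect_cases h σ (D := splitTuple a b c a b c) (oa.mul oc) (ob.mul oc)
    (mul_mod_four_eq_ite oa ob oc)
    (by rw [prod13_eq, e0, e2]) (by rw [prod23_eq, e1, e2]) (by rw [prod12_eq, e0, e1])
  push_cast at this
  rw [detectRow, radicand₁, radicand₂, radicand₃]
  rcases this with ⟨h1, h2⟩ | ⟨h1, h2⟩
  · rw [h1, if_pos h2]
  · rw [h1, if_neg h2]

/-! ### Integrality of the weights -/

/-- `q` is an integer of absolute value at most `N`. -/
def IsSmallInt (q : ℚ) (N : ℤ) : Prop := ∃ n : ℤ, q = n ∧ |n| ≤ N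

theorem IsSmallInt.add {p q : ℚ} {M N : ℤ} (hp : IsSmallInt p M) (hq : IsSmallInt q N) :
    IsSmallInt (p + q) (M + N) := by
  obtain ⟨m, rfl, hm⟩ := hp
  obtain ⟨n, rfl, hn⟩ := hq
  exact ⟨m + n, by push_cast; rfl, (abs_add_le m n).trans (add_le_add hm hn)⟩

theorem IsSmallInt.neg {p : ℚ} {M : ℤ} (hp : IsSmallInt p M) : IsSmallInt (-p) M := by
  obtain ⟨m, rfl, hm⟩ := hp
  exact ⟨-m, by push_cast; rfl, by rwa [abs_neg]⟩

theorem IsSmallInt.sub {p q : ℚ} {M N : ℤ} (hp : IsSmallInt p M) (hq : IsSmallInt q N) :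
    IsSmallInt (p - q) (M + N) := by
  rw [sub_eq_add_neg]; exact hp.add hq.neg

theorem IsSmallInt.mul {p q : ℚ} {M : ℤ} (hp : IsSmallInt p 1) (hq : IsSmallInt q M) :
    IsSmallInt (p * q) M := by
  obtain ⟨m, rfl, hm⟩ := hp
  obtain ⟨n, rfl, hn⟩ := hq
  refine ⟨m * n, by push_cast; rfl, ?_⟩
  rw [abs_mul]
  calc |m| * |n| ≤ 1 * |n| := by gcongr
    _ ≤ M := by rwa [one_mul]

theorem isSmallInt_intCast {n : ℤ} (h : n = 1 ∨ n = -1) : IsSmallInt n 1 :=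
  ⟨n, rfl, by rcases h with rfl | rfl <;> decide⟩

theorem isSmallInt_ind (p : Prop) [Decidable p] : IsSmallInt (ind p) 1 := by
  by_cases h : p
  · exact ⟨1, by simp [ind, h], by decide⟩
  · exact ⟨0, by simp [ind, h], by decide⟩

theorem isSmallInt_half {x : ℤ} (hx : x = 1 ∨ x = -1) : IsSmallInt (1 / 2 * (1 + x)) 1 := by
  rcases hx with rfl | rfl
  · exact ⟨1, by norm_num, by decide⟩
  · exact ⟨0, by norm_num, by decide⟩

theorem isSmallInt_half_mul {x y : ℤ} (hx : x = 1 ∨ x = -1) (hy : y = 1 ∨ y = -1) :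
    IsSmallInt (1 / 2 * (1 + x * y)) 1 := by
  have := isSmallInt_half (x := x * y) (by rcases hx with rfl | rfl <;> rcases hy with rfl | rfl <;>
    simp)
  rwa [Int.cast_mul] at this

theorem isSmallInt_detect (h : FieldType) (σ : ℤˣ × ℤˣ) {D : Tuple}
    (hD : ∀ i j, Odd (D i j)) : IsSmallInt (detect h σ D) 1 := by
  rcases detect_eq_one_or_zero h σ hD with h | h <;> rw [h]
  · exact ⟨1, by norm_num, by decide⟩
  · exact ⟨0, by norm_num, by decide⟩

theorem jacobiSym_unit_eq_or (ε : ℤˣ) {n : ℕ} (hn : Odd n) :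
    jacobiSym ε n = 1 ∨ jacobiSym ε n = -1 := by
  rcases Int.units_eq_one_or ε with rfl | rfl
  · left; exact jacobiSym.one_left n
  · exact jacobiSym_neg_one_eq_or hn

theorem jacobiSym_e_eq_or (h : FieldType) {n : ℕ} (hn : Odd n) :
    jacobiSym h.e n = 1 ∨ jacobiSym h.e n = -1 :=
  jacobiSym.eq_one_or_neg_one (by simpa using h.e_coprime hn)

/-- The bound `3` counts the cyclic terms, each of which is `0` or `±1`; all other factors are also
`0` or `±1`. -/
theorem isSmallInt_fTuple (h : FieldType) (σ : ℤˣ × ℤˣ) {D : Tuple} (hD : ∀ i j, Odd (D i j)) :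
    IsSmallInt (fTuple h σ D) 3 := by
  have o2 : ∀ i k, Odd (D i 0 * D k 0) := fun i k => (hD i 0).mul (hD k 0)
  have ho : ∀ i, Odd (rowProd D i) := fun i => (hD i 0).mul (hD i 1)
  have co : ∀ {m : ℕ}, Odd m → Odd (m : ℤ) := fun hm => by exact_mod_cast hm
  have o12 : Odd (prod12 D) := by rw [prod12_eq]; exact (ho 0).mul (ho 1)
  have o13 : Odd ((σ.1 : ℤ) * prod13 D) := by
    rw [prod13_eq]; exact (odd_unit _).mul (co ((ho 0).mul (ho 2)))
  have o23 : Odd ((σ.2 : ℤ) * prod23 D) := by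
    rw [prod23_eq]; exact (odd_unit _).mul (co ((ho 1).mul (ho 2)))
  have hs := jacobiSym_e_eq_or h o12
  have one_mul_one : ∀ {x y : ℤ}, (x = 1 ∨ x = -1) → (y = 1 ∨ y = -1) → x * y = 1 ∨ x * y = -1 := by
    rintro x y (rfl | rfl) (rfl | rfl) <;> simp
  have hPhi : Phi (D 0 0) (D 1 0) (D 2 0) = 1 ∨ Phi (D 0 0) (D 1 0) (D 2 0) = -1 := by
    refine one_mul_one (one_mul_one ?_ ?_) ?_ <;>
      exact eta_eq_one_or (co (hD _ _)) ((co (hD _ _)).add_even even_two)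
  rw [fTuple_eq]
  refine IsSmallInt.mul (IsSmallInt.mul (IsSmallInt.mul (IsSmallInt.mul (IsSmallInt.mul
    (isSmallInt_detect h σ hD) ?_) ?_) ?_) ?_) (IsSmallInt.add (M := 2) (N := 1)
    (IsSmallInt.add (M := 1) (N := 1) ?_ ?_) ?_)
  · exact isSmallInt_intCast (jacobiSym_unit_eq_or _ (o2 _ _))
  · exact isSmallInt_intCast (jacobiSym_unit_eq_or _ (o2 _ _))
  · exact isSmallInt_intCast hPhi
  · exact isSmallInt_intCast (jacobiSym_e_eq_or _ (o2 _ _))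
  · exact ((isSmallInt_ind _).mul (isSmallInt_half_mul
      (eta_eq_one_or (o13.add_even even_two) o23) hs)).mul
      (isSmallInt_intCast (jacobiSym_neg_one_eq_or (o2 _ _)))
  · exact ((isSmallInt_ind _).mul (isSmallInt_half_mul
      (eta_eq_one_or o13 (o23.add_even even_two)) hs)).mul
      (isSmallInt_intCast (jacobiSym_neg_one_eq_or (o2 _ _)))
  · exact ((isSmallInt_ind _).mul (isSmallInt_half_mul (eta_eq_one_or o13 o23) hs)).mul
      (isSmallInt_intCast (jacobiSym_neg_one_eq_or (o2 _ _)))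

theorem odd_val_units (w : H) : Odd (w : ZMod 8).val := by
  revert w; decide

theorem isSmallInt_f (h : FieldType) (σ : ℤˣ × ℤˣ) (w : Fin 3 → Fin 2 → H) :
    IsSmallInt (f h σ w) 3 :=
  isSmallInt_fTuple h σ fun _ _ => odd_val_units _

theorem isSmallInt_r (h : FieldType) (σ : ℤˣ × ℤˣ) {D : Tuple} (hD : ∀ i j, Odd (D i j)) :
    IsSmallInt (r h σ D) 4 := by
  have ho : ∀ i, Odd (rowProd D i) := fun i => (hD i 0).mul (hD i 1)
  have o12 : Odd (prod12 D) := by rw [prod12_eq]; exact (ho 0).mul (ho 1)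
  rw [r_eq, psiTerms]
  simp only [psi_eq]
  refine IsSmallInt.mul (IsSmallInt.mul (IsSmallInt.mul (isSmallInt_detect h σ hD)
    (isSmallInt_half (jacobiSym_e_eq_or h o12)))
    (isSmallInt_intCast (jacobiSym_e_eq_or _ ((hD 0 0).mul (hD 1 0)))))
    (IsSmallInt.add (M := 3) (N := 1) (IsSmallInt.sub (M := 2) (N := 1)
      (IsSmallInt.sub (M := 1) (N := 1) (IsSmallInt.neg ?_) ?_) ?_) ?_) <;>
  exact (isSmallInt_ind _).mul (isSmallInt_ind _)

/-! ### The sum of the weights -/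

theorem linkedSum_eq (w : Fin 3 → Fin 2 → H) (x : ℝ) :
    linkedSum w x = ∑ D ∈ (naturalTuples_finite x).toFinset,
      if (∀ i j, ((D i j : ℕ) : ZMod 8) = (w i j : ZMod 8)) then
        ((2 : ℝ) ^ omega D)⁻¹ * (g D : ℝ) else 0 := by
  rw [linkedSum, finsum_mem_eq_finite_toFinset_sum _
    ((naturalTuples_finite x).subset (Set.sep_subset _ _)), ← Finset.sum_filter]
  refine Finset.sum_congr ?_ fun _ _ => rfl
  ext D
  simp

/-- Each odd tuple lies in exactly one class of `H⁶`, so the sum over classes collapses. -/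
theorem sum_f_linkedSum (h : FieldType) (σ : ℤˣ × ℤˣ) (x : ℝ) :
    ∑ w : Fin 3 → Fin 2 → H, (f h σ w : ℝ) * linkedSum w x =
      ∑ D ∈ (naturalTuples_finite x).toFinset,
        (fTuple h σ D : ℝ) * (((2 : ℝ) ^ omega D)⁻¹ * (g D : ℝ)) := by
  simp only [linkedSum_eq, Finset.mul_sum]
  rw [Finset.sum_comm]
  refine Finset.sum_congr rfl fun D hD => ?_
  rw [Set.Finite.mem_toFinset] at hD
  have hodd : ∀ i j, Odd (D i j) := fun i j => (hD.1 i j).1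
  have hcop : ∀ i j, (D i j).Coprime 8 := fun i j =>
    (Nat.coprime_two_right.mpr (hodd i j)).pow_right 3
  let w₀ : Fin 3 → Fin 2 → H := fun i j => ZMod.unitOfCoprime (D i j) (hcop i j)
  have hw₀ : ∀ i j, ((D i j : ℕ) : ZMod 8) = (w₀ i j : ZMod 8) := fun i j =>
    (ZMod.coe_unitOfCoprime _ _).symm
  rw [Finset.sum_eq_single w₀]
  · rw [if_pos hw₀, f_eq_fTuple h σ hodd hw₀]
  · intro w _ hw
    rw [if_neg, mul_zero]
    intro hw'
    apply hw
    funext i j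
    exact Units.ext ((hw' i j).symm.trans (hw₀ i j))
  · intro hw; exact absurd (Finset.mem_univ _) hw

theorem sum_weights (h : FieldType) (σ : ℤˣ × ℤˣ) (x : ℝ) :
    ∑ w : Fin 3 → Fin 2 → H, (f h σ w : ℝ) * linkedSum w x + psiSum h σ x =
      ∑ t ∈ (rowTriples_finite x).toFinset,
        ((detectRow h σ t.1 t.2.1 t.2.2 * ind (SomeConic h σ t.1 t.2.1 t.2.2) : ℚ) : ℝ) := by
  rw [sum_f_linkedSum, psiSum, finsum_mem_eq_finite_toFinset_sum _ (naturalTuples_finite x),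
    ← Finset.sum_add_distrib, sum_naturalTuples]
  refine Finset.sum_congr rfl ?_
  rintro ⟨a, b, c⟩ ht
  rw [Set.Finite.mem_toFinset] at ht
  obtain ⟨hodd, hsq, -⟩ := ht
  have key := congrArg (fun q : ℚ => ((2 : ℝ) ^ (a * b * c).primeFactors.card)⁻¹ * (q : ℝ))
    (sum_splitTuple h σ hodd hsq)
  simp only [Rat.cast_sum, Rat.cast_mul, Rat.cast_add, Rat.cast_intCast, Rat.cast_pow,
    Rat.cast_ofNat] at key ⊢
  have h2 : ((2 : ℝ) ^ (a * b * c).primeFactors.card) ≠ 0 := by positivity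
  rw [show ((2 : ℝ) ^ (a * b * c).primeFactors.card)⁻¹ *
      ((detectRow h σ a b c : ℝ) * 2 ^ (a * b * c).primeFactors.card *
        (ind (SomeConic h σ a b c) : ℝ)) =
      (detectRow h σ a b c : ℝ) * (ind (SomeConic h σ a b c) : ℝ) by field_simp] at key
  rw [← key]
  simp only [Finset.mul_sum]
  refine Finset.sum_congr rfl fun k hk => Finset.sum_congr rfl fun l hl =>
    Finset.sum_congr rfl fun m hm => ?_
  rw [omega, prodAll_splitTuple (Nat.dvd_of_mem_divisors hk) (Nat.dvd_of_mem_divisors hl)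
    (Nat.dvd_of_mem_divisors hm)]
  ring

/-! ### Admissible triples and `D₁, D₂, D₃` -/

/-- The triple `(d₁, d₂, d₃)` attached to `(D₁, D₂, D₃)`. -/
def radicands (h : FieldType) (σ : ℤˣ × ℤˣ) (t : ℕ × ℕ × ℕ) : ℤ × ℤ × ℤ :=
  (radicand₁ h σ t.1 t.2.2, radicand₂ h σ t.2.1 t.2.2, radicand₃ σ t.1 t.2.1)

theorem natAbs_radicand₁ (h : FieldType) (σ : ℤˣ × ℤˣ) (a c : ℕ) :
    (radicand₁ h σ a c).natAbs = h.e * (a * c) := by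
  rw [radicand₁, natAbs_unit_mul]; exact_mod_cast Int.natAbs_natCast _

theorem natAbs_radicand₂ (h : FieldType) (σ : ℤˣ × ℤˣ) (b c : ℕ) :
    (radicand₂ h σ b c).natAbs = h.e * (b * c) := by
  rw [radicand₂, natAbs_unit_mul]; exact_mod_cast Int.natAbs_natCast _

theorem natAbs_radicand₃ (σ : ℤˣ × ℤˣ) (a b : ℕ) : (radicand₃ σ a b).natAbs = a * b := by
  rw [radicand₃, mul_assoc, natAbs_unit_mul, natAbs_unit_mul]
  exact_mod_cast Int.natAbs_natCast _

theorem unit_sq (ε : ℤˣ) : (ε : ℤ) ^ 2 = 1 := by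
  rcases Int.units_eq_one_or ε with rfl | rfl <;> simp

theorem sign_unit_mul (ε : ℤˣ) {n : ℤ} (hn : 0 < n) : Int.sign (ε * n) = ε := by
  rw [Int.sign_mul, Int.sign_eq_one_of_pos hn, mul_one]
  rcases Int.units_eq_one_or ε with rfl | rfl <;> rfl

theorem FieldType.e_pos (h : FieldType) : 0 < h.e := by rcases h.e_eq with he | he <;> omega

theorem FieldType.T_eq (h : FieldType) : h.T = h.tau * h.e ^ 2 := by cases h <;> rfl

theorem mul_radicands (h : FieldType) (σ : ℤˣ × ℤˣ) (a b c : ℕ) :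
    radicand₁ h σ a c * radicand₂ h σ b c * radicand₃ σ a b =
      ((h.e ^ 2 * (a * b * c) ^ 2 : ℕ) : ℤ) := by
  rw [radicand₁, radicand₂, radicand₃]
  push_cast
  linear_combination (σ.2 : ℤ) ^ 2 * h.e ^ 2 * (a * b * c) ^ 2 * unit_sq σ.1 +
    (h.e : ℤ) ^ 2 * (a * b * c) ^ 2 * unit_sq σ.2

theorem eq_one_of_coprime_of_dvd {m n : ℕ} (h : m.Coprime n) (hd : m ∣ n) : m = 1 := by
  rw [← Nat.gcd_eq_left hd]; exact h

/-- Coprimality shows that a radicand equal to `1`, or two equal radicands, would require two of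
`D₁, D₂, D₃` to be `1`. -/
theorem admissible_radicands (h : FieldType) (σ : ℤˣ × ℤˣ) {a b c : ℕ} (hodd : Odd (a * b * c))
    (hsq : Squarefree (a * b * c)) (hab : ¬ (a = 1 ∧ b = 1)) (hac : ¬ (a = 1 ∧ c = 1))
    (hbc : ¬ (b = 1 ∧ c = 1)) :
    Admissible (radicand₁ h σ a c) (radicand₂ h σ b c) (radicand₃ σ a b) := by
  obtain ⟨⟨oa, ob⟩, oc⟩ : (Odd a ∧ Odd b) ∧ Odd c := by simpa [Nat.odd_mul] using hodd
  have hs := squarefree_e_mul hodd hsq h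
  have cab_c := Nat.coprime_of_squarefree_mul hsq
  have cab : a.Coprime b := Nat.coprime_of_squarefree_mul hsq.of_mul_left
  have cac : a.Coprime c := cab_c.coprime_mul_right
  have cbc : b.Coprime c := cab_c.coprime_mul_left
  have e0 := h.e_pos
  have a0 := oa.pos
  have b0 := ob.pos
  have c0 := oc.pos
  have n₁ := natAbs_radicand₁ h σ a c
  have n₂ := natAbs_radicand₂ h σ b c
  have n₃ := natAbs_radicand₃ σ a b
  -- Excludes `d₁ = d₃` and `d₂ = d₃`: cancelling gives `e D₃ = x`, with `x` odd and prime to `D₃`.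
  have third : ∀ {x y : ℕ}, Odd x → x.Coprime c → h.e * (y * c) = y * x → 0 < y →
      x = 1 ∧ c = 1 := by
    intro x y ox hxc he hy
    have h1 : h.e * c = x := Nat.eq_of_mul_eq_mul_left hy (by rw [← he]; ring)
    have hc1 : c = 1 := eq_one_of_coprime_of_dvd hxc.symm ⟨h.e, by rw [← h1]; ring⟩
    rw [hc1, mul_one] at h1
    refine ⟨?_, hc1⟩
    rcases h.e_eq with he | he
    · omega
    · rw [← h1, he] at ox; exact absurd ox (by decide)
  refine ⟨?_, ?_, ?_, ?_, ?_, ?_, ?_, ?_, ?_, ?_⟩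
  · rw [← Int.squarefree_natAbs, n₁]
    exact hs.squarefree_of_dvd ⟨b, by ring⟩
  · rw [← Int.squarefree_natAbs, n₂]
    exact hs.squarefree_of_dvd ⟨a, by ring⟩
  · rw [← Int.squarefree_natAbs, n₃]
    exact hsq.of_mul_left
  · intro h1
    rw [h1] at n₁
    have := Nat.eq_one_of_mul_eq_one_left n₁.symm
    exact hac ⟨Nat.eq_one_of_mul_eq_one_right this, Nat.eq_one_of_mul_eq_one_left this⟩
  · intro h1
    rw [h1] at n₂
    have := Nat.eq_one_of_mul_eq_one_left n₂.symm
    exact hbc ⟨Nat.eq_one_of_mul_eq_one_right this, Nat.eq_one_of_mul_eq_one_left this⟩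
  · intro h1
    rw [h1] at n₃
    exact hab ⟨Nat.eq_one_of_mul_eq_one_right n₃.symm, Nat.eq_one_of_mul_eq_one_left n₃.symm⟩
  · intro h1
    rw [h1, n₂] at n₁
    have h2 := Nat.eq_of_mul_eq_mul_right c0 (Nat.eq_of_mul_eq_mul_left e0 n₁)
    rw [h2, Nat.coprime_self] at cab
    exact hab ⟨cab, by rw [h2, cab]⟩
  · intro h1
    rw [h1, n₃] at n₁
    exact hbc (third ob cbc n₁.symm a0)
  · intro h1
    rw [h1, n₃] at n₂
    exact hac (third oa cac (n₂.symm.trans (mul_comm a b)) b0)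
  · have hg : Int.gcd (radicand₁ h σ a c) (radicand₂ h σ b c) = h.e * c := by
      rw [Int.gcd_eq_natAbs, n₁, n₂, show h.e * (a * c) = h.e * c * a by ring,
        show h.e * (b * c) = h.e * c * b by ring, Nat.gcd_mul_left, cab.gcd_eq_one, mul_one]
    rw [hg, radicand₁, radicand₂, radicand₃]
    push_cast
    ring

theorem radicands_injective {h : FieldType} {σ : ℤˣ × ℤˣ} {t t' : ℕ × ℕ × ℕ}
    (ht : 0 < t.1 * t.2.1 * t.2.2) (heq : radicands h σ t = radicands h σ t') : t = t' := by
  obtain ⟨a, b, c⟩ := t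
  obtain ⟨a', b', c'⟩ := t'
  simp only [radicands, Prod.mk.injEq] at heq ht
  obtain ⟨h1, h2, h3⟩ := heq
  replace h1 := congrArg Int.natAbs h1
  replace h2 := congrArg Int.natAbs h2
  replace h3 := congrArg Int.natAbs h3
  rw [natAbs_radicand₁, natAbs_radicand₁] at h1
  rw [natAbs_radicand₂, natAbs_radicand₂] at h2
  rw [natAbs_radicand₃, natAbs_radicand₃] at h3
  replace h1 := Nat.eq_of_mul_eq_mul_left h.e_pos h1
  replace h2 := Nat.eq_of_mul_eq_mul_left h.e_pos h2
  have ha : 0 < a := Nat.pos_of_mul_pos_right (Nat.pos_of_mul_pos_right ht)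
  have hb : 0 < b := Nat.pos_of_mul_pos_left (Nat.pos_of_mul_pos_right ht)
  have hc : 0 < c := Nat.pos_of_mul_pos_left ht
  have haa : a = a' := by
    -- The absolute values give `ac`, `bc`, `ab`, and these determine `a²`.
    have : (b * c) * a ^ 2 = (b * c) * a' ^ 2 := by
      calc (b * c) * a ^ 2 = (a * b) * (a * c) := by ring
        _ = (b' * c') * a' ^ 2 := by rw [h1, h3]; ring
        _ = _ := by rw [h2]
    exact Nat.pow_left_injective two_ne_zero (Nat.eq_of_mul_eq_mul_left (by positivity) this)
  subst haa
  rw [Nat.eq_of_mul_eq_mul_left ha h1, Nat.eq_of_mul_eq_mul_left ha h3]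

theorem radicands_mem_triples {h : FieldType} {σ : ℤˣ × ℤˣ} {X : ℝ} {t : ℕ × ℕ × ℕ}
    (ht : t ∈ rowTriples (X / h.T))
    (hc : h.Congr (radicands h σ t).1 (radicands h σ t).2.1 (radicands h σ t).2.2)
    (ha : Admissible (radicands h σ t).1 (radicands h σ t).2.1 (radicands h σ t).2.2) :
    radicands h σ t ∈ triples h σ X := by
  obtain ⟨a, b, c⟩ := t
  obtain ⟨hodd, hsq, hX⟩ := ht
  obtain ⟨⟨oa, ob⟩, oc⟩ : (Odd a ∧ Odd b) ∧ Odd c := by simpa [Nat.odd_mul] using hodd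
  have a0 := oa.pos
  have b0 := ob.pos
  have c0 := oc.pos
  have e0 := h.e_pos
  refine ⟨ha, hc, ?_, sign_unit_mul _ (by positivity), sign_unit_mul _ (by positivity)⟩
  have hT : (0 : ℝ) < h.T := by cases h <;> norm_num [FieldType.T, FieldType.tau]
  rw [le_div_iff₀ hT, h.T_eq] at hX
  simp only [radicands, mul_radicands]
  push_cast at hX ⊢
  linarith

/-- The preimage is `D₃ = gcd(d₁, d₂) / e`, with `D₁` and `D₂` the absolute values of the cofactors
of the gcd. -/
theorem exists_radicands_eq {h : FieldType} {σ : ℤˣ × ℤˣ} {X : ℝ} {d : ℤ × ℤ × ℤ}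
    (hd : d ∈ triples h σ X) : ∃ t ∈ rowTriples (X / h.T), radicands h σ t = d := by
  obtain ⟨d₁, d₂, d₃⟩ := d
  obtain ⟨⟨s₁, s₂, s₃, -, -, -, -, -, -, hg⟩, hc, hX, hσ₁, hσ₂⟩ := hd
  simp only at s₁ s₂ s₃ hg hc hX hσ₁ hσ₂
  have gpos : 0 < Int.gcd d₁ d₂ := Int.gcd_pos_of_ne_zero_left _ s₁.ne_zero
  obtain ⟨x, y, hxy, hx, hy⟩ := Int.exists_gcd_one gpos
  set G := Int.gcd d₁ d₂ with hG
  have hd₃ : d₃ = x * y := by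
    have hG0 : (G : ℤ) ^ 2 ≠ 0 := by positivity
    apply mul_right_cancel₀ hG0
    rw [hg, hx, hy]; ring
  -- The residues modulo `4` say that `d₁` and `d₂` are both odd or both exactly divisible by `2`.
  have hGe : ∃ c : ℕ, G = h.e * c ∧ Odd (x * c) ∧ Odd (y * c) := by
    have hcases : (h.e = 1 ∧ d₁ % 2 = 1 ∧ d₂ % 2 = 1) ∨ (h.e = 2 ∧ d₁ % 4 = 2 ∧ d₂ % 4 = 2) := by
      rcases h with _ | _ | _ | _ <;> obtain ⟨h1, h2, -⟩ := hc <;> rw [Int.ModEq] at h1 h2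
      · exact Or.inl ⟨rfl, by omega, by omega⟩
      · exact Or.inr ⟨rfl, by omega, by omega⟩
      · exact Or.inl ⟨rfl, by omega, by omega⟩
      · exact Or.inr ⟨rfl, by omega, by omega⟩
    rcases hcases with ⟨he, h1, h2⟩ | ⟨he, h1, h2⟩
    · exact ⟨G, by rw [he, one_mul], by rwa [← hx, Int.odd_iff], by rwa [← hy, Int.odd_iff]⟩
    · have h2G : 2 ∣ G := Int.dvd_gcd (Int.dvd_of_emod_eq_zero (by omega))
        (Int.dvd_of_emod_eq_zero (by omega))
      obtain ⟨c, hc⟩ := h2G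
      have e1 : d₁ = 2 * (x * c) := by rw [hx, hc]; push_cast; ring
      have e2 : d₂ = 2 * (y * c) := by rw [hy, hc]; push_cast; ring
      exact ⟨c, by rw [he, hc], by rw [Int.odd_iff]; omega, by rw [Int.odd_iff]; omega⟩
  obtain ⟨c, hGc, oxc, oyc⟩ := hGe
  have gpos' : (0 : ℤ) < G := by exact_mod_cast gpos
  have hσx : x = σ.1 * (x.natAbs : ℤ) := by
    rw [← hσ₁, hx, Int.sign_mul, Int.sign_eq_one_of_pos gpos', mul_one, Int.sign_mul_natAbs]
  have hσy : y = σ.2 * (y.natAbs : ℤ) := by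
    rw [← hσ₂, hy, Int.sign_mul, Int.sign_eq_one_of_pos gpos', mul_one, Int.sign_mul_natAbs]
  have r₁ : radicand₁ h σ x.natAbs c = d₁ := by
    rw [radicand₁, hx, hGc]; simp only [Nat.cast_mul]; linear_combination -(h.e : ℤ) * c * hσx
  have r₂ : radicand₂ h σ y.natAbs c = d₂ := by
    rw [radicand₂, hy, hGc]; simp only [Nat.cast_mul]; linear_combination -(h.e : ℤ) * c * hσy
  have r₃ : radicand₃ σ x.natAbs y.natAbs = d₃ := by
    rw [radicand₃, hd₃]; linear_combination -(σ.2 : ℤ) * y.natAbs * hσx - x * hσy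
  have n₁ := natAbs_radicand₁ h σ x.natAbs c
  have n₂ := natAbs_radicand₂ h σ y.natAbs c
  have n₃ := natAbs_radicand₃ σ x.natAbs y.natAbs
  rw [r₁] at n₁
  rw [r₂] at n₂
  rw [r₃] at n₃
  rw [← Int.squarefree_natAbs] at s₁ s₂ s₃
  rw [n₁] at s₁
  rw [n₂] at s₂
  rw [n₃] at s₃
  have oxc' : Odd (x.natAbs * c) := by simpa [Int.natAbs_mul] using Int.natAbs_odd.mpr oxc
  have oyc' : Odd (y.natAbs * c) := by simpa [Int.natAbs_mul] using Int.natAbs_odd.mpr oyc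
  refine ⟨(x.natAbs, y.natAbs, c), ⟨?_, ?_, ?_⟩, ?_⟩
  · exact ((Nat.odd_mul.mp oxc').1.mul (Nat.odd_mul.mp oyc').1).mul (Nat.odd_mul.mp oxc').2
  · have h1 := s₁.of_mul_right
    have h2 := s₂.of_mul_right
    exact (Nat.squarefree_mul ((Nat.coprime_of_squarefree_mul h1).mul_left
      (Nat.coprime_of_squarefree_mul h2))).mpr ⟨s₃, h1.of_mul_right⟩
  · have hT : (0 : ℝ) < h.T := by cases h <;> norm_num [FieldType.T, FieldType.tau]
    rw [le_div_iff₀ hT, h.T_eq]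
    rw [← r₁, ← r₂, ← r₃, mul_radicands, Int.cast_natCast] at hX
    simp only [Nat.cast_mul, Nat.cast_pow] at hX ⊢
    linarith
  · simp only [radicands, r₁, r₂, r₃]

/-! ### Counting -/

/-- With two entries equal to `1`, the third is the whole product and is at most `√x`; there are
three positions for it. -/
theorem card_degenerate_le {x : ℝ} (S : Finset (ℕ × ℕ × ℕ))
    (hS : ∀ t ∈ S, t ∈ rowTriples x ∧
      ((t.1 = 1 ∧ t.2.1 = 1) ∨ (t.1 = 1 ∧ t.2.2 = 1) ∨ (t.2.1 = 1 ∧ t.2.2 = 1))) :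
    (S.card : ℝ) ≤ 3 * Real.sqrt x := by
  classical
  let I := Finset.Icc 1 ⌊Real.sqrt x⌋₊
  have hsub : S ⊆ I.image (fun n => (1, 1, n)) ∪ (I.image (fun n => (1, n, 1)) ∪
      I.image (fun n => (n, 1, 1))) := by
    rintro ⟨a, b, c⟩ ht
    obtain ⟨⟨hodd, -, hle⟩, h⟩ := hS _ ht
    simp only at hodd hle h
    have mem : ∀ n : ℕ, n = a * b * c → n ∈ I := by
      rintro n rfl
      refine Finset.mem_Icc.mpr ⟨hodd.pos, Nat.le_floor (Real.le_sqrt_of_sq_le ?_)⟩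
      exact_mod_cast hle
    simp only [Finset.mem_union, Finset.mem_image]
    rcases h with ⟨rfl, rfl⟩ | ⟨rfl, rfl⟩ | ⟨rfl, rfl⟩
    · exact Or.inl ⟨c, mem c (by ring), rfl⟩
    · exact Or.inr (Or.inl ⟨b, mem b (by ring), rfl⟩)
    · exact Or.inr (Or.inr ⟨a, mem a (by ring), rfl⟩)
  have hcard : S.card ≤ 3 * ⌊Real.sqrt x⌋₊ := by
    have hI : I.card = ⌊Real.sqrt x⌋₊ := by simp [I]
    have h1 := Finset.card_image_le (s := I) (f := fun n => ((1, 1, n) : ℕ × ℕ × ℕ))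
    have h2 := Finset.card_image_le (s := I) (f := fun n => ((1, n, 1) : ℕ × ℕ × ℕ))
    have h3 := Finset.card_image_le (s := I) (f := fun n => ((n, 1, 1) : ℕ × ℕ × ℕ))
    have h4 := (Finset.card_le_card hsub).trans ((Finset.card_union_le _ _).trans
      (Nat.add_le_add_left (Finset.card_union_le _ _) _))
    omega
  calc (S.card : ℝ) ≤ ((3 * ⌊Real.sqrt x⌋₊ : ℕ) : ℝ) := by exact_mod_cast hcard
    _ = 3 * (⌊Real.sqrt x⌋₊ : ℝ) := by push_cast; ring
    _ ≤ 3 * Real.sqrt x := by gcongr; exact Nat.floor_le (Real.sqrt_nonneg x)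

theorem indD4_radicands {h : FieldType} {σ : ℤˣ × ℤˣ} {t : ℕ × ℕ × ℕ}
    (hodd : Odd (t.1 * t.2.1 * t.2.2)) (hsq : Squarefree (t.1 * t.2.1 * t.2.2))
    (ha : Admissible (radicands h σ t).1 (radicands h σ t).2.1 (radicands h σ t).2.2) :
    indD4 (radicands h σ t) = (ind (SomeConic h σ t.1 t.2.1 t.2.2) : ℚ) := by
  have hiff : AdmitsExtension (DihedralGroup 4) (multiquadraticField (radicands h σ t).1
      (radicands h σ t).2.1 (radicands h σ t).2.2) ↔ SomeConic h σ t.1 t.2.1 t.2.2 := by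
    rw [admitsExtension_dihedral_iff ha]
    simp only [radicands]
    rw [conicSolvable_radicand₁₂ hodd hsq, conicSolvable_radicand₁₃ hodd hsq,
      conicSolvable_radicand₂₃ hodd hsq, SomeConic]
  by_cases hs : SomeConic h σ t.1 t.2.1 t.2.2
  · rw [indD4, if_pos (hiff.mpr hs), ind_eq_one hs, Rat.cast_one]
  · rw [indD4, if_neg fun h => hs (hiff.mp h), ind_eq_zero hs, Rat.cast_zero]

open Classical in
theorem sum_indD4 (h : FieldType) (σ : ℤˣ × ℤˣ) (X : ℝ) :
    ∑ᶠ d ∈ triples h σ X, indD4 d =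
      ∑ t ∈ (rowTriples_finite (X / h.T)).toFinset with
        h.Congr (radicands h σ t).1 (radicands h σ t).2.1 (radicands h σ t).2.2 ∧
        Admissible (radicands h σ t).1 (radicands h σ t).2.1 (radicands h σ t).2.2,
        ((ind (SomeConic h σ t.1 t.2.1 t.2.2) : ℚ) : ℝ) := by
  rw [finsum_mem_eq_finite_toFinset_sum _ (triples_finite h σ X)]
  symm
  refine Finset.sum_bij (fun t _ => radicands h σ t) ?_ ?_ ?_ ?_
  · intro t ht
    rw [Finset.mem_filter, Set.Finite.mem_toFinset] at ht
    rw [Set.Finite.mem_toFinset]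
    exact radicands_mem_triples ht.1 ht.2.1 ht.2.2
  · intro t ht t' _ heq
    rw [Finset.mem_filter, Set.Finite.mem_toFinset] at ht
    exact radicands_injective ht.1.1.pos heq
  · intro d hd
    rw [Set.Finite.mem_toFinset] at hd
    obtain ⟨t, ht, rfl⟩ := exists_radicands_eq hd
    exact ⟨t, by
      rw [Finset.mem_filter, Set.Finite.mem_toFinset]
      exact ⟨ht, hd.2.1, hd.1⟩, rfl⟩
  · intro t ht
    rw [Finset.mem_filter, Set.Finite.mem_toFinset] at ht
    exact (indD4_radicands ht.1.1 ht.1.2.1 ht.2.2).symm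

/-- Both sides sum the same indicator over triples satisfying the congruences, but the field count
also requires admissibility. The difference is supported on triples with two entries equal to `1`.
-/
theorem abs_sum_sub_le (h : FieldType) (σ : ℤˣ × ℤˣ) (X : ℝ) :
    |∑ᶠ d ∈ triples h σ X, indD4 d -
      (∑ w : Fin 3 → Fin 2 → H, (f h σ w : ℝ) * linkedSum w (X / h.T) +
        psiSum h σ (X / h.T))| ≤ 3 * Real.sqrt (X / h.T) := by
  classical
  set R := (rowTriples_finite (X / h.T)).toFinset with hR
  let C : ℕ × ℕ × ℕ → Prop := fun t =>
    h.Congr (radicands h σ t).1 (radicands h σ t).2.1 (radicands h σ t).2.2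
  let A : ℕ × ℕ × ℕ → Prop := fun t =>
    Admissible (radicands h σ t).1 (radicands h σ t).2.1 (radicands h σ t).2.2
  let F : ℕ × ℕ × ℕ → ℝ := fun t => ((ind (SomeConic h σ t.1 t.2.1 t.2.2) : ℚ) : ℝ)
  have hF : ∀ t, 0 ≤ F t ∧ F t ≤ 1 := by
    intro t
    by_cases hs : SomeConic h σ t.1 t.2.1 t.2.2 <;> simp [F, ind, hs]
  have h1 : ∑ᶠ d ∈ triples h σ X, indD4 d = ∑ t ∈ R with C t ∧ A t, F t := sum_indD4 h σ X
  have h2 : ∑ w : Fin 3 → Fin 2 → H, (f h σ w : ℝ) * linkedSum w (X / h.T) +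
      psiSum h σ (X / h.T) = ∑ t ∈ R with C t, F t := by
    rw [sum_weights, Finset.sum_filter]
    refine Finset.sum_congr rfl fun t ht => ?_
    rw [hR, Set.Finite.mem_toFinset] at ht
    rw [detectRow_eq h σ ht.1]
    change (((if C t then 1 else 0) * ind (SomeConic h σ t.1 t.2.1 t.2.2) : ℚ) : ℝ) = _
    by_cases hC : C t
    · rw [if_pos hC, if_pos hC, one_mul]
    · rw [if_neg hC, if_neg hC, zero_mul, Rat.cast_zero]
  have h3 : ∑ t ∈ R with C t, F t =
      ∑ t ∈ R with C t ∧ A t, F t + ∑ t ∈ R with C t ∧ ¬ A t, F t := by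
    rw [← Finset.sum_filter_add_sum_filter_not (R.filter C) A, Finset.filter_filter,
      Finset.filter_filter]
  rw [h1, h2, h3, sub_add_cancel_left, abs_neg, abs_of_nonneg (Finset.sum_nonneg fun t _ => (hF t).1)]
  calc ∑ t ∈ R with C t ∧ ¬ A t, F t ≤ ∑ t ∈ R with C t ∧ ¬ A t, (1 : ℝ) :=
        Finset.sum_le_sum fun t _ => (hF t).2
    _ = ((R.filter fun t => C t ∧ ¬ A t).card : ℝ) := by simp
    _ ≤ 3 * Real.sqrt (X / h.T) := by
      refine card_degenerate_le _ fun t ht => ?_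
      rw [Finset.mem_filter, hR, Set.Finite.mem_toFinset] at ht
      refine ⟨ht.1, ?_⟩
      by_contra! hcon
      refine ht.2.2 (admissible_radicands h σ ht.1.1 ht.1.2.1 ?_ ?_ ?_)
      exacts [fun h => hcon.1 h.1 h.2, fun h => hcon.2.1 h.1 h.2, fun h => hcon.2.2 h.1 h.2]

end BiquadraticD4

theorem mainTheorem10 :
    (∃ C : ℝ, ∀ (h : BiquadraticD4.FieldType) (σ : ℤˣ × ℤˣ) (X : ℝ), 1 ≤ X →
      |BiquadraticD4.countD4 h σ X -
        (1 / (h.m : ℝ) * ∑ w : Fin 3 → Fin 2 → BiquadraticD4.H,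
            (BiquadraticD4.f h σ w : ℝ) * BiquadraticD4.linkedSum w (X / h.T) +
          1 / (h.m : ℝ) * BiquadraticD4.psiSum h σ (X / h.T))| ≤ C * Real.sqrt X) ∧
    (∀ (h : BiquadraticD4.FieldType) (σ : ℤˣ × ℤˣ) (w : Fin 3 → Fin 2 → BiquadraticD4.H),
      ∃ n : ℤ, BiquadraticD4.f h σ w = n ∧ |n| ≤ 3) ∧
    (∀ (h : BiquadraticD4.FieldType) (σ : ℤˣ × ℤˣ) (D : BiquadraticD4.Tuple),
      (∀ i j, Odd (D i j)) → ∃ n : ℤ, BiquadraticD4.r h σ D = n ∧ |n| ≤ 4) := by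
  -- The constant is the `3` of the degenerate count; `m_h ≥ 1` and `T_h ≥ 1` only help.
  refine ⟨⟨3, fun h σ X hX => ?_⟩, BiquadraticD4.isSmallInt_f, fun h σ D hD =>
    BiquadraticD4.isSmallInt_r h σ hD⟩
  have hm : |1 / (h.m : ℝ)| ≤ 1 := by
    cases h <;> norm_num [BiquadraticD4.FieldType.m, abs_of_pos]
  have hT : (1 : ℝ) ≤ h.T := by
    cases h <;> norm_num [BiquadraticD4.FieldType.T, BiquadraticD4.FieldType.tau]
  rw [BiquadraticD4.countD4, ← mul_add, ← mul_sub, abs_mul]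
  calc |1 / (h.m : ℝ)| * _ ≤ 1 * (3 * Real.sqrt (X / h.T)) :=
        mul_le_mul hm (BiquadraticD4.abs_sum_sub_le h σ X) (abs_nonneg _) zero_le_one
    _ ≤ 3 * Real.sqrt X := by
      rw [one_mul]
      gcongr
      exact div_le_self (by linarith) hT
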